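/- Notation. Let $v\in\mathbb R^d\setminus\{0\}$, $\sigma_\xi>0$. A data point $((x_1,x_2),y)\sim\mathcal D$ has $y$ uniform on $\{\pm1\}$, $x_1=y\,v$, $x_2=\xi\sim\mathcal N(0,\sigma_\xi^2H)$ independent of $y$, with $H=I-vv^\top/\|v\|_2^2$. For a real $q>2$ and $\sigma(z)=\max\{0,z\}^q$, the network with filters $\mathbf W=(w_{j,r})_{j\in\{\pm1\},r\in[m]}$, $w_{j,r}\in\mathbb R^d$, is $f(\mathbf W,x)=F_{+1}-F_{-1}$, $F_j=\frac1m\sum_{r=1}^m[\sigma(\langle w_{j,r},x_1\rangle)+\sigma(\langle w_{j,r},x_2\rangle)]$. With $\ell(z)=\log(1+e^{-z})$ the training loss on an i.i.d. sample $D=((x_i,y_i))_{i\le n}$ from $\mathcal D$ is $L_D(\mathbf W)=\frac1n\sum_i\ell(y_if(\mathbf W,x_i))$ and the test loss is $L_{\mathcal D}(\mathbf W)=\mathbb E_{(x,y)\sim\mathcal D}\,\ell(yf(\mathbf W,x))$. Noisy gradient descent is $w_{j,r}^{(t+1)}=w_{j,r}^{(t)}-\eta\,(\nabla_{w_{j,r}}L_D(\mathbf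 W^{(t)})+z_t^{(j,r)})$, where $w^{(0)}_{j,r}\sim\mathcal N(0,\sigma_0^2I_d)$ are independent, the families $(z_t^{(j,r)})_{j,r}$ are i.i.d. over $t$ with $z_t^{(j,r)}\sim\mathcal N(0,\sigma_z^2I_d)$ for every $(j,r)$ (noises of different filters at the same step may be coupled in any way; in particular they may all be equal to one $z_t$, or independent), and data, initialization and noise are independent. Write $X=\sigma_\xi\sqrt d$ (for $\|\xi\|_2$), $\mathrm{SNR}=\|v\|_2/X$, $\mu=\max\{1,\|v\|_2,X\}$, $\sigma_z=\sigma_0/(\eta\mu\sqrt T)$ and $B=\frac{mn\varepsilon\sigma_0}{\eta\mu(\|v\|_2+X)}$, where $\varepsilon>0$ is the privacy budget, $T$ the number of iterations, $\eta>0$ the step size and $\kappa>0$ the target loss. For $C>0$, $k\in\mathbb N$ put $\Lambda=C(1+\log d)^k$ and $T_1=\frac{C\log(10/(\sigma_0X))\,4mn}{0.15^{q-2}\,\eta\, q\,\sigma_0^{q-2}X^q}$. Statement. For every $q>2$, $a\ge1$, $b\in\mathbb N$ there are $C>0$ and $k\in\mathbb N$, depending only on $q,a,b$, such that the following holds for all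 $d,n,m,T,v,\sigma_\xi,\sigma_0,\eta,\varepsilon,\kappa$ satisfying 1. $d\ge\Lambda\, m^{\max\{2,4/(q-2)\}}\,n^{\max\{4,(2q-2)/(q-2)\}}$, $\;n\ge\Lambda$, $\;m\ge\Lambda$; 2. $\Lambda\eta\le\min\{\|v\|_2^{-2},X^{-2}\}$; 3. $\Lambda\max\{\varepsilon^{-1/q}X^{-1},\frac{n}{\sqrt d}\|v\|_2^{-1}\}\le\sigma_0$ and $\Lambda\sigma_0\le\min\{(n\varepsilon)^{-1/q}\|v\|_2^{-1},X^{-1}\}$; 4. $\min\{\mathrm{SNR}^{-1}\varepsilon,\ \mathrm{SNR}^{-q}n^{-1}\}\ge\Lambda$; 5. $\frac{B}{a(1+\log d)^b}\le T\le a(1+\log d)^bB$, $\;T\ge\kappa^{-1}$, $\;T\ge T_1+\frac{1}{2\eta\kappa}\Lambda\big(m^2\sqrt n\,X^{-1}\big)^2$; 6. $\eta\ge\max\big\{\frac{2d\sigma_0^2}{\mu^2T\kappa},\ \frac{2m^2\sqrt n\,X^{-1}\sigma_0}{\mu\sqrt T\,\kappa}\big\}$. With probability at least $1-1/d$ over data,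 initialization and private noise, there is $\widetilde T\le T$ such that $L_D(\mathbf W^{(\widetilde T)})\le\kappa$ and $L_{\mathcal D}(\mathbf W^{(t)})\ge0.1$ for all $0\le t\le\widetilde T$. The bound $0.1$ does not depend on $n$ or $\varepsilon$. -/

import Mathlib

open MeasureTheory ProbabilityTheory
open scoped RealInnerProductSpace

noncomputable section

namespace NoisyCNN

/-- The space of a single patch, `ℝ^d` with the Euclidean norm. -/
abbrev Patch (d : ℕ) := EuclideanSpace ℝ (Fin d)

/-- Labels: `true` stands for `+1`, `false` for `-1`. -/
def sgn (y : Bool) : ℝ := if y then 1 else -1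

/-- A labelled data point `(x, y)` with `x = (x₁, x₂)` made of two patches. -/
abbrev DataPoint (d : ℕ) := (Patch d × Patch d) × Bool

/-- All filters `w_{j,r}`, `j ∈ {+1, -1}`, `r ∈ [m]`, of the network. -/
abbrev Weights (m d : ℕ) := Bool × Fin m → Patch d

/-! ### The data distribution -/

/-- `N(0, s² I_d)`. -/
def isoGaussian (d : ℕ) (s : ℝ) : Measure (Patch d) :=
  (stdGaussian (Patch d)).map (fun x => s • x)

/-- `H x`, where `H = I - v vᵀ / ‖v‖²` projects orthogonally to `v`. -/
def projH {d : ℕ} (v x : Patch d) : Patch d := x - (⟪v, x⟫ / ‖v‖ ^ 2) • v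

/-- `N(0, s² H)`: since `H Hᵀ = H`, it is the law of `s H g` for a standard Gaussian `g`. -/
def dataNoise {d : ℕ} (v : Patch d) (s : ℝ) : Measure (Patch d) :=
  (stdGaussian (Patch d)).map (fun x => s • projH v x)

/-- The law of a fair random sign. -/
def rademacher : Measure Bool :=
  (2⁻¹ : ENNReal) • Measure.dirac true + (2⁻¹ : ENNReal) • Measure.dirac false

/-- The data distribution: `y` is a random sign, `ξ ~ N(0, s² H)` is independent of `y`, and the
data point is `([y v, ξ], y)`. -/
def dataLaw {d : ℕ} (v : Patch d) (s : ℝ) : Measure (DataPoint d) :=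
  (rademacher.prod (dataNoise v s)).map (fun p => ((sgn p.1 • v, p.2), p.1))

/-! ### The network and its losses -/

/-- The polynomial ReLU `max {0, z} ^ q`. -/
def act (q z : ℝ) : ℝ := (max 0 z) ^ q

/-- `F_j(W_j, x)`. -/
def branch {m d : ℕ} (q : ℝ) (W : Weights m d) (j : Bool) (x : Patch d × Patch d) : ℝ :=
  (1 / (m : ℝ)) * ∑ r : Fin m, (act q ⟪W (j, r), x.1⟫ + act q ⟪W (j, r), x.2⟫)

/-- The network `f(W, x) = F_{+1}(W_{+1}, x) - F_{-1}(W_{-1}, x)`. -/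
def net {m d : ℕ} (q : ℝ) (W : Weights m d) (x : Patch d × Patch d) : ℝ :=
  branch q W true x - branch q W false x

/-- The logistic loss `log (1 + exp (-z))`. -/
def logistic (z : ℝ) : ℝ := Real.log (1 + Real.exp (-z))

/-- The training loss: the average logistic loss over the training set `D`. -/
def trainLoss {m d n : ℕ} (q : ℝ) (D : Fin n → DataPoint d) (W : Weights m d) : ℝ :=
  (1 / (n : ℝ)) * ∑ i : Fin n, logistic (sgn (D i).2 * net q W (D i).1)

/-- The test loss: the expected logistic loss at a fresh data point. -/
def testLoss {m d : ℕ} (q : ℝ) (v : Patch d) (s : ℝ) (W : Weights m d) : ℝ :=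
  ∫ p, logistic (sgn p.2 * net q W p.1) ∂(dataLaw v s)

/-! ### Noisy gradient descent -/

/-- The partial gradient of the training loss with respect to the filter `w_{j,r}`, `p = (j, r)`. -/
def trainGrad {m d n : ℕ} (q : ℝ) (D : Fin n → DataPoint d) (W : Weights m d)
    (p : Bool × Fin m) : Patch d :=
  gradient (fun u : Patch d => trainLoss q D (Function.update W p u)) (W p)

/-- Noisy gradient descent with step size `η`, started at `W₀`:
`w_{j,r}^{(t+1)} = w_{j,r}^{(t)} - η (∇_{w_{j,r}} L_D(W^{(t)}) + z_t)`. Here `z t p` is the private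
noise that the filter `p = (j, r)` receives at step `t`. -/
def noisyGD {m d n : ℕ} (q η : ℝ) (D : Fin n → DataPoint d) (W₀ : Weights m d)
    (z : ℕ → Weights m d) : ℕ → Weights m d
  | 0 => W₀
  | t + 1 => fun p =>
      noisyGD q η D W₀ z t p - η • (trainGrad q D (noisyGD q η D W₀ z t) p + z t p)

/-- All the randomness of training: the training set, the initialization, the private noise. -/
abbrev Outcome (n m d : ℕ) :=
  (Fin n → DataPoint d) × Weights m d × (ℕ → Weights m d)

/-- The law of the randomness of training. The `n` data points are i.i.d., the filters are
initialized independently from `N(0, σ₀² I_d)`, the private noises of different steps are i.i.d.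
with law `ν`, and these three sources are independent. -/
def trainLaw {m d : ℕ} (n : ℕ) (v : Patch d) (s σ₀ : ℝ) (ν : Measure (Weights m d))
    [IsProbabilityMeasure ν] : Measure (Outcome n m d) :=
  (Measure.pi fun _ : Fin n => dataLaw v s).prod
    ((Measure.pi fun _ : Bool × Fin m => isoGaussian d σ₀).prod
      (Measure.infinitePi fun _ : ℕ => ν))

/-- The iterate `W^{(t)}`. -/
def iterate {n m d : ℕ} (q η : ℝ) (ω : Outcome n m d) (t : ℕ) : Weights m d :=
  noisyGD q η ω.1 ω.2.1 ω.2.2 t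

/-! ### The noise-memorization regime -/

/-- The parameters of the problem: dimension, sample size, width, number of iterations, exponent of
the activation, signal, standard deviations of the data noise and of the initialization, step size,
privacy budget, target training loss. -/
structure Params where
  d : ℕ
  n : ℕ
  m : ℕ
  T : ℕ
  q : ℝ
  v : Patch d
  σξ : ℝ
  σ₀ : ℝ
  η : ℝ
  ε : ℝ
  κ : ℝ

namespace Params

variable (P : Params)

/-- The typical norm `σ_ξ √d` of the data noise, written `‖ξ‖₂`. -/
def normXi : ℝ := P.σξ * Real.sqrt P.d

/-- The signal-to-noise ratio `‖v‖₂ / ‖ξ‖₂`. -/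
def snr : ℝ := ‖P.v‖ / P.normXi

/-- `μ = max {1, ‖v‖₂, ‖ξ‖₂}`. -/
def mu : ℝ := max 1 (max ‖P.v‖ P.normXi)

/-- The scale of the private noise, `σ_z = σ₀ / (η μ √T)`. -/
def sigmaZ : ℝ := P.σ₀ / (P.η * P.mu * Real.sqrt P.T)

/-- The iteration budget under privacy, up to a polylogarithmic factor:
`m n ε σ₀ / (η μ (‖v‖₂ + ‖ξ‖₂))`. -/
def budget : ℝ := P.m * P.n * P.ε * P.σ₀ / (P.η * P.mu * (‖P.v‖ + P.normXi))

/-- The factor `C (1 + log d) ^ k` hidden in the notations `Õ` and `Ω̃`. -/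
def polylog (C : ℝ) (k : ℕ) : ℝ := C * (1 + Real.log P.d) ^ k

/-- The length of the first stage,
`C log (10 / (σ₀ ‖ξ‖₂)) 4 m n / (0.15^(q-2) η q σ₀^(q-2) ‖ξ‖₂^q)`. -/
def firstStage (C : ℝ) : ℝ :=
  C * Real.log (10 / (P.σ₀ * P.normXi)) * (4 * P.m * P.n) /
    ((0.15 : ℝ) ^ (P.q - 2) * P.η * P.q * P.σ₀ ^ (P.q - 2) * P.normXi ^ P.q)

/-- The noise-memorization regime. `C` and `k` determine the factors hidden in `Õ` and `Ω̃`,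
except that `a` and `b` determine the one in `T = Θ̃(budget)`. -/
structure NoiseMemorization (a : ℝ) (b : ℕ) (C : ℝ) (k : ℕ) : Prop where
  v_ne : P.v ≠ 0
  σξ_pos : 0 < P.σξ
  η_pos : 0 < P.η
  ε_pos : 0 < P.ε
  κ_pos : 0 < P.κ
  /-- `d = Ω̃(m^(2 ∨ 4/(q-2)) n^(4 ∨ (2q-2)/(q-2)))` -/
  dim : P.polylog C k * (P.m : ℝ) ^ max 2 (4 / (P.q - 2)) *
      (P.n : ℝ) ^ max 4 ((2 * P.q - 2) / (P.q - 2)) ≤ P.d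
  /-- `n, m = Ω(polylog d)` -/
  sample : P.polylog C k ≤ P.n
  width : P.polylog C k ≤ P.m
  /-- `η ≤ Õ(min {‖v‖⁻², ‖ξ‖⁻²})` -/
  step : P.polylog C k * P.η ≤ min (‖P.v‖ ^ 2)⁻¹ (P.normXi ^ 2)⁻¹
  /-- `Õ(max {ε^(-1/q) ‖ξ‖⁻¹, (n/√d) ‖v‖⁻¹}) ≤ σ₀` -/
  init_lower : P.polylog C k *
      max (P.ε ^ (-1 / P.q) * P.normXi⁻¹) (P.n / Real.sqrt P.d * ‖P.v‖⁻¹) ≤ P.σ₀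
  /-- `σ₀ ≤ Õ(min {(nε)^(-1/q) ‖v‖⁻¹, ‖ξ‖⁻¹})` -/
  init_upper : P.polylog C k * P.σ₀ ≤
      min ((P.n * P.ε) ^ (-1 / P.q) * ‖P.v‖⁻¹) P.normXi⁻¹
  /-- `min {SNR⁻¹ ε, SNR^(-q) n⁻¹} ≥ Ω̃(1)` -/
  snr_small : P.polylog C k ≤ min (P.snr⁻¹ * P.ε) (P.snr ^ (-P.q) * (P.n : ℝ)⁻¹)
  /-- `T = Θ̃(m n ε σ₀ / (η μ (‖v‖ + ‖ξ‖)))` -/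
  budget_le : P.budget ≤ P.polylog a b * P.T
  le_budget : P.T ≤ P.polylog a b * P.budget
  /-- `T ≥ κ⁻¹` -/
  inv_le : P.κ⁻¹ ≤ P.T
  /-- `T ≥ T₁ + R² / (2 η κ)` with `R² = Õ((m² √n / ‖ξ‖)²)` -/
  time : P.firstStage C +
      P.polylog C k * ((P.m : ℝ) ^ 2 * Real.sqrt P.n / P.normXi) ^ 2 / (2 * P.η * P.κ) ≤ P.T
  /-- `η ≥ max {2 d σ₀² / (μ² T κ), 2 m² √n ‖ξ‖⁻¹ σ₀ / (μ √T κ)}` -/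
  step_lower : max (2 * P.d * P.σ₀ ^ 2 / (P.mu ^ 2 * P.T * P.κ))
      (2 * (P.m : ℝ) ^ 2 * Real.sqrt P.n * P.normXi⁻¹ * P.σ₀ / (P.mu * Real.sqrt P.T * P.κ)) ≤ P.η

end Params

end NoisyCNN

end

/-!
Noisy gradient descent is reduced to a deterministic scalar dynamics that holds on an event of
probability at least `1 - 1/d`, and this dynamics is analysed with explicit rates.

**Reduction.** The gradient of the training loss is a combination of the signal `v` and of the noise
patches `ξ_i`. As `⟪v, ξ_i⟫ = 0` and the `ξ_i` are almost orthogonal, the correlation of a filter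
with `ξ_i` is its initial value, plus the private noise accumulated along `ξ_i`, plus `± ‖ξ_i‖²`
times a nonnegative nondecreasing coefficient (`Traj.mem`), up to a small Gram error. The private
noise, projected on a fixed direction, is a Gaussian random walk whatever the coupling between the
filters; its maximum up to time `T` is bounded by the exponential maximal inequality
(`measure_walk_le`), and by the choice of `σ_z` it is at most of the order of the initialization.
`Typical` lists the properties of data, initialization and noise that are used, `Typical.follows`
derives the scalar dynamics from them, and `trainLaw_not_typical_le` is the union bound.

**Memorization.** In filters of its own label, sample `i` is memorized: the average `level` of the
`q`-th powers of the memorized correlations agrees with the margin up to a constant. Since the slope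
of the logistic loss decays exponentially in the margin, `exp (level)` grows at most linearly in time,
so `level` is at most polylogarithmic throughout (`Follows.level_le_of_inv`). A positive fraction of
the filters has an initial correlation of order `σ₀ ‖ξ‖`; by averaging, one of these carries little of
the other samples, and its correlation grows exponentially until `level ≥ 1`
(`Follows.exists_good`, `Follows.one_le_level`). From then on `level` increases at each step by a
constant multiple of the slope. As `level` is bounded by `M`, the slopes have a sum of at most
`M` divided by that rate (`Follows.sum_slope_le`), and if `T` is large the slope at time `T`, hence
the training loss, is below `κ` (`Follows.margin_ge`).

**No signal.** The correlation with `v` moves only through slopes times `|⟪w, v⟫| ^ (q - 1) ‖v‖²`.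
By the bound on the sum of the slopes and the smallness of `n SNR ^ q`, it stays within a factor two
of its initial bound (`Follows.sig_le_of_inv`). All these estimates are proved together by induction
on time (`Follows.inv`). When the correlations of all filters with `v` are at most `1`, flipping the
label of a fresh point changes the network by a bounded amount while leaving the noise patch alone,
so one of the two labels has margin at most `1`, and the test loss is at least `logistic 1 / 2 ≥ 0.1`
(`testLoss_ge`).

**Parameters.** `exists_ample` chooses the polylogarithmic factor, and `Params.Regime.fits` checks
that the scales of the noise-memorization regime satisfy the inequalities `Scales.Fits` used by the
deterministic analysis. If `κ ≥ 1` the initial weights already have training loss at most `κ`.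
-/

noncomputable section

namespace NoisyCNN

/-! ### Elementary inequalities for real powers -/

/-- A tangent line of `x ↦ x ^ q` lies below the graph. -/
lemma rpow_tangent_le {q x y : ℝ} (hq : 1 < q) (hx : 0 ≤ x) (hy : 0 ≤ y) :
    y ^ q + q * y ^ (q - 1) * (x - y) ≤ x ^ q := by
  rcases hy.eq_or_lt with rfl | hy
  · rw [Real.zero_rpow (by linarith), Real.zero_rpow (by linarith)]
    simpa using Real.rpow_nonneg hx q
  have h := one_add_mul_self_le_rpow_one_add (s := x / y - 1) (p := q)
    (by linarith [div_nonneg hx hy.le]) hq.le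
  rw [show 1 + (x / y - 1) = x / y by ring, Real.div_rpow hx hy.le,
    le_div_iff₀ (Real.rpow_pos_of_pos hy q)] at h
  have e : y ^ q = y ^ (q - 1) * y := by
    rw [← Real.rpow_add_one hy.ne']; ring_nf
  calc y ^ q + q * y ^ (q - 1) * (x - y) = (1 + q * (x / y - 1)) * y ^ q := by
        rw [e]; field_simp
    _ ≤ x ^ q := h

lemma one_add_rpow_le {q u : ℝ} (hq : 0 < q) (hu : 0 ≤ u) :
    (1 + u) ^ q ≤ 2 ^ q * (1 + u ^ q) := by
  have h0 := Real.rpow_nonneg hu q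
  have h2 : (0 : ℝ) < 2 ^ q := by positivity
  rcases le_total u 1 with h | h
  · calc (1 + u) ^ q ≤ 2 ^ q := Real.rpow_le_rpow (by linarith) (by linarith) hq.le
      _ ≤ 2 ^ q * (1 + u ^ q) := by nlinarith
  · calc (1 + u) ^ q ≤ (2 * u) ^ q := Real.rpow_le_rpow (by linarith) (by linarith) hq.le
      _ = 2 ^ q * u ^ q := Real.mul_rpow (by norm_num) hu
      _ ≤ 2 ^ q * (1 + u ^ q) := by nlinarith

lemma self_le_one_add_rpow {q u : ℝ} (hq : 1 < q) (hu : 0 ≤ u) : u ≤ 1 + u ^ q := by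
  have h := rpow_tangent_le hq hu zero_le_one
  have h0 := Real.rpow_nonneg hu q
  simp only [Real.one_rpow] at h
  rcases le_total u 1 with h1 | h1 <;> nlinarith

/-- The derivative of the activation `act q`. -/
def rate (q z : ℝ) : ℝ := q * (max 0 z) ^ (q - 1)

lemma rate_nonneg {q : ℝ} (hq : 2 < q) (z : ℝ) : 0 ≤ rate q z := by
  unfold rate; positivity

lemma rate_mono {q : ℝ} (hq : 2 < q) {x y : ℝ} (h : x ≤ y) : rate q x ≤ rate q y := by
  unfold rate
  gcongr
  linarith

lemma rate_of_nonpos {q : ℝ} (hq : 2 < q) {z : ℝ} (hz : z ≤ 0) : rate q z = 0 := by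
  rw [rate, max_eq_left hz, Real.zero_rpow (by linarith), mul_zero]

lemma rate_of_nonneg (q : ℝ) {z : ℝ} (hz : 0 ≤ z) : rate q z = q * z ^ (q - 1) := by
  rw [rate, max_eq_right hz]

lemma act_nonneg (q z : ℝ) : 0 ≤ act q z := by unfold act; positivity

lemma act_mono {q : ℝ} (hq : 0 ≤ q) {x y : ℝ} (h : x ≤ y) : act q x ≤ act q y := by
  unfold act; gcongr

lemma act_of_nonneg (q : ℝ) {z : ℝ} (hz : 0 ≤ z) : act q z = z ^ q := by
  rw [act, max_eq_right hz]

lemma act_le_of_le {q z δ : ℝ} (hq : 1 < q) (h : z ≤ δ) (h0 : 0 ≤ δ) (h1 : δ ≤ 1) :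
    act q z ≤ δ :=
  calc act q z ≤ act q δ := act_mono (by linarith) h
    _ = δ ^ q := act_of_nonneg q h0
    _ ≤ δ ^ (1 : ℝ) := by
      rcases h0.eq_or_lt with rfl | h0
      · rw [Real.zero_rpow (by linarith), Real.zero_rpow (by norm_num)]
      · exact Real.rpow_le_rpow_of_exponent_ge h0 h1 hq.le
    _ = δ := Real.rpow_one δ

/-- A perturbation of the argument by at most `δ ≤ 1` changes the activation little, relative to
its size. -/
lemma abs_act_sub_le {q u z δ : ℝ} (hq : 2 < q) (hu : 0 ≤ u) (hz : |z - u| ≤ δ) (h1 : δ ≤ 1) :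
    |act q z - u ^ q| ≤ q * 2 ^ q * δ * (1 + u ^ q) := by
  have hδ : 0 ≤ δ := (abs_nonneg _).trans hz
  obtain ⟨hz1, hz2⟩ := abs_le.1 hz
  set w := max 0 z with hw
  have hw0 : 0 ≤ w := le_max_left _ _
  have hw1 : w ≤ u + δ := max_le (by linarith) (by linarith)
  have hw2 : u - δ ≤ w := le_trans (by linarith) (le_max_right _ _)
  have key : ∀ x : ℝ, 0 ≤ x → x ≤ 1 + u → q * x ^ (q - 1) * δ ≤ q * 2 ^ q * δ * (1 + u ^ q) := by
    intro x hx hxu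
    have : x ^ (q - 1) ≤ 2 ^ q * (1 + u ^ q) :=
      calc x ^ (q - 1) ≤ (1 + u) ^ (q - 1) := Real.rpow_le_rpow hx hxu (by linarith)
        _ ≤ (1 + u) ^ q := Real.rpow_le_rpow_of_exponent_le (by linarith) (by linarith)
        _ ≤ _ := one_add_rpow_le (by linarith) hu
    calc q * x ^ (q - 1) * δ = (q * δ) * x ^ (q - 1) := by ring
      _ ≤ (q * δ) * (2 ^ q * (1 + u ^ q)) := by gcongr
      _ = _ := by ring
  have ha : act q z = w ^ q := rfl
  rw [ha, abs_le]
  constructor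
  · have h := rpow_tangent_le (q := q) (by linarith) hw0 hu
    have k := key u hu (by linarith)
    have : 0 ≤ q * u ^ (q - 1) := by positivity
    nlinarith
  · have h := rpow_tangent_le (q := q) (by linarith) hu hw0
    have k := key w hw0 (by linarith)
    have : 0 ≤ q * w ^ (q - 1) := by positivity
    nlinarith

/-- The pointwise inequality that makes the second stage progress at a constant rate. -/
lemma rpow_mul_rate_ge {q u z : ℝ} (hq : 2 < q) (hu : 0 ≤ u) (hz : u - 1 / 4 ≤ z) :
    q * 2 ^ (3 - 2 * q) * (u ^ q - 2 ^ (-q)) ≤ u ^ (q - 1) * rate q z := by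
  rcases le_total u (1 / 2) with h | h
  · have h1 : u ^ q ≤ 2 ^ (-q) := by
      rw [Real.rpow_neg (by norm_num), ← Real.inv_rpow (by norm_num)]
      exact Real.rpow_le_rpow hu (by linarith) (by linarith)
    have h2 : 0 ≤ u ^ (q - 1) * rate q z := mul_nonneg (by positivity) (rate_nonneg hq z)
    have h3 : 0 < q * (2 : ℝ) ^ (3 - 2 * q) := by positivity
    nlinarith
  · have hu0 : 0 < u := by linarith
    have e1 : rate q z ≥ q * (u / 2) ^ (q - 1) := by
      rw [← rate_of_nonneg q (by linarith : 0 ≤ u / 2)]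
      exact rate_mono hq (by linarith)
    have e2 : (u / 2) ^ (q - 1) = u ^ (q - 1) * 2 ^ (1 - q) := by
      rw [Real.div_rpow hu (by norm_num), div_eq_mul_inv, ← Real.rpow_neg (by norm_num)]
      congr 2; ring
    have e3 : u ^ (q - 1) * u ^ (q - 1) = u ^ q * u ^ (q - 2) := by
      rw [← Real.rpow_add hu0, ← Real.rpow_add hu0]; ring_nf
    have e4 : (2 : ℝ) ^ (2 - q) ≤ u ^ (q - 2) := by
      rw [show 2 - q = -(q - 2) by ring, Real.rpow_neg (by norm_num),
        ← Real.inv_rpow (by norm_num)]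
      exact Real.rpow_le_rpow (by norm_num) (by linarith) (by linarith)
    have e5 : (2 : ℝ) ^ (3 - 2 * q) = 2 ^ (1 - q) * 2 ^ (2 - q) := by
      rw [← Real.rpow_add (by norm_num)]; ring_nf
    have p1 : (0 : ℝ) < 2 ^ (1 - q) := by positivity
    have p2 : 0 < u ^ q := by positivity
    have p3 : (0 : ℝ) < 2 ^ (-q) := by positivity
    calc q * 2 ^ (3 - 2 * q) * (u ^ q - 2 ^ (-q)) ≤ q * 2 ^ (3 - 2 * q) * u ^ q := by
          gcongr; linarith
      _ = q * 2 ^ (1 - q) * (u ^ q * 2 ^ (2 - q)) := by rw [e5]; ring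
      _ ≤ q * 2 ^ (1 - q) * (u ^ q * u ^ (q - 2)) := by gcongr
      _ = u ^ (q - 1) * (q * (u / 2) ^ (q - 1)) := by rw [e2, ← e3]; ring
      _ ≤ u ^ (q - 1) * rate q z := by gcongr

end NoisyCNN

namespace NoisyCNN

/-! ### The scalar dynamics -/

/-- The scalar quantities followed along a run of noisy gradient descent: `corr t p i` is the inner
product of the filter `p` with the noise patch of sample `i`, `sig t p` the inner product of the
filter with the signal, `mem t p i ≥ 0` the absolute value of the coefficient of that noise patch in
the filter, and `sq i` the squared norm of the noise patch. -/
structure Traj (n m : ℕ) where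
  label : Fin n → Bool
  corr : ℕ → Bool × Fin m → Fin n → ℝ
  sig : ℕ → Bool × Fin m → ℝ
  mem : ℕ → Bool × Fin m → Fin n → ℝ
  sq : Fin n → ℝ

namespace Traj

variable {n m : ℕ}

/-- The margin `y_i f(W, x_i)`. -/
def margin (X : Traj n m) (q : ℝ) (t : ℕ) (i : Fin n) : ℝ :=
  (1 / (m : ℝ)) * ∑ r, (act q (sgn (X.label i) * X.sig t (X.label i, r)) +
      act q (X.corr t (X.label i, r) i)) -
    (1 / (m : ℝ)) * ∑ r, (act q (sgn (X.label i) * X.sig t (!X.label i, r)) +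
      act q (X.corr t (!X.label i, r) i))

/-- `-ℓ'` at the margin. -/
def slope (X : Traj n m) (q : ℝ) (t : ℕ) (i : Fin n) : ℝ := (1 + Real.exp (X.margin q t i))⁻¹

/-- The memorized part of the correlation of sample `i` with a filter of its own label. -/
def own (X : Traj n m) (t : ℕ) (i : Fin n) (r : Fin m) : ℝ := X.mem t (X.label i, r) i * X.sq i

/-- The memorized part of the margin of sample `i`. -/
def level (X : Traj n m) (q : ℝ) (t : ℕ) (i : Fin n) : ℝ := (1 / (m : ℝ)) * ∑ r, X.own t i r ^ q

end Traj

/-- The numerical data of the deterministic analysis: exponent, normalized step size, a priori bound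
`M` for the memorized margins, bound `δ` for all deviations, bound `B` for initial correlations and
for the private noise, scale `x₀` of the useful initial correlations, bound `R` for the Gram matrix,
bounds `A₀` and `A` for the signal, squared norm `V` of the signal vector, bounds `slo`, `shi` for
the squared norms of the noise patches, proportion `p₁` of filters with a useful initial
correlation, lengths of the phases. -/
structure Scales where
  q : ℝ
  h : ℝ
  M : ℝ
  δ : ℝ
  B : ℝ
  x₀ : ℝ
  R : ℝ
  A₀ : ℝ
  A : ℝ
  V : ℝ
  slo : ℝ
  shi : ℝ
  p₁ : ℝ
  T : ℕ
  t₁ : ℕ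
  t₂ : ℕ

/-- The rate constant of the second stage. -/
def lateRate (q : ℝ) : ℝ := q ^ 2 * 2 ^ (2 - 2 * q)

/-- The largest possible increment of a memorized margin in one step. -/
def Scales.incr (N : Scales) (m : ℕ) : ℝ :=
  N.q ^ 2 * 4 ^ N.q * (N.h * N.shi) * (m * (1 + N.M) ^ 2)

/-- The inequalities between the scales that the deterministic analysis uses. -/
structure Scales.Fits (N : Scales) (n m : ℕ) : Prop where
  hq : 2 < N.q
  h_pos : 0 < N.h
  n_pos : 0 < n
  m_pos : 0 < m
  M_ge : 1 ≤ N.M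
  δ_nonneg : 0 ≤ N.δ
  δ_le : N.δ ≤ 1 / 4
  x₀_pos : 0 < N.x₀
  x₀_le : N.x₀ ≤ 1
  R_nonneg : 0 ≤ N.R
  A_nonneg : 0 ≤ N.A
  A_le : N.A ≤ N.δ
  V_nonneg : 0 ≤ N.V
  slo_pos : 0 < N.slo
  p₁_pos : 0 < N.p₁
  err : 2 * N.B + N.R * (n * (m * N.M / N.slo)) ≤ N.δ
  close : N.q * 2 ^ N.q * N.δ * (1 + N.M) + 3 * N.δ ≤ 1 / 2
  step : N.h * N.shi * (N.q * 2 ^ N.q * (m * (1 + N.M))) ≤ 1 / 4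
  incr_le : N.incr m ≤ 1
  horizon : 1 + 2 * Real.exp 1 * N.incr m * N.T ≤ Real.exp N.M
  cross : N.R * (2 / N.p₁ * (n * (1 + N.M) / N.slo)) ≤ N.x₀
  phase_one : 1 ≤ N.x₀ * (1 + N.h * N.slo * N.q * N.x₀ ^ (N.q - 2) / 9) ^ N.t₁
  phase_two : 2 * (m : ℝ) ≤ (1 + N.h * N.slo * N.q / 9) ^ N.t₂
  signal : N.A₀ + N.h * N.V * (N.q * N.A ^ (N.q - 1)) *
    (n * (N.t₁ + N.t₂ + N.M / (lateRate N.q * (N.h * N.slo)))) ≤ N.A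

/-- The laws of the scalar dynamics up to time `N.T`, together with the properties of the data, the
initialization and the private noise that hold with high probability. -/
structure Traj.Follows {n m : ℕ} (X : Traj n m) (N : Scales) : Prop where
  mem_zero : ∀ p i, X.mem 0 p i = 0
  mem_succ : ∀ t p i, X.mem (t + 1) p i =
    X.mem t p i + N.h * X.slope N.q t i * rate N.q (X.corr t p i)
  corr_init : ∀ p i, |X.corr 0 p i| ≤ N.B
  corr_approx : ∀ t ≤ N.T, ∀ p i,
    |X.corr t p i - X.corr 0 p i - sgn p.1 * sgn (X.label i) * (X.mem t p i * X.sq i)| ≤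
      N.B + N.R * ∑ k, X.mem t p k
  corr_approx_early : ∀ t ≤ N.T, t ≤ N.t₁ + N.t₂ → ∀ p i,
    |X.corr t p i - X.corr 0 p i - sgn p.1 * sgn (X.label i) * (X.mem t p i * X.sq i)| ≤
      N.x₀ + N.R * ∑ k, X.mem t p k
  good : ∀ i, N.p₁ * m ≤
    ((Finset.univ.filter fun r => 3 * N.x₀ ≤ X.corr 0 (X.label i, r) i).card : ℝ)
  sig_le : ∀ t ≤ N.T, ∀ p, |X.sig t p| ≤ N.A₀ + N.h * N.V *
    ∑ s ∈ Finset.range t, ∑ k, X.slope N.q s k * rate N.q |X.sig s p|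
  sq_ge : ∀ i, N.slo ≤ X.sq i
  sq_le : ∀ i, X.sq i ≤ N.shi

lemma sgn_mul_self (y : Bool) : sgn y * sgn y = 1 := by cases y <;> simp [sgn]

lemma sgn_not (y : Bool) : sgn (!y) = -sgn y := by cases y <;> simp [sgn]

lemma abs_sgn (y : Bool) : |sgn y| = 1 := by cases y <;> simp [sgn]

namespace Traj

variable {n m : ℕ} {X : Traj n m} {N : Scales}

lemma slope_pos (X : Traj n m) (q : ℝ) (t : ℕ) (i : Fin n) : 0 < X.slope q t i := by
  unfold slope; positivity

lemma slope_le_one (X : Traj n m) (q : ℝ) (t : ℕ) (i : Fin n) : X.slope q t i ≤ 1 := by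
  unfold slope
  apply inv_le_one_of_one_le₀
  linarith [Real.exp_pos (X.margin q t i)]

lemma slope_le_exp (X : Traj n m) (q : ℝ) (t : ℕ) (i : Fin n) :
    X.slope q t i ≤ Real.exp (-X.margin q t i) := by
  rw [slope, Real.exp_neg]
  gcongr
  linarith

/-- The invariant of the run: memorized margins stay below `M`, no noise patch enters filters of the
other label, and the signal is not learned. -/
structure Inv (X : Traj n m) (N : Scales) (t : ℕ) : Prop where
  level_le : ∀ i, X.level N.q t i ≤ N.M
  other_le : ∀ p i, p.1 ≠ X.label i → X.mem t p i * X.sq i ≤ 1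
  sig_le : ∀ p, |X.sig t p| ≤ N.A

section
variable (F : X.Follows N) (H : N.Fits n m)
include F H

lemma Follows.mem_le_succ (t : ℕ) (p : Bool × Fin m) (i : Fin n) :
    X.mem t p i ≤ X.mem (t + 1) p i := by
  rw [F.mem_succ]
  have := mul_nonneg (mul_nonneg H.h_pos.le (X.slope_pos N.q t i).le)
    (rate_nonneg H.hq (X.corr t p i))
  linarith

lemma Follows.mem_mono {s t : ℕ} (h : s ≤ t) (p : Bool × Fin m) (i : Fin n) :
    X.mem s p i ≤ X.mem t p i :=
  monotone_nat_of_le_succ (f := fun t => X.mem t p i) (fun t => F.mem_le_succ H t p i) h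

lemma Follows.mem_nonneg (t : ℕ) (p : Bool × Fin m) (i : Fin n) : 0 ≤ X.mem t p i := by
  have := F.mem_mono H (Nat.zero_le t) p i
  rwa [F.mem_zero] at this

lemma Follows.sq_pos (i : Fin n) : 0 < X.sq i := H.slo_pos.trans_le (F.sq_ge i)

lemma Follows.own_nonneg (t : ℕ) (i : Fin n) (r : Fin m) : 0 ≤ X.own t i r :=
  mul_nonneg (F.mem_nonneg H _ _ _) (F.sq_pos H i).le

lemma Follows.own_mono {s t : ℕ} (h : s ≤ t) (i : Fin n) (r : Fin m) :
    X.own s i r ≤ X.own t i r :=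
  mul_le_mul_of_nonneg_right (F.mem_mono H h _ _) (F.sq_pos H i).le

omit H in
lemma Follows.own_succ (t : ℕ) (i : Fin n) (r : Fin m) : X.own (t + 1) i r =
    X.own t i r + N.h * X.sq i * X.slope N.q t i * rate N.q (X.corr t (X.label i, r) i) := by
  rw [own, F.mem_succ, own]; ring

lemma Follows.level_mono {s t : ℕ} (h : s ≤ t) (i : Fin n) :
    X.level N.q s i ≤ X.level N.q t i := by
  unfold level
  have hq := H.hq
  gcongr with r _
  · exact F.own_nonneg H _ _ _
  · exact F.own_mono H h i r

lemma Follows.level_zero (i : Fin n) : X.level N.q 0 i = 0 := by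
  have hq := H.hq
  simp [level, own, F.mem_zero, Real.zero_rpow (by linarith : N.q ≠ 0)]

lemma Follows.level_nonneg (t : ℕ) (i : Fin n) : 0 ≤ X.level N.q t i := by
  rw [← F.level_zero H i]; exact F.level_mono H (Nat.zero_le t) i

omit F in
lemma sum_own_rpow (t : ℕ) (i : Fin n) :
    ∑ r, X.own t i r ^ N.q = m * X.level N.q t i := by
  have hm : (m : ℝ) ≠ 0 := by have := H.m_pos; positivity
  rw [level]; field_simp

lemma Follows.own_rpow_le (t : ℕ) (i : Fin n) (r : Fin m) :
    X.own t i r ^ N.q ≤ m * X.level N.q t i := by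
  rw [← sum_own_rpow H]
  exact Finset.single_le_sum (f := fun r => X.own t i r ^ N.q)
    (fun r _ => Real.rpow_nonneg (F.own_nonneg H t i r) _) (Finset.mem_univ r)

lemma Follows.own_le {t : ℕ} {i : Fin n} (hM : X.level N.q t i ≤ N.M) (r : Fin m) :
    X.own t i r ≤ m * N.M := by
  have hm : (1 : ℝ) ≤ m := by exact_mod_cast H.m_pos
  have hM1 := H.M_ge
  have h1 : (1 : ℝ) ≤ m * N.M := by nlinarith
  rcases le_total (X.own t i r) 1 with h | h
  · linarith
  · calc X.own t i r = X.own t i r ^ (1 : ℝ) := (Real.rpow_one _).symm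
      _ ≤ X.own t i r ^ N.q := Real.rpow_le_rpow_of_exponent_le h (by linarith [H.hq])
      _ ≤ m * X.level N.q t i := F.own_rpow_le H t i r
      _ ≤ m * N.M := by gcongr

lemma Follows.mem_le {t : ℕ} (I : X.Inv N t) (p : Bool × Fin m) (i : Fin n) :
    X.mem t p i ≤ m * N.M / N.slo := by
  have hm : (1 : ℝ) ≤ m := by exact_mod_cast H.m_pos
  have hM1 := H.M_ge
  have h1 : (1 : ℝ) ≤ m * N.M := by nlinarith
  rw [le_div_iff₀ H.slo_pos]
  calc X.mem t p i * N.slo ≤ X.mem t p i * X.sq i :=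
        mul_le_mul_of_nonneg_left (F.sq_ge i) (F.mem_nonneg H _ _ _)
    _ ≤ m * N.M := by
      by_cases hp : p.1 = X.label i
      · have := F.own_le H (I.level_le i) p.2
        rwa [own, ← hp] at this
      · exact (I.other_le p i hp).trans h1

/-- All correlations are given by their memorized part up to an error `δ`. -/
lemma Follows.corr_close {t : ℕ} (ht : t ≤ N.T) (I : X.Inv N t) (p : Bool × Fin m) (i : Fin n) :
    |X.corr t p i - sgn p.1 * sgn (X.label i) * (X.mem t p i * X.sq i)| ≤ N.δ := by
  have h1 := F.corr_approx t ht p i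
  have h2 := F.corr_init p i
  have h3 : ∑ k, X.mem t p k ≤ n * (m * N.M / N.slo) := by
    calc ∑ k, X.mem t p k ≤ ∑ _k : Fin n, m * N.M / N.slo :=
          Finset.sum_le_sum fun k _ => F.mem_le H I p k
      _ = _ := by simp
  have h4 := mul_le_mul_of_nonneg_left h3 H.R_nonneg
  have h5 := H.err
  rw [abs_le] at *
  constructor <;> linarith

lemma Follows.corr_own_close {t : ℕ} (ht : t ≤ N.T) (I : X.Inv N t) (i : Fin n) (r : Fin m) :
    |X.corr t (X.label i, r) i - X.own t i r| ≤ N.δ := by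
  have := F.corr_close H ht I (X.label i, r) i
  rwa [sgn_mul_self, one_mul] at this

lemma Follows.corr_other_le {t : ℕ} (ht : t ≤ N.T) (I : X.Inv N t) {p : Bool × Fin m} {i : Fin n}
    (hp : p.1 ≠ X.label i) : X.corr t p i ≤ N.δ - X.mem t p i * X.sq i := by
  have h := F.corr_close H ht I p i
  have e : p.1 = !X.label i := by revert hp; cases p.1 <;> cases X.label i <;> simp
  rw [e, sgn_not, neg_mul, sgn_mul_self] at h
  have := (abs_le.1 h).2
  linarith

/-- The margin is given by its memorized part up to an error `1 / 2`. -/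
lemma Follows.abs_margin_sub_level {t : ℕ} (ht : t ≤ N.T) (I : X.Inv N t) (i : Fin n) :
    |X.margin N.q t i - X.level N.q t i| ≤ 1 / 2 := by
  have hm : (0 : ℝ) < m := by exact_mod_cast H.m_pos
  have hq := H.hq
  have hδ := H.δ_nonneg
  have hδ1 : N.δ ≤ 1 := by linarith [H.δ_le]
  have avg : ∀ (f : Fin m → ℝ) (c : ℝ), (∀ r, |f r| ≤ c) → |(1 / (m : ℝ)) * ∑ r, f r| ≤ c := by
    intro f c hf
    rw [abs_mul, abs_of_pos (by positivity : (0 : ℝ) < 1 / m)]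
    calc 1 / (m : ℝ) * |∑ r, f r| ≤ 1 / (m : ℝ) * ∑ r, |f r| := by
          gcongr; exact Finset.abs_sum_le_sum_abs _ _
      _ ≤ 1 / (m : ℝ) * ∑ _r : Fin m, c := by gcongr with r _; exact hf r
      _ = c := by simp; field_simp
  have hs : ∀ b r, |act N.q (sgn (X.label i) * X.sig t (b, r))| ≤ N.δ := by
    intro b r
    rw [abs_of_nonneg (act_nonneg _ _)]
    refine act_le_of_le (by linarith) ?_ hδ hδ1
    calc sgn (X.label i) * X.sig t (b, r) ≤ |sgn (X.label i) * X.sig t (b, r)| := le_abs_self _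
      _ = |X.sig t (b, r)| := by rw [abs_mul, abs_sgn, one_mul]
      _ ≤ N.δ := (I.sig_le _).trans H.A_le
  have h1 := avg _ _ (hs (X.label i))
  have h2 := avg _ _ (hs (!X.label i))
  have h3 : |(1 / (m : ℝ)) * ∑ r, act N.q (X.corr t (!X.label i, r) i)| ≤ N.δ := by
    refine avg _ _ fun r => ?_
    rw [abs_of_nonneg (act_nonneg _ _)]
    refine act_le_of_le (by linarith) ?_ hδ hδ1
    have := F.corr_other_le H ht I (p := (!X.label i, r)) (i := i) (by simp)
    have h0 := mul_nonneg (F.mem_nonneg H t (!X.label i, r) i) (F.sq_pos H i).le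
    linarith
  have h4 : |(1 / (m : ℝ)) * ∑ r, (act N.q (X.corr t (X.label i, r) i) - X.own t i r ^ N.q)| ≤
      N.q * 2 ^ N.q * N.δ * (1 + N.M) := by
    rw [abs_mul, abs_of_pos (by positivity : (0 : ℝ) < 1 / m)]
    calc 1 / (m : ℝ) * |∑ r, (act N.q (X.corr t (X.label i, r) i) - X.own t i r ^ N.q)|
        ≤ 1 / (m : ℝ) * ∑ r, |act N.q (X.corr t (X.label i, r) i) - X.own t i r ^ N.q| := by
          gcongr; exact Finset.abs_sum_le_sum_abs _ _
      _ ≤ 1 / (m : ℝ) * ∑ r, N.q * 2 ^ N.q * N.δ * (1 + X.own t i r ^ N.q) := by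
          gcongr with r _
          exact abs_act_sub_le hq (F.own_nonneg H t i r) (F.corr_own_close H ht I i r) hδ1
      _ = N.q * 2 ^ N.q * N.δ * (1 + X.level N.q t i) := by
          rw [← Finset.mul_sum, Finset.sum_add_distrib, sum_own_rpow H]
          simp; field_simp
      _ ≤ _ := by gcongr; exact I.level_le i
  have e : X.margin N.q t i - X.level N.q t i =
      (1 / (m : ℝ)) * ∑ r, act N.q (sgn (X.label i) * X.sig t (X.label i, r)) -
      (1 / (m : ℝ)) * ∑ r, act N.q (sgn (X.label i) * X.sig t (!X.label i, r)) -
      (1 / (m : ℝ)) * ∑ r, act N.q (X.corr t (!X.label i, r) i) +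
      (1 / (m : ℝ)) * ∑ r, (act N.q (X.corr t (X.label i, r) i) - X.own t i r ^ N.q) := by
    rw [margin, level, Finset.sum_add_distrib, Finset.sum_add_distrib, Finset.sum_sub_distrib]
    ring
  rw [e]
  have h5 := H.close
  rw [abs_le] at *
  constructor <;> linarith

/-- Increments of the memorized parts are small, whatever the correlation. -/
lemma Follows.own_succ_le {t : ℕ} (ht : t ≤ N.T) (I : X.Inv N t) (i : Fin n) (r : Fin m) :
    X.own (t + 1) i r ≤ 1 + X.own t i r ∧
      X.own (t + 1) i r - X.own t i r ≤
        N.h * N.shi * X.slope N.q t i * (N.q * (1 + X.own t i r) ^ (N.q - 1)) := by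
  have hq := H.hq
  have hu := F.own_nonneg H t i r
  have hh := H.h_pos
  have hg := X.slope_pos N.q t i
  have hS := F.sq_pos H i
  have hshi : 0 < N.shi := hS.trans_le (F.sq_le i)
  have h1 : rate N.q (X.corr t (X.label i, r) i) ≤ N.q * (1 + X.own t i r) ^ (N.q - 1) := by
    rw [← rate_of_nonneg N.q (by linarith : 0 ≤ 1 + X.own t i r)]
    apply rate_mono hq
    have := (abs_le.1 (F.corr_own_close H ht I i r)).2
    linarith [H.δ_le]
  have h2 : X.own (t + 1) i r - X.own t i r ≤
      N.h * N.shi * X.slope N.q t i * (N.q * (1 + X.own t i r) ^ (N.q - 1)) := by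
    rw [F.own_succ, add_sub_cancel_left]
    have := F.sq_le i
    have := rate_nonneg hq (X.corr t (X.label i, r) i)
    gcongr
  refine ⟨?_, h2⟩
  have h3 : (1 + X.own t i r) ^ (N.q - 1) ≤ 2 ^ N.q * (m * (1 + N.M)) :=
    calc (1 + X.own t i r) ^ (N.q - 1) ≤ (1 + X.own t i r) ^ N.q :=
          Real.rpow_le_rpow_of_exponent_le (by linarith) (by linarith)
      _ ≤ 2 ^ N.q * (1 + X.own t i r ^ N.q) := one_add_rpow_le (by linarith) hu
      _ ≤ 2 ^ N.q * (m * (1 + N.M)) := by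
          have hm : (1 : ℝ) ≤ m := by exact_mod_cast H.m_pos
          have := F.own_rpow_le H t i r
          have := mul_le_mul_of_nonneg_left (I.level_le i) (by linarith : (0 : ℝ) ≤ m)
          gcongr
          linarith
  have h4 := X.slope_le_one N.q t i
  have : N.h * N.shi * X.slope N.q t i * (N.q * (1 + X.own t i r) ^ (N.q - 1)) ≤
      N.h * N.shi * 1 * (N.q * (2 ^ N.q * (m * (1 + N.M)))) := by gcongr
  have h5 := H.step
  have e : N.h * N.shi * 1 * (N.q * (2 ^ N.q * (m * (1 + N.M)))) =
    N.h * N.shi * (N.q * 2 ^ N.q * (m * (1 + N.M))) := by ring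
  linarith

lemma Follows.level_succ_sub_le {t : ℕ} (ht : t ≤ N.T) (I : X.Inv N t) (i : Fin n) :
    X.level N.q (t + 1) i - X.level N.q t i ≤ X.slope N.q t i * N.incr m := by
  have hq := H.hq
  have hm : (1 : ℝ) ≤ m := by exact_mod_cast H.m_pos
  have hM := H.M_ge
  have hh := H.h_pos
  have hg := X.slope_pos N.q t i
  have hshi : 0 < N.shi := (F.sq_pos H i).trans_le (F.sq_le i)
  have key : ∀ r, X.own (t + 1) i r ^ N.q - X.own t i r ^ N.q ≤
      X.slope N.q t i * (N.q ^ 2 * 4 ^ N.q * (N.h * N.shi)) * (m * (1 + N.M)) *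
        (1 + X.own t i r ^ N.q) := by
    intro r
    have hu := F.own_nonneg H t i r
    have hu' := F.own_nonneg H (t + 1) i r
    have hmon := F.own_mono H (Nat.le_succ t) i r
    obtain ⟨h1, h2⟩ := F.own_succ_le H ht I i r
    have h3 := rpow_tangent_le (q := N.q) (by linarith) hu hu'
    have h4 : X.own (t + 1) i r ^ (N.q - 1) ≤ (1 + X.own t i r) ^ N.q :=
      (Real.rpow_le_rpow hu' h1 (by linarith)).trans
        (Real.rpow_le_rpow_of_exponent_le (by linarith) (by linarith))
    have h5 : (1 + X.own t i r) ^ (N.q - 1) ≤ (1 + X.own t i r) ^ N.q :=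
      Real.rpow_le_rpow_of_exponent_le (by linarith) (by linarith)
    have h6 := one_add_rpow_le (q := N.q) (by linarith) hu
    have h7 : 1 + X.own t i r ^ N.q ≤ m * (1 + N.M) := by
      have := F.own_rpow_le H t i r
      have := mul_le_mul_of_nonneg_left (I.level_le i) (by linarith : (0 : ℝ) ≤ m)
      linarith
    have h8 : (4 : ℝ) ^ N.q = 2 ^ N.q * 2 ^ N.q := by
      rw [← Real.mul_rpow (by norm_num) (by norm_num)]; norm_num
    calc X.own (t + 1) i r ^ N.q - X.own t i r ^ N.q
        ≤ N.q * X.own (t + 1) i r ^ (N.q - 1) * (X.own (t + 1) i r - X.own t i r) := by linarith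
      _ ≤ N.q * (2 ^ N.q * (1 + X.own t i r ^ N.q)) *
          (N.h * N.shi * X.slope N.q t i * (N.q * (2 ^ N.q * (m * (1 + N.M))))) := by
          have a1 : X.own (t + 1) i r ^ (N.q - 1) ≤ 2 ^ N.q * (1 + X.own t i r ^ N.q) :=
            h4.trans h6
          have a2 : (1 + X.own t i r) ^ (N.q - 1) ≤ 2 ^ N.q * (m * (1 + N.M)) :=
            (h5.trans h6).trans (by gcongr)
          have a3 : X.own (t + 1) i r - X.own t i r ≤
              N.h * N.shi * X.slope N.q t i * (N.q * (2 ^ N.q * (m * (1 + N.M)))) :=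
            h2.trans (by gcongr)
          have a4 : 0 ≤ X.own (t + 1) i r - X.own t i r := by linarith
          gcongr
      _ = _ := by rw [h8]; ring
  calc X.level N.q (t + 1) i - X.level N.q t i
      = (1 / (m : ℝ)) * ∑ r, (X.own (t + 1) i r ^ N.q - X.own t i r ^ N.q) := by
        rw [level, level, Finset.sum_sub_distrib]; ring
    _ ≤ (1 / (m : ℝ)) * ∑ r, X.slope N.q t i * (N.q ^ 2 * 4 ^ N.q * (N.h * N.shi)) *
          (m * (1 + N.M)) * (1 + X.own t i r ^ N.q) := by
        gcongr with r _; exact key r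
    _ = X.slope N.q t i * (N.q ^ 2 * 4 ^ N.q * (N.h * N.shi)) *
          (m * (1 + N.M)) * (1 + X.level N.q t i) := by
        rw [← Finset.mul_sum, Finset.sum_add_distrib, sum_own_rpow H]
        simp; field_simp
    _ ≤ X.slope N.q t i * (N.q ^ 2 * 4 ^ N.q * (N.h * N.shi)) *
          (m * (1 + N.M)) * (1 + N.M) := by gcongr; exact I.level_le i
    _ = _ := by rw [Scales.incr]; ring

/-- The exponential of a memorized margin grows at most linearly in time, as the slope of the
logistic loss decays exponentially in the margin. -/
lemma Follows.exp_level_succ_le {t : ℕ} (ht : t ≤ N.T) (I : X.Inv N t) (i : Fin n) :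
    Real.exp (X.level N.q (t + 1) i) ≤
      Real.exp (X.level N.q t i) + 2 * Real.exp 1 * N.incr m := by
  have h1 := F.level_succ_sub_le H ht I i
  have hg := X.slope_pos N.q t i
  have hg1 := X.slope_le_one N.q t i
  have hD := H.incr_le
  have hshi : 0 < N.shi := (F.sq_pos H i).trans_le (F.sq_le i)
  have hD0 : 0 ≤ N.incr m := by have := H.h_pos; unfold Scales.incr; positivity
  set x := X.slope N.q t i * N.incr m with hx
  have hx0 : 0 ≤ x := by positivity
  have hx1 : x ≤ 1 := by nlinarith
  have h2 : Real.exp x ≤ 1 + 2 * x := by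
    have h := Real.abs_exp_sub_one_le (x := x) (by rwa [abs_of_nonneg hx0])
    rw [abs_of_nonneg hx0] at h
    linarith [(abs_le.1 h).2]
  have h3 : X.slope N.q t i * Real.exp (X.level N.q t i) ≤ Real.exp 1 := by
    calc X.slope N.q t i * Real.exp (X.level N.q t i)
        ≤ Real.exp (-X.margin N.q t i) * Real.exp (X.level N.q t i) := by
          gcongr; exact X.slope_le_exp _ _ _
      _ = Real.exp (-X.margin N.q t i + X.level N.q t i) := (Real.exp_add _ _).symm
      _ ≤ Real.exp 1 := by
          apply Real.exp_le_exp.2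
          have := (abs_le.1 (F.abs_margin_sub_level H ht I i)).1
          linarith
  calc Real.exp (X.level N.q (t + 1) i) ≤ Real.exp (X.level N.q t i + x) :=
        Real.exp_le_exp.2 (by linarith)
    _ = Real.exp (X.level N.q t i) * Real.exp x := Real.exp_add _ _
    _ ≤ Real.exp (X.level N.q t i) * (1 + 2 * x) := by gcongr
    _ = Real.exp (X.level N.q t i) +
        2 * (X.slope N.q t i * Real.exp (X.level N.q t i)) * N.incr m := by rw [hx]; ring
    _ ≤ _ := by gcongr

lemma Follows.level_le_of_inv {t : ℕ} (ht : t ≤ N.T) (I : ∀ s < t, X.Inv N s) (i : Fin n) :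
    X.level N.q t i ≤ N.M := by
  have hshi : 0 < N.shi := (F.sq_pos H i).trans_le (F.sq_le i)
  have hD0 : 0 ≤ N.incr m := by have := H.h_pos; unfold Scales.incr; positivity
  have key : ∀ s ≤ t, Real.exp (X.level N.q s i) ≤ 1 + 2 * Real.exp 1 * N.incr m * s := by
    intro s
    induction s with
    | zero => intro _; simp [F.level_zero H]
    | succ s ih =>
      intro hs
      have h1 := ih (by omega)
      have h2 := F.exp_level_succ_le H (by omega : s ≤ N.T) (I s (by omega)) i
      push_cast
      linarith
  rw [← Real.exp_le_exp]
  refine (key t le_rfl).trans (le_trans ?_ H.horizon)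
  gcongr

lemma Follows.other_succ_le {t : ℕ} (ht : t ≤ N.T) (I : X.Inv N t) (p : Bool × Fin m)
    (i : Fin n) (hp : p.1 ≠ X.label i) : X.mem (t + 1) p i * X.sq i ≤ 1 := by
  have hq := H.hq
  have hc := F.corr_other_le H ht I hp
  have h0 := I.other_le p i hp
  rw [F.mem_succ]
  rcases le_total N.δ (X.mem t p i * X.sq i) with h | h
  · rw [rate_of_nonpos hq (by linarith)]
    linarith
  · have hh := H.h_pos
    have hg := X.slope_pos N.q t i
    have hg1 := X.slope_le_one N.q t i
    have hM := H.M_ge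
    have hm : (1 : ℝ) ≤ m := by exact_mod_cast H.m_pos
    have hshi : 0 < N.shi := (F.sq_pos H i).trans_le (F.sq_le i)
    have h1 : rate N.q (X.corr t p i) ≤ N.q * 1 := by
      have hle : X.corr t p i ≤ 1 := by
        have := mul_nonneg (F.mem_nonneg H t p i) (F.sq_pos H i).le
        linarith [H.δ_le]
      calc rate N.q (X.corr t p i) ≤ rate N.q 1 := rate_mono hq hle
        _ = N.q * 1 := by rw [rate_of_nonneg _ zero_le_one, Real.one_rpow]
    have h2 : (1 : ℝ) ≤ 2 ^ N.q * (m * (1 + N.M)) := by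
      have : (1 : ℝ) ≤ 2 ^ N.q := Real.one_le_rpow (by norm_num) (by linarith)
      have : (1 : ℝ) ≤ m * (1 + N.M) := by nlinarith
      nlinarith
    have h3 : N.h * X.slope N.q t i * rate N.q (X.corr t p i) * X.sq i ≤ 1 / 4 :=
      calc N.h * X.slope N.q t i * rate N.q (X.corr t p i) * X.sq i
          ≤ N.h * 1 * (N.q * (2 ^ N.q * (m * (1 + N.M)))) * N.shi := by
            have := F.sq_le i
            have := (F.sq_pos H i).le
            have := rate_nonneg hq (X.corr t p i)
            gcongr
            exact h1.trans (by gcongr)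
        _ = N.h * N.shi * (N.q * 2 ^ N.q * (m * (1 + N.M))) := by ring
        _ ≤ 1 / 4 := H.step
    have := H.δ_le
    nlinarith

/-! ### The first stage -/

/-- By Markov's inequality over the filters, one of the filters with a useful initial correlation
has only memorized little of the other samples. -/
lemma Follows.exists_good {t : ℕ} (I : X.Inv N t) (i : Fin n) :
    ∃ r, 3 * N.x₀ ≤ X.corr 0 (X.label i, r) i ∧
      N.R * ∑ k, X.mem t (X.label i, r) k ≤ N.x₀ := by
  have hq := H.hq
  have hm : (0 : ℝ) < m := by exact_mod_cast H.m_pos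
  have hn : (0 : ℝ) < n := by exact_mod_cast H.n_pos
  have hM := H.M_ge
  have hp := H.p₁_pos
  have hs := H.slo_pos
  set b := n * (1 + N.M) / N.slo with hb
  have hb0 : 0 < b := by positivity
  -- the average over `r` of the memory of sample `k`
  have h1 : ∀ k, ∑ r, X.mem t (X.label i, r) k ≤ m * ((1 + N.M) / N.slo) := by
    intro k
    have : ∀ r, X.mem t (X.label i, r) k * N.slo ≤ 1 + X.own t k r ^ N.q := by
      intro r
      have h0 : X.mem t (X.label i, r) k * N.slo ≤ X.mem t (X.label i, r) k * X.sq k :=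
        mul_le_mul_of_nonneg_left (F.sq_ge k) (F.mem_nonneg H _ _ _)
      have h0' := Real.rpow_nonneg (F.own_nonneg H t k r) N.q
      by_cases hl : X.label i = X.label k
      · have := self_le_one_add_rpow (q := N.q) (by linarith) (F.own_nonneg H t k r)
        rw [hl] at h0 ⊢
        exact h0.trans this
      · have := I.other_le (X.label i, r) k hl
        linarith
    have h2 := Finset.sum_le_sum fun r (_ : r ∈ Finset.univ) => this r
    rw [← Finset.sum_mul, Finset.sum_add_distrib, sum_own_rpow H] at h2
    simp only [Finset.sum_const, Finset.card_univ, Fintype.card_fin, nsmul_eq_mul, mul_one] at h2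
    have h3 := mul_le_mul_of_nonneg_left (I.level_le k) hm.le
    rw [← mul_div_assoc, le_div_iff₀ hs]
    linarith
  have h2 : ∑ r, ∑ k, X.mem t (X.label i, r) k ≤ m * b := by
    rw [Finset.sum_comm]
    calc ∑ k, ∑ r, X.mem t (X.label i, r) k ≤ ∑ _k : Fin n, m * ((1 + N.M) / N.slo) :=
          Finset.sum_le_sum fun k _ => h1 k
      _ = m * b := by simp [hb]; ring
  by_contra! hcon
  set Gd := Finset.univ.filter fun r => 3 * N.x₀ ≤ X.corr 0 (X.label i, r) i with hG
  have h3 : ∀ r ∈ Gd, 2 / N.p₁ * b ≤ ∑ k, X.mem t (X.label i, r) k := by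
    intro r hr
    have hlt := hcon r (Finset.mem_filter.1 hr).2
    by_contra! h
    have := mul_le_mul_of_nonneg_left h.le H.R_nonneg
    linarith [H.cross]
  have h4 : (Gd.card : ℝ) * (2 / N.p₁ * b) ≤ m * b := by
    calc (Gd.card : ℝ) * (2 / N.p₁ * b) = ∑ _r ∈ Gd, 2 / N.p₁ * b := by simp
      _ ≤ ∑ r ∈ Gd, ∑ k, X.mem t (X.label i, r) k := Finset.sum_le_sum h3
      _ ≤ ∑ r, ∑ k, X.mem t (X.label i, r) k :=
          Finset.sum_le_sum_of_subset_of_nonneg (Finset.subset_univ _) fun r _ _ =>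
            Finset.sum_nonneg fun k _ => F.mem_nonneg H _ _ _
      _ ≤ _ := h2
  have h5 : N.p₁ * m * (2 / N.p₁ * b) ≤ Gd.card * (2 / N.p₁ * b) :=
    mul_le_mul_of_nonneg_right (F.good i) (by positivity)
  have h6 : N.p₁ * m * (2 / N.p₁ * b) = 2 * (m * b) := by field_simp
  nlinarith [mul_pos hm hb0]

omit F H in
/-- A sequence with increments at least `a * x_s`, as long as it stays above `b`, grows
exponentially. -/
lemma exp_growth {x : ℕ → ℝ} {a b : ℝ} {s₀ k : ℕ} (ha : 0 ≤ a) (h0 : b ≤ x s₀) (hb : 0 ≤ b)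
    (hx : ∀ s, s₀ ≤ s → s < s₀ + k → b ≤ x s → x s * (1 + a) ≤ x (s + 1)) :
    b * (1 + a) ^ k ≤ x (s₀ + k) := by
  induction k with
  | zero => simpa using h0
  | succ k ih =>
    have h1 := ih fun s hs hs' => hx s hs (by omega)
    have h2 : b ≤ x (s₀ + k) := by
      refine le_trans ?_ h1
      have : 1 ≤ (1 + a) ^ k := one_le_pow₀ (by linarith)
      nlinarith
    have h3 := hx (s₀ + k) (by omega) (by omega) h2
    calc b * (1 + a) ^ (k + 1) = b * (1 + a) ^ k * (1 + a) := by ring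
      _ ≤ x (s₀ + k) * (1 + a) := by gcongr
      _ ≤ x (s₀ + (k + 1)) := h3

/-- At the end of the first stage all samples are memorized. For each sample, the correlation with a
single well-initialized filter is followed: it grows exponentially to order one in the first `t₁`
steps, and to order `m`, where it dominates the average over all filters, in the next `t₂`. -/
lemma Follows.one_le_level {t : ℕ} (ht : t ≤ N.T) (h12 : N.t₁ + N.t₂ ≤ t)
    (I : ∀ s ≤ t, X.Inv N s) (i : Fin n) : 1 ≤ X.level N.q t i := by
  have hq := H.hq
  have hm : (1 : ℝ) ≤ m := by exact_mod_cast H.m_pos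
  have hh := H.h_pos
  have hs := H.slo_pos
  have hx0 := H.x₀_pos
  refine le_trans ?_ (F.level_mono H h12 i)
  by_contra! hlt
  obtain ⟨r, hr1, hr2⟩ := F.exists_good H (I _ h12) i
  -- as long as the sample is not memorized, its slope stays bounded away from zero
  have hslope : ∀ s ≤ N.t₁ + N.t₂, 1 / 9 ≤ X.slope N.q s i := by
    intro s hs'
    have h1 := (abs_le.1 (F.abs_margin_sub_level H (by omega) (I s (by omega)) i)).2
    have h2 := F.level_mono H hs' i
    have h3 : Real.exp (X.margin N.q s i) ≤ 8 :=
      calc Real.exp (X.margin N.q s i) ≤ Real.exp 2 := Real.exp_le_exp.2 (by linarith)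
        _ = Real.exp 1 ^ 2 := by rw [← Real.exp_nat_mul]; norm_num
        _ ≤ 8 := by nlinarith [Real.exp_one_lt_d9, Real.exp_pos 1]
    rw [slope, one_div]
    gcongr
    linarith
  have hcorr : ∀ s ≤ N.t₁ + N.t₂, X.own s i r + N.x₀ ≤ X.corr s (X.label i, r) i := by
    intro s hs'
    have h1 := F.corr_approx_early s (by omega) hs' (X.label i, r) i
    rw [sgn_mul_self, one_mul] at h1
    have h2 : N.R * ∑ k, X.mem s (X.label i, r) k ≤ N.x₀ := by
      refine le_trans ?_ hr2
      have := H.R_nonneg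
      gcongr with k _
      exact F.mem_mono H hs' _ _
    have := (abs_le.1 h1).1
    rw [own]
    linarith
  set x : ℕ → ℝ := fun s => X.own s i r + N.x₀ with hx
  have hxpos : ∀ s, 0 < x s := fun s => by
    have := F.own_nonneg H s i r; simp only [hx]; linarith
  have hstep : ∀ b, 0 < b → ∀ s ≤ N.t₁ + N.t₂, b ≤ x s →
      x s * (1 + N.h * N.slo * N.q * b ^ (N.q - 2) / 9) ≤ x (s + 1) := by
    intro b hb s hs' hbx
    have h1 : N.q * x s ^ (N.q - 1) ≤ rate N.q (X.corr s (X.label i, r) i) := by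
      rw [← rate_of_nonneg N.q (hxpos s).le]
      exact rate_mono hq (hcorr s hs')
    have h2 : x s ^ (N.q - 1) = x s ^ (N.q - 2) * x s := by
      rw [← Real.rpow_add_one (hxpos s).ne']; ring_nf
    have h3 : b ^ (N.q - 2) ≤ x s ^ (N.q - 2) := Real.rpow_le_rpow hb.le hbx (by linarith)
    have h4 : N.h * N.slo * (1 / 9) * (N.q * (b ^ (N.q - 2) * x s)) ≤
        N.h * X.sq i * X.slope N.q s i * rate N.q (X.corr s (X.label i, r) i) := by
      have := F.sq_ge i
      have := hslope s hs'
      have := hxpos s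
      have h5 : N.q * (b ^ (N.q - 2) * x s) ≤ rate N.q (X.corr s (X.label i, r) i) := by
        refine le_trans ?_ h1
        rw [h2]; gcongr
      have := F.sq_pos H i
      gcongr
    have h6 := F.own_succ s i r
    simp only [hx] at h4 ⊢
    rw [h6]
    linarith
  have hA : 1 ≤ x N.t₁ := by
    have h := exp_growth (x := x) (a := N.h * N.slo * N.q * N.x₀ ^ (N.q - 2) / 9) (b := N.x₀)
      (s₀ := 0) (k := N.t₁) (by positivity)
      (by simp only [hx]; linarith [F.own_nonneg H 0 i r]) hx0.le
      (fun s _ hs' hb => hstep _ hx0 s (by omega) hb)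
    rw [zero_add] at h
    exact H.phase_one.trans h
  have hB : 2 * (m : ℝ) ≤ x (N.t₁ + N.t₂) := by
    have h := exp_growth (x := x) (a := N.h * N.slo * N.q / 9) (b := 1)
      (s₀ := N.t₁) (k := N.t₂) (by positivity) hA zero_le_one
      (fun s _ hs' hb => by
        have := hstep 1 one_pos s (by omega) hb
        rwa [Real.one_rpow, mul_one] at this)
    rw [one_mul] at h
    exact H.phase_two.trans h
  have hu : (m : ℝ) ≤ X.own (N.t₁ + N.t₂) i r := by
    have := H.x₀_le
    simp only [hx] at hB
    linarith
  have h1 : (m : ℝ) ≤ X.own (N.t₁ + N.t₂) i r ^ N.q :=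
    calc (m : ℝ) = (m : ℝ) ^ (1 : ℝ) := (Real.rpow_one _).symm
      _ ≤ (m : ℝ) ^ N.q := Real.rpow_le_rpow_of_exponent_le hm (by linarith)
      _ ≤ _ := Real.rpow_le_rpow (by linarith) hu (by linarith)
  have h2 := F.own_rpow_le H (N.t₁ + N.t₂) i r
  nlinarith

/-! ### The second stage -/

omit F H in
lemma lateRate_pos {q : ℝ} (hq : 2 < q) : 0 < lateRate q := by
  unfold lateRate; positivity

/-- Once a sample is memorized, its memorized margin grows by a fixed multiple of its slope, so that
the sum of the slopes telescopes against the bound `M` for the margin. -/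
lemma Follows.level_succ_ge {t : ℕ} (ht : t ≤ N.T) (I : X.Inv N t) (i : Fin n)
    (h1 : 1 ≤ X.level N.q t i) :
    X.level N.q t i + lateRate N.q * (N.h * N.slo) * X.slope N.q t i ≤
      X.level N.q (t + 1) i := by
  have hq := H.hq
  have hm : (0 : ℝ) < m := by exact_mod_cast H.m_pos
  have hh := H.h_pos
  have hs := H.slo_pos
  have hg := X.slope_pos N.q t i
  have key : ∀ r, X.own t i r ^ N.q + N.h * X.sq i * X.slope N.q t i *
      (N.q * (N.q * 2 ^ (3 - 2 * N.q) * (X.own t i r ^ N.q - 2 ^ (-N.q)))) ≤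
      X.own (t + 1) i r ^ N.q := by
    intro r
    have hu := F.own_nonneg H t i r
    have h2 := rpow_tangent_le (q := N.q) (by linarith) (F.own_nonneg H (t + 1) i r) hu
    rw [F.own_succ] at h2
    have h3 := (abs_le.1 (F.corr_own_close H ht I i r)).1
    have h4 := rpow_mul_rate_ge hq hu (z := X.corr t (X.label i, r) i) (by linarith [H.δ_le])
    have h5 : 0 < N.h * X.sq i * X.slope N.q t i := by
      have := F.sq_pos H i; positivity
    have h6 := mul_le_mul_of_nonneg_left (mul_le_mul_of_nonneg_left h4 (by linarith : 0 ≤ N.q))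
      h5.le
    rw [F.own_succ]
    refine le_trans ?_ h2
    rw [add_sub_cancel_left]
    linarith
  have h2 : (2 : ℝ) ^ (-N.q) ≤ 1 / 2 := by
    calc (2 : ℝ) ^ (-N.q) ≤ 2 ^ (-1 : ℝ) :=
          Real.rpow_le_rpow_of_exponent_le (by norm_num) (by linarith)
      _ = 1 / 2 := by rw [Real.rpow_neg_one]; norm_num
  have h3 : (2 : ℝ) ^ (3 - 2 * N.q) = 2 * 2 ^ (2 - 2 * N.q) := by
    rw [show 3 - 2 * N.q = 2 - 2 * N.q + 1 by ring, Real.rpow_add_one (by norm_num)]; ring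
  have h4 := Finset.sum_le_sum fun r (_ : r ∈ Finset.univ) => key r
  rw [Finset.sum_add_distrib, ← Finset.mul_sum, ← Finset.mul_sum, ← Finset.mul_sum,
    Finset.sum_sub_distrib, sum_own_rpow H, sum_own_rpow H] at h4
  simp only [Finset.sum_const, Finset.card_univ, Fintype.card_fin, nsmul_eq_mul] at h4
  have h5 : (m : ℝ) * (X.level N.q t i + lateRate N.q * (N.h * N.slo) * X.slope N.q t i) ≤
      m * X.level N.q (t + 1) i := by
    refine le_trans ?_ h4
    have h6 : lateRate N.q * (N.h * N.slo) * X.slope N.q t i * m ≤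
        N.h * X.sq i * X.slope N.q t i * (N.q * (N.q * 2 ^ (3 - 2 * N.q) *
          (m * X.level N.q t i - m * 2 ^ (-N.q)))) :=
      calc lateRate N.q * (N.h * N.slo) * X.slope N.q t i * m
          = N.h * N.slo * X.slope N.q t i * (N.q * (N.q * 2 ^ (3 - 2 * N.q) * (m * (1 / 2)))) := by
            rw [h3, lateRate]; ring
        _ ≤ _ := by
          have := F.sq_ge i
          have h7 : (m : ℝ) * (1 / 2) ≤ m * X.level N.q t i - m * 2 ^ (-N.q) := by nlinarith
          have := F.sq_pos H i
          gcongr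
    linarith
  exact le_of_mul_le_mul_left h5 hm

/-- The total slope of a sample is bounded over the whole run. -/
lemma Follows.sum_slope_le {t : ℕ} (ht : t ≤ N.T) (I : ∀ s < t, X.Inv N s) (i : Fin n) :
    ∑ s ∈ Finset.range t, X.slope N.q s i ≤
      N.t₁ + N.t₂ + N.M / (lateRate N.q * (N.h * N.slo)) := by
  have hc : 0 < lateRate N.q * (N.h * N.slo) := by
    have := lateRate_pos H.hq; have := H.h_pos; have := H.slo_pos; positivity
  have key : ∀ s ≤ t, ∑ u ∈ Finset.range s, X.slope N.q u i ≤
      N.t₁ + N.t₂ + X.level N.q s i / (lateRate N.q * (N.h * N.slo)) := by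
    intro s
    induction s with
    | zero => intro _; simp only [Finset.range_zero, Finset.sum_empty, F.level_zero H]; positivity
    | succ s ih =>
      intro hs
      rcases lt_or_ge s (N.t₁ + N.t₂) with h | h
      · have h1 : ∑ u ∈ Finset.range (s + 1), X.slope N.q u i ≤ (s + 1 : ℕ) := by
          calc ∑ u ∈ Finset.range (s + 1), X.slope N.q u i ≤ ∑ _u ∈ Finset.range (s + 1), (1 : ℝ) :=
                Finset.sum_le_sum fun u _ => X.slope_le_one _ _ _
            _ = _ := by simp
        have h2 : ((s + 1 : ℕ) : ℝ) ≤ N.t₁ + N.t₂ := by exact_mod_cast h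
        have h3 := div_nonneg (F.level_nonneg H (s + 1) i) hc.le
        linarith
      · have h1 := F.one_le_level H (by omega : s ≤ N.T) h (fun u hu => I u (by omega)) i
        have h2 := F.level_succ_ge H (by omega : s ≤ N.T) (I s (by omega)) i h1
        have h3 := ih (by omega)
        rw [Finset.sum_range_succ]
        have h4 : X.level N.q s i / (lateRate N.q * (N.h * N.slo)) + X.slope N.q s i ≤
            X.level N.q (s + 1) i / (lateRate N.q * (N.h * N.slo)) := by
          rw [div_add' _ _ _ hc.ne']
          gcongr
          linarith
        linarith
  refine (key t le_rfl).trans ?_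
  gcongr
  exact F.level_le_of_inv H ht I i

/-- The signal is not learned, as the slopes have a bounded sum. -/
lemma Follows.sig_le_of_inv {t : ℕ} (ht : t ≤ N.T) (I : ∀ s < t, X.Inv N s) (p : Bool × Fin m) :
    |X.sig t p| ≤ N.A := by
  have hq := H.hq
  have hh := H.h_pos
  have hV := H.V_nonneg
  have hA := H.A_nonneg
  refine (F.sig_le t ht p).trans (le_trans ?_ H.signal)
  have h1 : ∑ s ∈ Finset.range t, ∑ k, X.slope N.q s k * rate N.q |X.sig s p| ≤
      N.q * N.A ^ (N.q - 1) * (n * (N.t₁ + N.t₂ + N.M / (lateRate N.q * (N.h * N.slo)))) :=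
    calc ∑ s ∈ Finset.range t, ∑ k, X.slope N.q s k * rate N.q |X.sig s p|
        ≤ ∑ s ∈ Finset.range t, ∑ k, X.slope N.q s k * (N.q * N.A ^ (N.q - 1)) := by
          refine Finset.sum_le_sum fun s hs => Finset.sum_le_sum fun k _ => ?_
          have := X.slope_pos N.q s k
          rw [← rate_of_nonneg N.q hA]
          gcongr
          exact rate_mono hq ((I s (Finset.mem_range.1 hs)).sig_le p)
      _ = N.q * N.A ^ (N.q - 1) * ∑ k, ∑ s ∈ Finset.range t, X.slope N.q s k := by
          rw [Finset.sum_comm]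
          simp_rw [← Finset.sum_mul]
          ring
      _ ≤ N.q * N.A ^ (N.q - 1) *
          ∑ _k : Fin n, (N.t₁ + N.t₂ + N.M / (lateRate N.q * (N.h * N.slo))) := by
          gcongr with k _
          exact F.sum_slope_le H ht I k
      _ = _ := by rw [Finset.sum_const, Finset.card_univ, Fintype.card_fin, nsmul_eq_mul]
  have h2 := mul_le_mul_of_nonneg_left h1 (mul_nonneg hh.le hV)
  linarith

/-- The invariant holds during the whole run: the bounds on the memorized margins, on the
cross-memorization and on the signal at time `t` need each other only at earlier times. -/
theorem Follows.inv {t : ℕ} (ht : t ≤ N.T) : X.Inv N t := by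
  induction t using Nat.strong_induction_on with
  | _ t ih =>
    have I : ∀ s < t, X.Inv N s := fun s hs => ih s hs (by omega)
    refine ⟨F.level_le_of_inv H ht I, ?_, F.sig_le_of_inv H ht I⟩
    intro p i hp
    rcases t with _ | t
    · simp [F.mem_zero]
    · exact F.other_succ_le H (by omega) (I t (by omega)) p i hp

/-- If the second stage is long enough, all margins are large in the end. -/
theorem Follows.margin_ge {κ : ℝ} (hκ : 0 < κ) (hκ1 : κ ≤ 1) (h12 : N.t₁ + N.t₂ ≤ N.T)
    (hT : N.M < ((N.T : ℝ) - (N.t₁ + N.t₂ : ℕ)) *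
      (lateRate N.q * (N.h * N.slo) * (κ / (2 * Real.exp 2)))) (i : Fin n) :
    Real.log κ⁻¹ ≤ X.margin N.q N.T i := by
  have hc : 0 < lateRate N.q * (N.h * N.slo) := by
    have := lateRate_pos H.hq; have := H.h_pos; have := H.slo_pos; positivity
  have hclose := fun t (ht : t ≤ N.T) =>
    abs_le.1 (F.abs_margin_sub_level H ht (F.inv H ht) i)
  suffices h : Real.log κ⁻¹ + 1 ≤ X.level N.q N.T i by linarith [(hclose N.T le_rfl).1]
  by_contra! hlt
  have hslope : ∀ s ≤ N.T, κ / (2 * Real.exp 2) ≤ X.slope N.q s i := by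
    intro s hs
    have h1 := F.level_mono H hs i
    have h2 : Real.exp (X.margin N.q s i) ≤ Real.exp 2 / κ :=
      calc Real.exp (X.margin N.q s i) ≤ Real.exp (2 + Real.log κ⁻¹) :=
            Real.exp_le_exp.2 (by linarith [(hclose s hs).2])
        _ = Real.exp 2 / κ := by
            rw [Real.exp_add, Real.exp_log (by positivity), div_eq_mul_inv]
    have h3 : 1 ≤ Real.exp 2 / κ := by
      rw [le_div_iff₀ hκ]
      linarith [Real.add_one_le_exp (2 : ℝ)]
    rw [slope, ← inv_div]
    gcongr
    calc 1 + Real.exp (X.margin N.q s i) ≤ Real.exp 2 / κ + Real.exp 2 / κ := by linarith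
      _ = 2 * Real.exp 2 / κ := by ring
  have key : ∀ k, N.t₁ + N.t₂ + k ≤ N.T →
      k * (lateRate N.q * (N.h * N.slo) * (κ / (2 * Real.exp 2))) ≤
        X.level N.q (N.t₁ + N.t₂ + k) i := by
    intro k
    induction k with
    | zero => intro _; simpa using F.level_nonneg H _ i
    | succ k ih =>
      intro hk
      have ht : N.t₁ + N.t₂ + k ≤ N.T := by omega
      have h1 := ih ht
      have h2 := F.level_succ_ge H ht (F.inv H ht) i
        (F.one_le_level H ht (by omega) (fun s hs => F.inv H (by omega)) i)
      have h3 := mul_le_mul_of_nonneg_left (hslope _ ht) hc.le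
      rw [← add_assoc]
      push_cast
      linarith
  have h1 := key (N.T - (N.t₁ + N.t₂)) (by omega)
  rw [Nat.add_sub_cancel' h12, Nat.cast_sub h12] at h1
  have h2 := (F.inv H le_rfl).level_le i
  linarith

end

end Traj

end NoisyCNN

namespace NoisyCNN

/-! ### The gradient of the training loss -/

lemma hasDerivAt_act {q : ℝ} (hq : 2 < q) (z : ℝ) : HasDerivAt (act q) (rate q z) z := by
  rcases lt_trichotomy z 0 with hz | rfl | hz
  · rw [rate_of_nonpos hq hz.le]
    refine (hasDerivAt_const z (0 : ℝ)).congr_of_eventuallyEq ?_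
    filter_upwards [eventually_lt_nhds hz] with x hx
    rw [act, max_eq_left hx.le, Real.zero_rpow (by linarith)]
  · rw [rate_of_nonpos hq le_rfl]
    have h := hasDerivAt_abs_rpow (0 : ℝ) (p := q) (by linarith)
    rw [mul_zero, hasDerivAt_iff_isLittleO] at h
    rw [hasDerivAt_iff_isLittleO]
    refine Asymptotics.IsBigO.trans_isLittleO ?_ h
    refine Asymptotics.IsBigO.of_bound 1 (Filter.Eventually.of_forall fun x => ?_)
    have hq0 : q ≠ 0 := by linarith
    simp only [act, abs_zero, max_self, Real.zero_rpow hq0, sub_zero, smul_zero, one_mul,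
      Real.norm_eq_abs]
    rw [abs_of_nonneg (by positivity), abs_of_nonneg (by positivity)]
    exact Real.rpow_le_rpow (le_max_left _ _) (max_le (abs_nonneg x) (le_abs_self x))
      (by linarith)
  · rw [rate_of_nonneg q hz.le]
    refine (Real.hasDerivAt_rpow_const (Or.inl hz.ne')).congr_of_eventuallyEq ?_
    filter_upwards [eventually_gt_nhds hz] with x hx
    rw [act, max_eq_right hx.le]

lemma hasDerivAt_logistic (z : ℝ) :
    HasDerivAt logistic (-(1 + Real.exp z)⁻¹) z := by
  have h1 : HasDerivAt (fun z : ℝ => 1 + Real.exp (-z)) (-Real.exp (-z)) z := by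
    have := ((hasDerivAt_id z).neg.exp).const_add 1
    simpa using this
  have h2 := h1.log (by positivity)
  have e : -(1 + Real.exp z)⁻¹ = -Real.exp (-z) / (1 + Real.exp (-z)) := by
    rw [Real.exp_neg]
    have := Real.exp_pos z
    field_simp
    ring
  rw [e]
  exact h2

section
variable {m n d : ℕ}

lemma branch_update (q : ℝ) (W : Weights m d) (p : Bool × Fin m) (u : Patch d) (b : Bool)
    (x : Patch d × Patch d) :
    branch q (Function.update W p u) b x = branch q W b x +
      if b = p.1 then (1 / (m : ℝ)) * ((act q ⟪u, x.1⟫ + act q ⟪u, x.2⟫) -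
        (act q ⟪W p, x.1⟫ + act q ⟪W p, x.2⟫)) else 0 := by
  obtain ⟨j, r⟩ := p
  by_cases h : b = j
  · subst h
    simp only [branch, if_true]
    rw [← mul_add, ← Finset.add_sum_erase _ _ (Finset.mem_univ r),
      ← Finset.add_sum_erase (a := r) (f := fun r => act q ⟪W (b, r), x.1⟫ + act q ⟪W (b, r), x.2⟫)
        _ (Finset.mem_univ r)]
    have : ∀ r' ∈ Finset.univ.erase r, act q ⟪Function.update W (b, r) u (b, r'), x.1⟫ +
        act q ⟪Function.update W (b, r) u (b, r'), x.2⟫ =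
        act q ⟪W (b, r'), x.1⟫ + act q ⟪W (b, r'), x.2⟫ := by
      intro r' hr'
      rw [Function.update_of_ne]
      simpa using (Finset.mem_erase.1 hr').1
    rw [Finset.sum_congr rfl this, Function.update_self]
    ring
  · simp only [branch, h, if_false, add_zero]
    congr 1
    refine Finset.sum_congr rfl fun r' _ => ?_
    rw [Function.update_of_ne]
    simp [h]

lemma net_update (q : ℝ) (W : Weights m d) (p : Bool × Fin m) (u : Patch d)
    (x : Patch d × Patch d) :
    net q (Function.update W p u) x = net q W x + sgn p.1 * ((1 / (m : ℝ)) *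
      ((act q ⟪u, x.1⟫ + act q ⟪u, x.2⟫) - (act q ⟪W p, x.1⟫ + act q ⟪W p, x.2⟫))) := by
  rw [net, net, branch_update, branch_update]
  cases p.1 <;> simp [sgn] <;> ring

/-- `-ℓ'` at the margin of sample `i`. -/
def lossSlope (q : ℝ) (D : Fin n → DataPoint d) (W : Weights m d) (i : Fin n) : ℝ :=
  (1 + Real.exp (sgn (D i).2 * net q W (D i).1))⁻¹

lemma trainGrad_eq {q : ℝ} (hq : 2 < q) (D : Fin n → DataPoint d) (W : Weights m d)
    (p : Bool × Fin m) :
    trainGrad q D W p = -((1 / ((n : ℝ) * m)) • ∑ i, (lossSlope q D W i * sgn (D i).2 * sgn p.1) •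
      (rate q ⟪W p, (D i).1.1⟫ • (D i).1.1 + rate q ⟪W p, (D i).1.2⟫ • (D i).1.2)) := by
  have hin : ∀ x : Patch d, HasFDerivAt (fun u : Patch d => ⟪u, x⟫) (innerSL ℝ x) (W p) := by
    intro x
    have := (innerSL ℝ x).hasFDerivAt (x := W p)
    refine this.congr_of_eventuallyEq (Filter.Eventually.of_forall fun u => ?_)
    simp [real_inner_comm]
  have hact : ∀ x : Patch d, HasFDerivAt (fun u : Patch d => act q ⟪u, x⟫)
      (rate q ⟪W p, x⟫ • innerSL ℝ x) (W p) := fun x =>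
    (hasDerivAt_act hq _).comp_hasFDerivAt (W p) (hin x)
  have hnet : ∀ i, HasFDerivAt (fun u : Patch d => sgn (D i).2 * net q (Function.update W p u) (D i).1)
      (sgn (D i).2 • sgn p.1 • (1 / (m : ℝ)) • (rate q ⟪W p, (D i).1.1⟫ • innerSL ℝ (D i).1.1 +
        rate q ⟪W p, (D i).1.2⟫ • innerSL ℝ (D i).1.2)) (W p) := by
    intro i
    simp_rw [net_update]
    exact (((((hact _).add (hact _)).sub_const _).const_mul _).const_mul _ |>.const_add _).const_mul _
  have hloss : ∀ i, HasFDerivAt (fun u : Patch d =>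
      logistic (sgn (D i).2 * net q (Function.update W p u) (D i).1))
      ((-lossSlope q D W i) • sgn (D i).2 • sgn p.1 • (1 / (m : ℝ)) •
        (rate q ⟪W p, (D i).1.1⟫ • innerSL ℝ (D i).1.1 +
          rate q ⟪W p, (D i).1.2⟫ • innerSL ℝ (D i).1.2)) (W p) := by
    intro i
    have h := (hasDerivAt_logistic
      (sgn (D i).2 * net q (Function.update W p (W p)) (D i).1)).comp_hasFDerivAt (W p) (hnet i)
    rw [Function.update_eq_self] at h
    exact h
  have htot := (HasFDerivAt.fun_sum fun i (_ : i ∈ Finset.univ) => hloss i).const_mul (1 / (n : ℝ))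
  have hg : HasGradientAt (fun u : Patch d => trainLoss q D (Function.update W p u))
      (-((1 / ((n : ℝ) * m)) • ∑ i, (lossSlope q D W i * sgn (D i).2 * sgn p.1) •
      (rate q ⟪W p, (D i).1.1⟫ • (D i).1.1 + rate q ⟪W p, (D i).1.2⟫ • (D i).1.2))) (W p) := by
    rw [hasGradientAt_iff_hasFDerivAt]
    refine htot.congr_fderiv ?_
    ext y
    simp only [InnerProductSpace.toDual_apply_apply, inner_neg_left, inner_smul_left, sum_inner,
      inner_add_left, smul_apply, add_apply,
      sum_apply, innerSL_apply_apply, smul_eq_mul, RCLike.conj_to_real]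
    rw [Finset.mul_sum, Finset.mul_sum, ← Finset.sum_neg_distrib]
    refine Finset.sum_congr rfl fun i _ => ?_
    rw [one_div ((n : ℝ) * m), mul_inv]
    ring
  exact hg.gradient

/-! ### The scalar quantities along a run -/

/-- The scalar dynamics of a run of noisy gradient descent. -/
def runTraj (q η : ℝ) (v : Patch d) (D : Fin n → DataPoint d) (W₀ : Weights m d)
    (z : ℕ → Weights m d) : Traj n m where
  label i := (D i).2
  corr t p i := ⟪noisyGD q η D W₀ z t p, (D i).1.2⟫
  sig t p := ⟪noisyGD q η D W₀ z t p, v⟫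
  mem t p i := ∑ s ∈ Finset.range t, η / ((n : ℝ) * m) *
    lossSlope q D (noisyGD q η D W₀ z s) i * rate q ⟪noisyGD q η D W₀ z s p, (D i).1.2⟫
  sq i := ‖(D i).1.2‖ ^ 2

variable {q η : ℝ} {v : Patch d} {D : Fin n → DataPoint d} {W₀ : Weights m d}
  {z : ℕ → Weights m d}

lemma runTraj_margin (hD : ∀ i, (D i).1.1 = sgn (D i).2 • v) (t : ℕ) (i : Fin n) :
    (runTraj q η v D W₀ z).margin q t i =
      sgn (D i).2 * net q (noisyGD q η D W₀ z t) (D i).1 := by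
  have h : ∀ p, ⟪noisyGD q η D W₀ z t p, (D i).1.1⟫ =
      sgn (D i).2 * ⟪noisyGD q η D W₀ z t p, v⟫ := fun p => by
    rw [hD, inner_smul_right]
  simp only [Traj.margin, runTraj, net, branch, h]
  cases (D i).2 <;> simp [sgn]

lemma runTraj_slope (hD : ∀ i, (D i).1.1 = sgn (D i).2 • v) (t : ℕ) (i : Fin n) :
    (runTraj q η v D W₀ z).slope q t i = lossSlope q D (noisyGD q η D W₀ z t) i := by
  rw [Traj.slope, runTraj_margin hD, lossSlope]

lemma noisyGD_succ (hq : 2 < q) (hD : ∀ i, (D i).1.1 = sgn (D i).2 • v) (t : ℕ)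
    (p : Bool × Fin m) (y : Patch d) :
    ⟪noisyGD q η D W₀ z (t + 1) p, y⟫ = ⟪noisyGD q η D W₀ z t p, y⟫ - η * ⟪z t p, y⟫ +
      ∑ k, η / ((n : ℝ) * m) * lossSlope q D (noisyGD q η D W₀ z t) k * sgn p.1 *
        (rate q (sgn (D k).2 * ⟪noisyGD q η D W₀ z t p, v⟫) * ⟪v, y⟫ +
          sgn (D k).2 * rate q ⟪noisyGD q η D W₀ z t p, (D k).1.2⟫ * ⟪(D k).1.2, y⟫) := by
  have e : noisyGD q η D W₀ z (t + 1) p = noisyGD q η D W₀ z t p -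
      η • (trainGrad q D (noisyGD q η D W₀ z t) p + z t p) := rfl
  rw [e, trainGrad_eq hq]
  simp only [inner_sub_left, inner_smul_left, inner_add_left, inner_neg_left, sum_inner,
    RCLike.conj_to_real]
  rw [mul_add, mul_neg, Finset.mul_sum, Finset.mul_sum]
  have : ∀ k, η * (1 / ((n : ℝ) * m) * (lossSlope q D (noisyGD q η D W₀ z t) k * sgn (D k).2 *
      sgn p.1 * (rate q ⟪noisyGD q η D W₀ z t p, (D k).1.1⟫ * ⟪(D k).1.1, y⟫ +
        rate q ⟪noisyGD q η D W₀ z t p, (D k).1.2⟫ * ⟪(D k).1.2, y⟫))) =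
      η / ((n : ℝ) * m) * lossSlope q D (noisyGD q η D W₀ z t) k * sgn p.1 *
        (rate q (sgn (D k).2 * ⟪noisyGD q η D W₀ z t p, v⟫) * ⟪v, y⟫ +
          sgn (D k).2 * rate q ⟪noisyGD q η D W₀ z t p, (D k).1.2⟫ * ⟪(D k).1.2, y⟫) := by
    intro k
    rw [hD, inner_smul_right, inner_smul_left, RCLike.conj_to_real]
    have := sgn_mul_self (D k).2
    linear_combination (η / ((n : ℝ) * m) * lossSlope q D (noisyGD q η D W₀ z t) k * sgn p.1 *
      rate q (sgn (D k).2 * ⟪noisyGD q η D W₀ z t p, v⟫) * ⟪v, y⟫) * this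
  rw [Finset.sum_congr rfl fun k _ => this k]
  ring

lemma runTraj_corr (hq : 2 < q) (hD : ∀ i, (D i).1.1 = sgn (D i).2 • v)
    (hv : ∀ i, ⟪v, (D i).1.2⟫ = 0) (t : ℕ) (p : Bool × Fin m) (i : Fin n) :
    (runTraj q η v D W₀ z).corr t p i = (runTraj q η v D W₀ z).corr 0 p i -
      η * ∑ s ∈ Finset.range t, ⟪z s p, (D i).1.2⟫ +
      ∑ k, sgn p.1 * sgn (D k).2 * (runTraj q η v D W₀ z).mem t p k * ⟪(D k).1.2, (D i).1.2⟫ := by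
  induction t with
  | zero => simp [runTraj]
  | succ t ih =>
    have h := noisyGD_succ (W₀ := W₀) (z := z) (η := η) hq hD t p (D i).1.2
    simp only [runTraj] at ih ⊢
    simp only [hv, mul_zero, zero_add] at h
    rw [h, ih, Finset.sum_range_succ]
    simp_rw [Finset.sum_range_succ, mul_add, add_mul, Finset.sum_add_distrib]
    have : ∀ k, η / ((n : ℝ) * m) * lossSlope q D (noisyGD q η D W₀ z t) k * sgn p.1 *
        (sgn (D k).2 * rate q ⟪noisyGD q η D W₀ z t p, (D k).1.2⟫ * ⟪(D k).1.2, (D i).1.2⟫) =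
        sgn p.1 * sgn (D k).2 * (η / ((n : ℝ) * m) * lossSlope q D (noisyGD q η D W₀ z t) k *
          rate q ⟪noisyGD q η D W₀ z t p, (D k).1.2⟫) * ⟪(D k).1.2, (D i).1.2⟫ := by
      intro k; ring
    rw [Finset.sum_congr rfl fun k _ => this k]
    ring

lemma runTraj_sig (hq : 2 < q) (hD : ∀ i, (D i).1.1 = sgn (D i).2 • v)
    (hv : ∀ i, ⟪v, (D i).1.2⟫ = 0) (t : ℕ) (p : Bool × Fin m) :
    (runTraj q η v D W₀ z).sig t p = (runTraj q η v D W₀ z).sig 0 p -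
      η * ∑ s ∈ Finset.range t, ⟪z s p, v⟫ +
      sgn p.1 * (η / ((n : ℝ) * m) * ‖v‖ ^ 2 * ∑ s ∈ Finset.range t, ∑ k,
        (runTraj q η v D W₀ z).slope q s k *
          rate q (sgn (D k).2 * (runTraj q η v D W₀ z).sig s p)) := by
  induction t with
  | zero => simp [runTraj]
  | succ t ih =>
    have h := noisyGD_succ (W₀ := W₀) (z := z) (η := η) hq hD t p v
    simp only [runTraj_slope hD] at ih ⊢
    simp only [runTraj] at ih ⊢
    have hv' : ∀ k, ⟪(D k).1.2, v⟫ = 0 := fun k => by rw [real_inner_comm]; exact hv k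
    simp only [hv', mul_zero, add_zero, real_inner_self_eq_norm_sq] at h
    have : ∀ k, η / ((n : ℝ) * m) * lossSlope q D (noisyGD q η D W₀ z t) k * sgn p.1 *
        (rate q (sgn (D k).2 * ⟪noisyGD q η D W₀ z t p, v⟫) * ‖v‖ ^ 2) =
        sgn p.1 * (η / ((n : ℝ) * m) * ‖v‖ ^ 2) * (lossSlope q D (noisyGD q η D W₀ z t) k *
          rate q (sgn (D k).2 * ⟪noisyGD q η D W₀ z t p, v⟫)) := by
      intro k; ring
    rw [Finset.sum_congr rfl fun k _ => this k, ← Finset.mul_sum] at h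
    rw [Finset.sum_range_succ, Finset.sum_range_succ]
    linear_combination h + ih

/-- The properties of the data, the initialization and the private noise that make a run of noisy
gradient descent follow the scalar dynamics. -/
structure Typical (η : ℝ) (v : Patch d) (N : Scales) (D : Fin n → DataPoint d) (W₀ : Weights m d)
    (z : ℕ → Weights m d) : Prop where
  signal_patch : ∀ i, (D i).1.1 = sgn (D i).2 • v
  orth : ∀ i, ⟪v, (D i).1.2⟫ = 0
  sq_ge : ∀ i, N.slo ≤ ‖(D i).1.2‖ ^ 2
  sq_le : ∀ i, ‖(D i).1.2‖ ^ 2 ≤ N.shi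
  gram : ∀ i k, i ≠ k → |⟪(D k).1.2, (D i).1.2⟫| ≤ N.R
  init : ∀ p i, |⟪W₀ p, (D i).1.2⟫| ≤ N.B
  good : ∀ i j, N.p₁ * m ≤
    ((Finset.univ.filter fun r => 3 * N.x₀ ≤ ⟪W₀ (j, r), (D i).1.2⟫).card : ℝ)
  init_sig : ∀ p, |⟪W₀ p, v⟫| ≤ N.A₀ / 2
  noise : ∀ t ≤ N.T, ∀ p i, η * |∑ s ∈ Finset.range t, ⟪z s p, (D i).1.2⟫| ≤ N.B
  noise_early : ∀ t ≤ N.T, t ≤ N.t₁ + N.t₂ → ∀ p i,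
    η * |∑ s ∈ Finset.range t, ⟪z s p, (D i).1.2⟫| ≤ N.x₀
  noise_sig : ∀ t ≤ N.T, ∀ p, η * |∑ s ∈ Finset.range t, ⟪z s p, v⟫| ≤ N.A₀ / 2

/-- The deterministic part of the gradient descent recursion, written in coordinates: along a noise
patch only its own coefficient matters, the other ones entering through the small off-diagonal Gram
entries, and along the signal only the signal patches matter, as the noise patches are orthogonal
to it. -/
theorem Typical.follows {N : Scales} (hη : 0 < η) (hq : 2 < N.q)
    (hh : N.h = η / ((n : ℝ) * m)) (hV : N.V = ‖v‖ ^ 2) (hR : 0 ≤ N.R)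
    (E : Typical η v N D W₀ z) : (runTraj N.q η v D W₀ z).Follows N := by
  set X := runTraj N.q η v D W₀ z with hX
  have hh0 : 0 ≤ N.h := by rw [hh]; positivity
  have hmem : ∀ t p i, 0 ≤ X.mem t p i := by
    intro t p i
    simp only [hX, runTraj]
    refine Finset.sum_nonneg fun s _ => mul_nonneg (mul_nonneg (by positivity) ?_)
      (rate_nonneg hq _)
    unfold lossSlope; positivity
  have approx : ∀ ν t p i, η * |∑ s ∈ Finset.range t, ⟪z s p, (D i).1.2⟫| ≤ ν →
      |X.corr t p i - X.corr 0 p i - sgn p.1 * sgn (X.label i) * (X.mem t p i * X.sq i)| ≤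
      ν + N.R * ∑ k, X.mem t p k := by
    intro ν t p i hν
    rw [hX, runTraj_corr hq E.signal_patch E.orth, ← hX,
      ← Finset.add_sum_erase _ _ (Finset.mem_univ i)]
    have e : ⟪(D i).1.2, (D i).1.2⟫ = X.sq i := real_inner_self_eq_norm_sq _
    have e' : (D i).2 = X.label i := rfl
    rw [e, e']
    have h1 : |∑ k ∈ Finset.univ.erase i, sgn p.1 * sgn (D k).2 * X.mem t p k *
        ⟪(D k).1.2, (D i).1.2⟫| ≤ N.R * ∑ k, X.mem t p k := by
      calc _ ≤ ∑ k ∈ Finset.univ.erase i, |sgn p.1 * sgn (D k).2 * X.mem t p k *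
              ⟪(D k).1.2, (D i).1.2⟫| := Finset.abs_sum_le_sum_abs _ _
        _ ≤ ∑ k ∈ Finset.univ.erase i, N.R * X.mem t p k := by
            refine Finset.sum_le_sum fun k hk => ?_
            rw [abs_mul, abs_mul, abs_mul, abs_sgn, abs_sgn, one_mul, one_mul,
              abs_of_nonneg (hmem t p k), mul_comm]
            exact mul_le_mul_of_nonneg_right (E.gram i k (Finset.ne_of_mem_erase hk).symm)
              (hmem t p k)
        _ ≤ ∑ k, N.R * X.mem t p k :=
            Finset.sum_le_sum_of_subset_of_nonneg (Finset.erase_subset _ _)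
              fun k _ _ => mul_nonneg hR (hmem t p k)
        _ = _ := (Finset.mul_sum _ _ _).symm
    have h2 : |η * ∑ s ∈ Finset.range t, ⟪z s p, (D i).1.2⟫| ≤ ν := by
      rwa [abs_mul, abs_of_pos hη]
    rw [abs_le] at *
    constructor <;> linarith
  exact {
    mem_zero := fun p i => by simp [hX, runTraj]
    mem_succ := fun t p i => by
      rw [hX, runTraj_slope E.signal_patch, hh]
      simp only [runTraj, Finset.sum_range_succ]
    corr_init := E.init
    corr_approx := fun t ht p i => approx _ t p i (E.noise t ht p i)
    corr_approx_early := fun t ht ht' p i => approx _ t p i (E.noise_early t ht ht' p i)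
    good := fun i => E.good i (X.label i)
    sig_le := fun t ht p => by
      have h0 := E.init_sig p
      have h1 : |η * ∑ s ∈ Finset.range t, ⟪z s p, v⟫| ≤ N.A₀ / 2 := by
        rw [abs_mul, abs_of_pos hη]; exact E.noise_sig t ht p
      have h2 : |sgn p.1 * (η / ((n : ℝ) * m) * ‖v‖ ^ 2 * ∑ s ∈ Finset.range t, ∑ k,
          X.slope N.q s k * rate N.q (sgn (D k).2 * X.sig s p))| ≤ N.h * N.V *
          ∑ s ∈ Finset.range t, ∑ k, X.slope N.q s k * rate N.q |X.sig s p| := by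
        rw [abs_mul, abs_sgn, one_mul, ← hh, ← hV, abs_of_nonneg]
        · have : 0 ≤ N.V := by rw [hV]; positivity
          gcongr with s _ k _
          · exact (X.slope_pos _ _ _).le
          · apply rate_mono hq
            calc sgn (D k).2 * X.sig s p ≤ |sgn (D k).2 * X.sig s p| := le_abs_self _
              _ = _ := by rw [abs_mul, abs_sgn, one_mul]
        · have : 0 ≤ N.V := by rw [hV]; positivity
          refine mul_nonneg (by positivity) (Finset.sum_nonneg fun s _ => Finset.sum_nonneg
            fun k _ => mul_nonneg (X.slope_pos _ _ _).le (rate_nonneg hq _))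
      have e : X.sig 0 p = ⟪W₀ p, v⟫ := rfl
      rw [hX, runTraj_sig hq E.signal_patch E.orth, ← hX, e]
      rw [abs_le] at *
      constructor <;> linarith
    sq_ge := E.sq_ge
    sq_le := E.sq_le }

end

end NoisyCNN

namespace NoisyCNN

/-! ### The laws of the data -/

section
variable {d : ℕ}

/-- `projH v` as a continuous linear map. -/
def projL (v : Patch d) : Patch d →L[ℝ] Patch d :=
  ContinuousLinearMap.id ℝ (Patch d) - ((‖v‖ ^ 2)⁻¹ • innerSL ℝ v).smulRight v

lemma projL_apply (v x : Patch d) : projL v x = projH v x := by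
  simp [projL, projH, div_eq_inv_mul]

lemma continuous_projH (v : Patch d) : Continuous (projH v) :=
  (projL v).continuous.congr (projL_apply v)

lemma inner_projH_left {v : Patch d} (hv : v ≠ 0) (x : Patch d) : ⟪v, projH v x⟫ = 0 := by
  have : ‖v‖ ≠ 0 := norm_ne_zero_iff.2 hv
  rw [projH, inner_sub_right, inner_smul_right, real_inner_self_eq_norm_sq]
  field_simp
  ring

lemma inner_projH_symm (v x y : Patch d) : ⟪projH v x, y⟫ = ⟪x, projH v y⟫ := by
  rw [projH, projH, inner_sub_left, inner_sub_right, inner_smul_left, inner_smul_right,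
    real_inner_comm x v]
  simp
  ring

lemma norm_projH_sq {v : Patch d} (hv : v ≠ 0) (x : Patch d) :
    ‖projH v x‖ ^ 2 = ‖x‖ ^ 2 - (⟪v, x⟫ / ‖v‖) ^ 2 := by
  have : ‖v‖ ≠ 0 := norm_ne_zero_iff.2 hv
  rw [← real_inner_self_eq_norm_sq, ← real_inner_self_eq_norm_sq]
  nth_rewrite 2 [projH]
  rw [inner_sub_right, inner_smul_right, real_inner_comm v, inner_projH_left hv, projH,
    inner_sub_left, inner_smul_left]
  simp
  field_simp

instance : IsProbabilityMeasure rademacher := by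
  refine ⟨?_⟩
  simp [rademacher, ENNReal.inv_two_add_inv_two]

lemma dataNoise_eq (v : Patch d) (s : ℝ) :
    dataNoise v s = (stdGaussian (Patch d)).map (s • projL v) := by
  rw [dataNoise]
  congr 1
  ext1 x
  simp [projL_apply]

instance (v : Patch d) (s : ℝ) : IsGaussian (dataNoise v s) := by
  rw [dataNoise_eq]; infer_instance

instance (s : ℝ) : IsProbabilityMeasure (isoGaussian d s) :=
  Measure.isProbabilityMeasure_map (by fun_prop)

lemma measurable_toDataPoint (v : Patch d) :
    Measurable fun p : Bool × Patch d => (((sgn p.1 • v, p.2), p.1) : DataPoint d) := by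
  have h : Measurable fun p : Bool × Patch d => sgn p.1 • v :=
    (Measurable.of_discrete (f := fun y : Bool => sgn y • v)).comp measurable_fst
  fun_prop

instance (v : Patch d) (s : ℝ) : IsProbabilityMeasure (dataLaw v s) :=
  Measure.isProbabilityMeasure_map (measurable_toDataPoint v).aemeasurable

lemma dataLaw_map_noise (v : Patch d) (s : ℝ) :
    (dataLaw v s).map (fun p => p.1.2) = dataNoise v s := by
  rw [dataLaw, Measure.map_map (by fun_prop) (measurable_toDataPoint v)]
  exact Measure.map_snd_prod.trans (by rw [measure_univ, one_smul])

lemma dataLaw_ae {v : Patch d} (hv : v ≠ 0) (s : ℝ) :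
    ∀ᵐ p ∂(dataLaw v s), p.1.1 = sgn p.2 • v ∧ ⟪v, p.1.2⟫ = 0 := by
  have h1 : ∀ᵐ p ∂(dataLaw v s), p.1.1 = sgn p.2 • v := by
    have hm : Measurable fun p : DataPoint d => sgn p.2 • v :=
      (Measurable.of_discrete (f := fun y : Bool => sgn y • v)).comp measurable_snd
    rw [dataLaw, ae_map_iff (measurable_toDataPoint v).aemeasurable
      (measurableSet_eq_fun (by fun_prop) hm)]
    exact Filter.Eventually.of_forall fun p => rfl
  have h2 : ∀ᵐ x ∂(dataNoise v s), ⟪v, x⟫ = 0 := by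
    have hc : Continuous fun x => s • projH v x := (continuous_projH v).const_smul s
    rw [dataNoise, ae_map_iff hc.measurable.aemeasurable
      (measurableSet_eq_fun (by fun_prop) (by fun_prop))]
    exact Filter.Eventually.of_forall fun x => by
      rw [inner_smul_right, inner_projH_left hv, mul_zero]
  have h3 : ∀ᵐ p ∂(dataLaw v s), ⟪v, p.1.2⟫ = 0 := by
    rw [← dataLaw_map_noise] at h2
    exact ae_of_ae_map (by fun_prop) h2
  filter_upwards [h1, h3] with p hp hp' using ⟨hp, hp'⟩

end

/-! ### The test loss -/

lemma logistic_nonneg (z : ℝ) : 0 ≤ logistic z :=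
  Real.log_nonneg (by linarith [Real.exp_pos (-z)])

lemma logistic_anti {x y : ℝ} (h : x ≤ y) : logistic y ≤ logistic x := by
  unfold logistic
  gcongr

lemma logistic_le_exp (z : ℝ) : logistic z ≤ Real.exp (-z) := by
  have := Real.log_le_sub_one_of_pos (x := 1 + Real.exp (-z)) (by positivity)
  unfold logistic; linarith

lemma logistic_le (z : ℝ) : logistic z ≤ 1 + |z| := by
  calc logistic z ≤ logistic (-|z|) := logistic_anti (neg_abs_le z)
    _ ≤ Real.log (Real.exp 1 * Real.exp |z|) := by
      unfold logistic
      rw [neg_neg]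
      apply Real.log_le_log (by positivity)
      have h1 : 1 ≤ Real.exp |z| := Real.one_le_exp (abs_nonneg z)
      nlinarith [Real.add_one_le_exp (1 : ℝ)]
    _ = 1 + |z| := by rw [← Real.exp_add, Real.log_exp]

lemma logistic_one_ge : (0.2 : ℝ) ≤ logistic 1 := by
  have h1 : (0.36 : ℝ) ≤ Real.exp (-1) := by linarith [Real.exp_neg_one_gt_d9]
  have h2 := Real.one_sub_inv_le_log_of_pos (x := 1 + Real.exp (-1)) (by positivity)
  have h3 : (1 + Real.exp (-1))⁻¹ ≤ (1.36 : ℝ)⁻¹ := by gcongr; linarith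
  unfold logistic
  norm_num at h3 ⊢
  linarith

lemma continuous_logistic : Continuous logistic :=
  continuous_iff_continuousAt.2 fun z => (hasDerivAt_logistic z).continuousAt

lemma continuous_act {q : ℝ} (hq : 2 < q) : Continuous (act q) :=
  continuous_iff_continuousAt.2 fun z => (hasDerivAt_act hq z).continuousAt

section
variable {m d : ℕ}

lemma continuous_net {q : ℝ} (hq : 2 < q) (W : Weights m d) : Continuous (net q W) := by
  have := continuous_act hq
  unfold net branch
  fun_prop

lemma integrable_act_inner {q : ℝ} (hq : 2 < q) (v w : Patch d) (s : ℝ) :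
    Integrable (fun x => act q ⟪w, x⟫) (dataNoise v s) := by
  have h := (IsGaussian.memLp_id (dataNoise v s) (ENNReal.ofReal q) (by simp)).integrable_norm_rpow
    (by simpa using by linarith) (by simp)
  rw [ENNReal.toReal_ofReal (by linarith)] at h
  refine (h.const_mul (‖w‖ ^ q)).mono' ?_ (Filter.Eventually.of_forall fun x => ?_)
  · have := continuous_act hq
    exact Continuous.aestronglyMeasurable (by fun_prop)
  · rw [Real.norm_of_nonneg (act_nonneg _ _), ← Real.mul_rpow (norm_nonneg _) (norm_nonneg _), act]
    refine Real.rpow_le_rpow (le_max_left _ _) ?_ (by linarith)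
    exact max_le (by positivity) (real_inner_le_norm w x)

lemma integrable_loss {q : ℝ} (hq : 2 < q) (v : Patch d) (s : ℝ) (W : Weights m d) (y : Bool) :
    Integrable (fun x => logistic (sgn y * net q W (sgn y • v, x))) (dataNoise v s) := by
  have hb : ∀ b, Integrable (fun x => branch q W b (sgn y • v, x)) (dataNoise v s) := by
    intro b
    unfold branch
    refine (integrable_finsetSum _ fun r _ => ?_).const_mul _
    exact (integrable_const (act q ⟪W (b, r), sgn y • v⟫)).add (integrable_act_inner hq v _ s)
  have h : Integrable (fun x => sgn y * net q W (sgn y • v, x)) (dataNoise v s) :=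
    ((hb true).sub (hb false)).const_mul _
  refine ((integrable_const (1 : ℝ)).add h.abs).mono' ?_ (Filter.Eventually.of_forall fun x => ?_)
  · have := continuous_logistic
    have := continuous_net hq W
    exact Continuous.aestronglyMeasurable (by fun_prop)
  · rw [Real.norm_of_nonneg (logistic_nonneg _)]
    exact logistic_le _

lemma testLoss_eq {q : ℝ} (hq : 2 < q) (v : Patch d) (s : ℝ) (W : Weights m d) :
    testLoss q v s W = ∫ x, 2⁻¹ * (logistic (net q W (v, x)) + logistic (-net q W (-v, x)))
      ∂(dataNoise v s) := by
  have hm : Measurable fun p : DataPoint d => logistic (sgn p.2 * net q W p.1) := by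
    have h1 := continuous_logistic.measurable
    have h2 := (continuous_net hq W).measurable
    have h3 : Measurable sgn := Measurable.of_discrete
    fun_prop
  have hm' : Measurable fun p : Bool × Patch d =>
      logistic (sgn p.1 * net q W (sgn p.1 • v, p.2)) := hm.comp (measurable_toDataPoint v)
  have hi := fun y => integrable_loss hq v s W y
  have key : ∀ y : Bool, Integrable (fun p : Bool × Patch d =>
      logistic (sgn p.1 * net q W (sgn p.1 • v, p.2))) ((Measure.dirac y).prod (dataNoise v s)) ∧
      ∫ p : Bool × Patch d, logistic (sgn p.1 * net q W (sgn p.1 • v, p.2))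
        ∂((Measure.dirac y).prod (dataNoise v s)) =
      ∫ x, logistic (sgn y * net q W (sgn y • v, x)) ∂(dataNoise v s) := by
    intro y
    rw [Measure.dirac_prod]
    refine ⟨?_, ?_⟩
    · rw [integrable_map_measure hm'.aestronglyMeasurable (by fun_prop)]
      exact hi y
    · rw [integral_map (by fun_prop) hm'.aestronglyMeasurable]
  rw [testLoss, dataLaw, integral_map (measurable_toDataPoint v).aemeasurable
    hm.aestronglyMeasurable, rademacher, Measure.add_prod, Measure.prod_smul_left,
    Measure.prod_smul_left, integral_add_measure ((key true).1.smul_measure (by simp))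
      ((key false).1.smul_measure (by simp)), integral_smul_measure, integral_smul_measure,
    (key true).2, (key false).2, integral_const_mul, integral_add]
  · simp [sgn]; ring
  · simpa [sgn] using hi true
  · simpa [sgn] using hi false

/-- If no filter has learned the signal, then the sign of the network at a fresh data point is
dominated by the noise patch, which is independent of the label. -/
theorem testLoss_ge {q : ℝ} (hq : 2 < q) (hm : 0 < m) (v : Patch d) (s : ℝ) (W : Weights m d)
    (hW : ∀ p, |⟪W p, v⟫| ≤ 1) : 0.1 ≤ testLoss q v s W := by
  rw [testLoss_eq hq]
  have key : ∀ x : Patch d,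
      (0.1 : ℝ) ≤ 2⁻¹ * (logistic (net q W (v, x)) + logistic (-net q W (-v, x))) := by
    intro x
    have hsum : ∀ (b : Bool) (u : Patch d), (∀ p, |⟪W p, u⟫| ≤ 1) →
        0 ≤ (1 / (m : ℝ)) * ∑ r, act q ⟪W (b, r), u⟫ ∧
        (1 / (m : ℝ)) * ∑ r, act q ⟪W (b, r), u⟫ ≤ 1 := by
      intro b u hu
      constructor
      · exact mul_nonneg (by positivity) (Finset.sum_nonneg fun r _ => act_nonneg _ _)
      · calc (1 / (m : ℝ)) * ∑ r, act q ⟪W (b, r), u⟫ ≤ (1 / (m : ℝ)) * ∑ _r : Fin m, 1 := by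
              gcongr with r _
              exact act_le_of_le (by linarith) ((le_abs_self _).trans (hu _)) zero_le_one le_rfl
          _ = 1 := by simp; field_simp
    have hW' : ∀ p, |⟪W p, -v⟫| ≤ 1 := fun p => by rw [inner_neg_right, abs_neg]; exact hW p
    set Γ := (1 / (m : ℝ)) * ∑ r, act q ⟪W (true, r), x⟫ -
      (1 / (m : ℝ)) * ∑ r, act q ⟪W (false, r), x⟫ with hΓ
    have hnet : ∀ u, net q W (u, x) = (1 / (m : ℝ)) * ∑ r, act q ⟪W (true, r), u⟫ -
        (1 / (m : ℝ)) * ∑ r, act q ⟪W (false, r), u⟫ + Γ := by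
      intro u
      simp only [net, branch, Finset.sum_add_distrib, hΓ]
      ring
    have h1 : logistic (1 + Γ) ≤ logistic (net q W (v, x)) := by
      apply logistic_anti
      rw [hnet]
      linarith [(hsum true v hW).2, (hsum false v hW).1]
    have h2 : logistic (1 - Γ) ≤ logistic (-net q W (-v, x)) := by
      apply logistic_anti
      rw [hnet]
      linarith [(hsum true (-v) hW').1, (hsum false (-v) hW').2]
    have h3 := logistic_one_ge
    have h4 := logistic_nonneg (1 + Γ)
    have h5 := logistic_nonneg (1 - Γ)
    rcases le_total Γ 0 with h | h
    · have := logistic_anti (by linarith : 1 + Γ ≤ 1)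
      norm_num at h3 ⊢; linarith
    · have := logistic_anti (by linarith : 1 - Γ ≤ 1)
      norm_num at h3 ⊢; linarith
  have hi : Integrable (fun x => 2⁻¹ * (logistic (net q W (v, x)) + logistic (-net q W (-v, x))))
      (dataNoise v s) := by
    have h1 := integrable_loss hq v s W true
    have h2 := integrable_loss hq v s W false
    simp only [sgn, if_true, one_smul, one_mul, Bool.false_eq_true, if_false, neg_smul,
      neg_mul] at h1 h2
    exact (h1.add h2).const_mul _
  calc (0.1 : ℝ) = ∫ _x, (0.1 : ℝ) ∂(dataNoise v s) := by simp
    _ ≤ _ := integral_mono (integrable_const _) hi key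

end

end NoisyCNN

namespace NoisyCNN

/-! ### Gaussian tail bounds -/

lemma measure_le_ofReal_integral {α : Type*} [MeasurableSpace α] {μ : Measure α} {f : α → ℝ}
    (hf : Integrable f μ) (h0 : ∀ x, 0 ≤ f x) {S : Set α} (hS : ∀ x ∈ S, 1 ≤ f x) :
    μ S ≤ ENNReal.ofReal (∫ x, f x ∂μ) := by
  rw [ofReal_integral_eq_lintegral_ofReal hf (Filter.Eventually.of_forall h0)]
  refine meas_le_lintegral₀ hf.aemeasurable.ennreal_ofReal fun x hx => ?_
  rw [← ENNReal.ofReal_one]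
  exact ENNReal.ofReal_le_ofReal (hS x hx)

section
variable {d : ℕ}

/-- The coordinates of a standard Gaussian vector are standard Gaussian. -/
lemma stdGaussian_map_inner (x : Patch d) :
    (stdGaussian (Patch d)).map (fun w => ⟪w, x⟫) = gaussianReal 0 (‖x‖ ^ 2).toNNReal := by
  have h := IsGaussian.map_eq_gaussianReal (μ := stdGaussian (Patch d)) (innerSL ℝ x)
  rw [integral_strongDual_stdGaussian, variance_dual_stdGaussian, innerSL_apply_norm] at h
  rw [← h]
  congr 1
  ext w
  simp [real_inner_comm]

lemma isoGaussian_map_inner (s : ℝ) (x : Patch d) :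
    (isoGaussian d s).map (fun w => ⟪w, x⟫) = gaussianReal 0 ((s * ‖x‖) ^ 2).toNNReal := by
  rw [isoGaussian, Measure.map_map (by fun_prop) (by fun_prop)]
  have : (fun w : Patch d => ⟪w, x⟫) ∘ (fun w => s • w) = fun w => ⟪w, s • x⟫ := by
    ext w
    simp [inner_smul_left, inner_smul_right]
  rw [this, stdGaussian_map_inner, norm_smul, mul_pow, mul_pow, Real.norm_eq_abs, sq_abs]

/-- The moment generating function of a centred Gaussian of standard deviation `s`. -/
lemma integral_exp_of_map_gaussian {α : Type*} [MeasurableSpace α] {ν : Measure α} {φ : α → ℝ}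
    {s : ℝ} (hφ : Measurable φ) (h : ν.map φ = gaussianReal 0 (s ^ 2).toNNReal) (l : ℝ) :
    Integrable (fun z => Real.exp (l * φ z)) ν ∧
      ∫ z, Real.exp (l * φ z) ∂ν = Real.exp (l ^ 2 * s ^ 2 / 2) := by
  constructor
  · have := integrable_exp_mul_gaussianReal (μ := 0) (v := (s ^ 2).toNNReal) l
    rw [← h] at this
    exact (integrable_map_measure this.aestronglyMeasurable hφ.aemeasurable).1 this
  · have := mgf_gaussianReal h l
    rw [mgf, Real.coe_toNNReal _ (sq_nonneg s)] at this
    rw [this]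
    congr 1
    ring

/-! ### The maximal inequality for Gaussian random walks -/

/-- The partial sums of `φ ∘ z` reach the level `x`. -/
def Hits {α : Type*} (φ : α → ℝ) {T : ℕ} (x : ℝ) (z : Fin T → α) : Prop :=
  ∃ t ≤ T, x ≤ ∑ s : Fin T, if (s : ℕ) < t then φ (z s) else 0

lemma measurableSet_hits {α : Type*} [MeasurableSpace α] {φ : α → ℝ} (hφ : Measurable φ) {T : ℕ}
    {β : Type*} [MeasurableSpace β] {x : β → ℝ} (hx : Measurable x) {z : β → Fin T → α}
    (hz : Measurable z) : MeasurableSet {b | Hits φ (x b) (z b)} := by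
  have : {b | Hits φ (x b) (z b)} = ⋃ t ∈ Finset.range (T + 1),
      {b | x b ≤ ∑ s : Fin T, if (s : ℕ) < t then φ (z b s) else 0} := by
    ext b; simp [Hits]
  rw [this]
  refine Finset.measurableSet_biUnion _ fun t _ => measurableSet_le hx ?_
  refine Finset.measurable_sum _ fun s _ => ?_
  split_ifs
  · exact hφ.comp ((measurable_pi_apply s).comp hz)
  · exact measurable_const

/-- The exponential maximal inequality, by conditioning on the first step. -/
lemma measure_hits_le {α : Type*} [MeasurableSpace α] {ν : Measure α} [IsProbabilityMeasure ν]
    {φ : α → ℝ} {l c : ℝ} (hφ : Measurable φ) (hl : 0 ≤ l) (hc : 0 ≤ c)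
    (hi : Integrable (fun z => Real.exp (l * φ z)) ν)
    (hle : ∫ z, Real.exp (l * φ z) ∂ν ≤ Real.exp c) (T : ℕ) (x : ℝ) :
    (Measure.pi fun _ : Fin T => ν) {z | Hits φ x z} ≤
      ENNReal.ofReal (Real.exp (T * c - l * x)) := by
  induction T generalizing x with
  | zero =>
    rcases le_or_gt x 0 with hx | hx
    · refine prob_le_one.trans ?_
      rw [← ENNReal.ofReal_one]
      refine ENNReal.ofReal_le_ofReal (Real.one_le_exp ?_)
      simp; nlinarith
    · have : {z : Fin 0 → α | Hits φ x z} = ∅ := by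
        ext z; simp [Hits]; linarith
      rw [this]; simp
  | succ T ih =>
    rcases le_or_gt x 0 with hx | hx
    · refine prob_le_one.trans ?_
      rw [← ENNReal.ofReal_one]
      refine ENNReal.ofReal_le_ofReal (Real.one_le_exp ?_)
      have := mul_nonneg (Nat.cast_nonneg (α := ℝ) (T + 1)) hc
      nlinarith
    · have hmp := measurePreserving_piFinSuccAbove (fun _ : Fin (T + 1) => ν) 0
      have hset : {z : Fin (T + 1) → α | Hits φ x z} ⊆
          (MeasurableEquiv.piFinSuccAbove (fun _ : Fin (T + 1) => α) 0) ⁻¹'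
            {p | Hits φ (x - φ p.1) p.2} := by
        rintro z ⟨t, ht, hz⟩
        rcases t with _ | t
        · simp at hz; linarith
        · refine ⟨t, by omega, ?_⟩
          rw [Fin.sum_univ_succ] at hz
          simp only [Fin.val_zero, Nat.zero_lt_succ, if_true, Fin.val_succ,
            Nat.add_lt_add_iff_right] at hz
          have e : ∀ s : Fin T, (MeasurableEquiv.piFinSuccAbove (fun _ : Fin (T + 1) => α) 0 z).2 s =
            z s.succ := fun s => rfl
          have e' : (MeasurableEquiv.piFinSuccAbove (fun _ : Fin (T + 1) => α) 0 z).1 = z 0 := rfl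
          simp only [e, e']
          linarith
      have hms : MeasurableSet {p : α × (Fin T → α) | Hits φ (x - φ p.1) p.2} :=
        measurableSet_hits hφ (by fun_prop) measurable_snd
      refine (measure_mono hset).trans ?_
      rw [hmp.measure_preimage hms.nullMeasurableSet, Measure.prod_apply hms]
      calc ∫⁻ a, (Measure.pi fun _ : Fin T => ν) (Prod.mk a ⁻¹' {p | Hits φ (x - φ p.1) p.2}) ∂ν
          ≤ ∫⁻ a, ENNReal.ofReal (Real.exp (T * c - l * x) * Real.exp (l * φ a)) ∂ν := by
            refine lintegral_mono fun a => (ih (x - φ a)).trans (le_of_eq ?_)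
            rw [← Real.exp_add]
            congr 2; ring
        _ = ENNReal.ofReal (Real.exp (T * c - l * x) * ∫ a, Real.exp (l * φ a) ∂ν) := by
            rw [← integral_const_mul, ofReal_integral_eq_lintegral_ofReal (hi.const_mul _)
              (Filter.Eventually.of_forall fun a => by positivity)]
        _ ≤ ENNReal.ofReal (Real.exp (T * c - l * x) * Real.exp c) := by gcongr
        _ = _ := by
            rw [← Real.exp_add]
            congr 2; push_cast; ring

/-- A Gaussian random walk with steps of standard deviation `s` exceeds `L` standard deviations of
its final value at some time with probability at most `2 exp (- L² / 2)`. -/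
lemma measure_walk_le {α : Type*} [MeasurableSpace α] {ν : Measure α} [IsProbabilityMeasure ν]
    {φ : α → ℝ} {s : ℝ} (hφ : Measurable φ) (hs : 0 ≤ s)
    (h : ν.map φ = gaussianReal 0 (s ^ 2).toNNReal) (T : ℕ) {L : ℝ} (hL : 0 ≤ L) :
    (Measure.infinitePi fun _ : ℕ => ν)
      {z | ∃ t ≤ T, L * s * Real.sqrt T < |∑ k ∈ Finset.range t, φ (z k)|} ≤
      2 * ENNReal.ofReal (Real.exp (-L ^ 2 / 2)) := by
  set P := Measure.infinitePi fun _ : ℕ => ν with hP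
  have one : ∀ (ψ : α → ℝ), Measurable ψ → ν.map ψ = gaussianReal 0 (s ^ 2).toNNReal →
      P {z | ∃ t ≤ T, L * s * Real.sqrt T < ∑ k ∈ Finset.range t, ψ (z k)} ≤
        ENNReal.ofReal (Real.exp (-L ^ 2 / 2)) := by
    intro ψ hψ hψ'
    rcases Nat.eq_zero_or_pos T with rfl | hT
    · have : {z : ℕ → α | ∃ t ≤ 0, L * s * Real.sqrt (0 : ℕ) <
          ∑ k ∈ Finset.range t, ψ (z k)} = ∅ := by
        ext z; simp
      rw [this]; simp
    rcases hs.eq_or_lt with rfl | hs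
    · -- the walk vanishes almost surely
      have h0 : ∀ᵐ a ∂ν, ψ a = 0 := by
        have : ∀ᵐ y ∂(ν.map ψ), y = 0 := by
          rw [hψ']
          simp [gaussianReal_zero_var, ae_dirac_eq]
        exact ae_of_ae_map hψ.aemeasurable this
      have h1 : ∀ᵐ z ∂P, ∀ k, ψ (z k) = 0 := by
        rw [ae_all_iff]
        intro k
        have := Measure.infinitePi_map_eval (fun _ : ℕ => ν) k
        rw [← this] at h0
        exact ae_of_ae_map (measurable_pi_apply k).aemeasurable h0
      have : P {z | ∃ t ≤ T, L * 0 * Real.sqrt T < ∑ k ∈ Finset.range t, ψ (z k)} = 0 := by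
        refine measure_mono_null ?_ (ae_iff.1 h1)
        rintro z ⟨t, -, ht⟩ hz
        simp [hz] at ht
      rw [this]; exact zero_le
    have hT' : (0 : ℝ) < T := by exact_mod_cast hT
    have hsq := Real.sqrt_pos.2 hT'
    set l := L / (s * Real.sqrt T) with hl
    obtain ⟨hi, hint⟩ := integral_exp_of_map_gaussian hψ hψ' l
    have hb := measure_hits_le (T := T) hψ (by positivity : 0 ≤ l)
      (by positivity : 0 ≤ l ^ 2 * s ^ 2 / 2) hi hint.le (L * s * Real.sqrt T)
    have he : T * (l ^ 2 * s ^ 2 / 2) - l * (L * s * Real.sqrt T) = -L ^ 2 / 2 := by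
      have : Real.sqrt T ^ 2 = T := Real.sq_sqrt hT'.le
      rw [hl]
      field_simp
      rw [this]
      field_simp
      ring
    rw [he] at hb
    refine le_trans ?_ hb
    have hmap : P.map (fun z (k : Fin T) => z k) = Measure.pi fun _ : Fin T => ν :=
      (Measure.map_infinitePi_infinitePi_of_inj (P := fun _ : ℕ => ν)
        (Fin.val_injective (n := T))).trans (Measure.infinitePi_eq_pi _)
    have hms : MeasurableSet {z : Fin T → α | Hits ψ (L * s * Real.sqrt T) z} :=
      measurableSet_hits hψ measurable_const measurable_id
    rw [← hmap, Measure.map_apply (by fun_prop) hms]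
    refine measure_mono ?_
    rintro z ⟨t, ht, hz⟩
    refine ⟨t, ht, hz.le.trans (le_of_eq ?_)⟩
    rw [Fin.sum_univ_eq_sum_range (fun k => if k < t then ψ (z k) else 0) T,
      ← Finset.sum_filter]
    congr 1
    ext k; simp; omega
  have hneg : ν.map (fun a => -φ a) = gaussianReal 0 (s ^ 2).toNNReal := by
    have : (fun a => -φ a) = (fun y : ℝ => -y) ∘ φ := rfl
    rw [this, ← Measure.map_map measurable_neg hφ, h, gaussianReal_map_neg, neg_zero]
  calc P {z | ∃ t ≤ T, L * s * Real.sqrt T < |∑ k ∈ Finset.range t, φ (z k)|}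
      ≤ P ({z | ∃ t ≤ T, L * s * Real.sqrt T < ∑ k ∈ Finset.range t, φ (z k)} ∪
          {z | ∃ t ≤ T, L * s * Real.sqrt T < ∑ k ∈ Finset.range t, -φ (z k)}) := by
        refine measure_mono ?_
        rintro z ⟨t, ht, hz⟩
        rcases lt_abs.1 hz with h | h
        · exact Or.inl ⟨t, ht, h⟩
        · exact Or.inr ⟨t, ht, by rwa [Finset.sum_neg_distrib]⟩
    _ ≤ _ := measure_union_le _ _
    _ ≤ _ := by rw [two_mul]; exact add_le_add (one φ hφ h) (one _ hφ.neg hneg)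

/-- The tail bound for a single Gaussian variable. -/
lemma measure_abs_gaussian_le {α : Type*} [MeasurableSpace α] {ν : Measure α}
    [IsProbabilityMeasure ν] {φ : α → ℝ} {s : ℝ} (hφ : Measurable φ) (hs : 0 ≤ s)
    (h : ν.map φ = gaussianReal 0 (s ^ 2).toNNReal) {L : ℝ} (hL : 0 ≤ L) :
    ν {a | L * s < |φ a|} ≤ 2 * ENNReal.ofReal (Real.exp (-L ^ 2 / 2)) := by
  refine le_trans ?_ (measure_walk_le hφ hs h 1 hL)
  have hm : MeasurableSet {a | L * s < |φ a|} := measurableSet_lt measurable_const hφ.abs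
  have e : ν {a | L * s < |φ a|} = (Measure.infinitePi fun _ : ℕ => ν)
      ((fun z => z 0) ⁻¹' {a | L * s < |φ a|}) := by
    rw [← Measure.map_apply (measurable_pi_apply 0) hm, Measure.infinitePi_map_eval]
  rw [e]
  refine measure_mono fun z hz => ?_
  refine (⟨1, le_rfl, ?_⟩ : ∃ t ≤ 1, L * s * Real.sqrt (1 : ℕ) <
    |∑ k ∈ Finset.range t, φ (z k)|)
  simpa using hz

/-! ### The norm of a Gaussian vector -/

lemma integral_exp_sq_gaussian {a : ℝ} (ha : a < 1 / 2) :
    Integrable (fun x => Real.exp (a * x ^ 2)) (gaussianReal 0 1) ∧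
      ∫ x, Real.exp (a * x ^ 2) ∂(gaussianReal 0 1) = Real.sqrt (1 / (1 - 2 * a)) := by
  have hb : 0 < 1 / 2 - a := by linarith
  have e : ∀ x : ℝ, gaussianPDFReal 0 1 x * Real.exp (a * x ^ 2) =
      (Real.sqrt (2 * Real.pi))⁻¹ * Real.exp (-(1 / 2 - a) * x ^ 2) := by
    intro x
    rw [gaussianPDFReal, NNReal.coe_one, mul_one, mul_assoc, ← Real.exp_add]
    congr 2; ring
  have hi := (integrable_exp_neg_mul_sq hb).const_mul (Real.sqrt (2 * Real.pi))⁻¹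
  constructor
  · rw [gaussianReal_of_var_ne_zero _ one_ne_zero]
    unfold gaussianPDF
    rw [integrable_withDensity_iff_integrable_smul' (by fun_prop)
      (Filter.Eventually.of_forall fun x => ENNReal.ofReal_lt_top)]
    refine hi.congr (Filter.Eventually.of_forall fun x => ?_)
    simp only [smul_eq_mul]
    rw [ENNReal.toReal_ofReal (gaussianPDFReal_nonneg _ _ _), e]
  · rw [integral_gaussianReal_eq_integral_smul one_ne_zero]
    simp only [smul_eq_mul, e]
    rw [integral_const_mul, integral_gaussian, ← Real.sqrt_inv, ← Real.sqrt_mul (by positivity)]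
    congr 1
    have := Real.pi_pos
    have : 1 - 2 * a ≠ 0 := by linarith
    field_simp

lemma integral_exp_norm_sq {a : ℝ} (ha : a < 1 / 2) :
    Integrable (fun x : Patch d => Real.exp (a * ‖x‖ ^ 2)) (stdGaussian (Patch d)) ∧
      ∫ x : Patch d, Real.exp (a * ‖x‖ ^ 2) ∂(stdGaussian (Patch d)) =
        Real.sqrt (1 / (1 - 2 * a)) ^ d := by
  have hm : Measurable fun x : Fin d → ℝ => (WithLp.toLp 2 x : Patch d) := by fun_prop
  have e : ∀ x : Fin d → ℝ, Real.exp (a * ‖(WithLp.toLp 2 x : Patch d)‖ ^ 2) =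
      ∏ i, Real.exp (a * x i ^ 2) := by
    intro x
    rw [← Real.exp_sum, EuclideanSpace.real_norm_sq_eq, Finset.mul_sum]
  obtain ⟨h1, h2⟩ := integral_exp_sq_gaussian ha
  have hc : Continuous fun x : Patch d => Real.exp (a * ‖x‖ ^ 2) := by fun_prop
  rw [← map_pi_eq_stdGaussian]
  constructor
  · rw [integrable_map_measure hc.aestronglyMeasurable hm.aemeasurable]
    refine (Integrable.fintype_prod (f := fun _ x => Real.exp (a * x ^ 2))
      (μ := fun _ : Fin d => gaussianReal 0 1) fun _ => h1).congr
      (Filter.Eventually.of_forall fun x => ?_)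
    exact (e x).symm
  · rw [integral_map hm.aemeasurable hc.aestronglyMeasurable]
    simp_rw [e]
    rw [integral_fintype_prod_eq_prod (f := fun _ x => Real.exp (a * x ^ 2)), h2]
    simp

lemma stdGaussian_norm_sq_lt :
    stdGaussian (Patch d) {x | ‖x‖ ^ 2 < d / 4} ≤ ENNReal.ofReal (Real.exp (-(d : ℝ) / 4)) := by
  obtain ⟨h1, h2⟩ := integral_exp_norm_sq (d := d) (a := -1) (by norm_num)
  refine (measure_le_ofReal_integral (h1.const_mul (Real.exp (d / 4))) (fun x => by positivity)
    (fun x hx => ?_)).trans (ENNReal.ofReal_le_ofReal ?_)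
  · rw [← Real.exp_add]
    apply Real.one_le_exp
    have : ‖x‖ ^ 2 < d / 4 := hx
    linarith
  · rw [integral_const_mul, h2]
    have h3 : Real.sqrt (1 / (1 - 2 * (-1))) ≤ Real.exp (-1 / 2) := by
      rw [Real.sqrt_le_left (by positivity), ← Real.exp_nat_mul]
      have := Real.exp_one_lt_d9
      rw [show ((2 : ℕ) : ℝ) * (-1 / 2) = -1 by norm_num, Real.exp_neg]
      norm_num
      rw [← one_div]
      have h0 := Real.exp_pos 1
      exact one_div_le_one_div_of_le h0 (by linarith)
    calc Real.exp (d / 4) * Real.sqrt (1 / (1 - 2 * (-1))) ^ d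
        ≤ Real.exp (d / 4) * Real.exp (-1 / 2) ^ d := by gcongr
      _ = Real.exp (-(d : ℝ) / 4) := by
        rw [← Real.exp_nat_mul, ← Real.exp_add]; congr 1; ring

lemma stdGaussian_norm_sq_gt :
    stdGaussian (Patch d) {x | 4 * d < ‖x‖ ^ 2} ≤ ENNReal.ofReal (Real.exp (-(d : ℝ) / 4)) := by
  obtain ⟨h1, h2⟩ := integral_exp_norm_sq (d := d) (a := 1 / 4) (by norm_num)
  refine (measure_le_ofReal_integral (h1.const_mul (Real.exp (-d))) (fun x => by positivity)
    (fun x hx => ?_)).trans (ENNReal.ofReal_le_ofReal ?_)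
  · rw [← Real.exp_add]
    apply Real.one_le_exp
    have : 4 * d < ‖x‖ ^ 2 := hx
    linarith
  · rw [integral_const_mul, h2]
    have h3 : Real.sqrt (1 / (1 - 2 * (1 / 4))) ≤ Real.exp (1 / 2) := by
      rw [Real.sqrt_le_left (by positivity), ← Real.exp_nat_mul]
      rw [show ((2 : ℕ) : ℝ) * (1 / 2) = 1 by norm_num]
      norm_num
      linarith [Real.add_one_le_exp (1 : ℝ)]
    calc Real.exp (-d) * Real.sqrt (1 / (1 - 2 * (1 / 4))) ^ d
        ≤ Real.exp (-d) * Real.exp (1 / 2) ^ d := by gcongr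
      _ = Real.exp (-(d : ℝ) / 2) := by
        rw [← Real.exp_nat_mul, ← Real.exp_add]; congr 1; ring
      _ ≤ _ := Real.exp_le_exp.2 (by linarith [Nat.cast_nonneg (α := ℝ) d])

/-! ### The number of filters with a useful initial correlation -/

/-- The probability that a standard Gaussian variable is at least `1 / 4`. -/
def quarterProb : ℝ := (gaussianReal 0 1).real (Set.Ici (1 / 4))

lemma quarterProb_pos : 0 < quarterProb := by
  have h : gaussianReal 0 1 (Set.Ici (1 / 4)) ≠ 0 := by
    intro h0
    have := gaussianReal_absolutelyContinuous' 0 one_ne_zero h0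
    simp at this
  exact ENNReal.toReal_pos h (measure_ne_top _ _)

lemma quarterProb_le : quarterProb ≤ 1 := measureReal_le_one

lemma isoGaussian_quarter {s : ℝ} (hs : 0 < s) {x : Patch d} (hx : x ≠ 0) :
    (isoGaussian d s).real {w | s * ‖x‖ / 4 ≤ ⟪w, x⟫} = quarterProb := by
  have hx' := norm_pos_iff.2 hx
  have e : {w : Patch d | s * ‖x‖ / 4 ≤ ⟪w, x⟫} =
      (fun w : Patch d => ⟪w, (s * ‖x‖)⁻¹ • x⟫) ⁻¹' Set.Ici (1 / 4) := by
    ext w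
    simp only [Set.mem_ofPred_eq, Set.mem_preimage, Set.mem_Ici, inner_smul_right]
    rw [inv_mul_eq_div, le_div_iff₀ (by positivity)]
    constructor <;> intro h <;> linarith
  rw [quarterProb, measureReal_def, e, ← Measure.map_apply (by fun_prop) measurableSet_Ici,
    isoGaussian_map_inner, norm_smul, measureReal_def]
  congr 3
  rw [norm_inv, norm_mul, norm_norm, Real.norm_of_nonneg hs.le]
  have : s * ((s * ‖x‖)⁻¹ * ‖x‖) = 1 := by field_simp
  rw [this]; simp

lemma measure_few_good_le {m : ℕ} {s : ℝ} (hs : 0 < s) {x : Patch d} (hx : x ≠ 0) (j : Bool) :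
    (Measure.pi fun _ : Bool × Fin m => isoGaussian d s)
      {W | ((Finset.univ.filter fun r => s * ‖x‖ / 4 ≤ ⟪W (j, r), x⟫).card : ℝ) <
        quarterProb / 2 * m} ≤ ENNReal.ofReal (Real.exp (-(quarterProb * m / 10))) := by
  classical
  set p := quarterProb with hp
  have hp0 := quarterProb_pos
  set S : Set (Patch d) := {w | s * ‖x‖ / 4 ≤ ⟪w, x⟫} with hS
  have hSm : MeasurableSet S := measurableSet_le measurable_const (by fun_prop)
  set a := 1 - Real.exp (-1) with ha
  have ha0 : 0.6 ≤ a := by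
    have h : Real.exp (-1) ≤ 0.4 := by linarith [Real.exp_neg_one_lt_d9]
    norm_num at h ⊢; linarith
  let f : Bool × Fin m → Patch d → ℝ := fun q w =>
    if q.1 = j then 1 - a * S.indicator (fun _ => (1 : ℝ)) w else 1
  have hf : ∀ q, Integrable (f q) (isoGaussian d s) := by
    intro q
    by_cases h : q.1 = j
    · simp only [f, h, if_true]
      exact (integrable_const _).sub (((integrable_const (1 : ℝ)).indicator hSm).const_mul a)
    · simp only [f, h, if_false]
      exact integrable_const _
  have hfint : ∀ q, ∫ w, f q w ∂(isoGaussian d s) = if q.1 = j then 1 - a * p else 1 := by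
    intro q
    by_cases h : q.1 = j
    · simp only [f, h, if_true]
      rw [integral_sub (integrable_const _)
        (((integrable_const (1 : ℝ)).indicator hSm).const_mul a), integral_const_mul,
        integral_indicator_const _ hSm, isoGaussian_quarter hs hx]
      simp [hp]
    · simp [f, h]
  have hprod : ∀ W : Bool × Fin m → Patch d, ∏ q, f q (W q) =
      Real.exp (-((Finset.univ.filter fun r => s * ‖x‖ / 4 ≤ ⟪W (j, r), x⟫).card : ℝ)) := by
    intro W
    rw [Fintype.prod_prod_type]
    have h1 : ∀ b, ∏ r, f (b, r) (W (b, r)) = if b = j then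
        Real.exp (-((Finset.univ.filter fun r => s * ‖x‖ / 4 ≤ ⟪W (j, r), x⟫).card : ℝ)) else 1 := by
      intro b
      by_cases hb : b = j
      · subst hb
        simp only [f, if_true]
        have h2 : ∀ r, 1 - a * S.indicator (fun _ => (1 : ℝ)) (W (b, r)) =
            if s * ‖x‖ / 4 ≤ ⟪W (b, r), x⟫ then Real.exp (-1) else 1 := by
          intro r
          by_cases h : s * ‖x‖ / 4 ≤ ⟪W (b, r), x⟫
          · rw [if_pos h, Set.indicator_of_mem (show W (b, r) ∈ S from h)]; simp [ha]
          · rw [if_neg h, Set.indicator_of_notMem (show W (b, r) ∉ S from h)]; simp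
        simp_rw [h2]
        rw [Finset.prod_ite, Finset.prod_const, Finset.prod_const_one, mul_one, ← Real.exp_nat_mul]
        congr 1; ring
      · simp [f, hb]
    simp_rw [h1]
    simp
  have hI := Integrable.fintype_prod (f := f) (μ := fun _ => isoGaussian d s) hf
  refine (measure_le_ofReal_integral (hI.const_mul (Real.exp (p / 2 * m))) (fun W => ?_)
    (fun W hW => ?_)).trans (ENNReal.ofReal_le_ofReal ?_)
  · simp only [hprod]; positivity
  · simp only [hprod]
    rw [← Real.exp_add]
    apply Real.one_le_exp
    have : ((Finset.univ.filter fun r => s * ‖x‖ / 4 ≤ ⟪W (j, r), x⟫).card : ℝ) < p / 2 * m := hW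
    linarith
  · rw [integral_const_mul, integral_fintype_prod_eq_prod (f := f)]
    simp_rw [hfint]
    rw [Fintype.prod_prod_type]
    rw [Finset.prod_eq_single j (fun b _ hb => by simp [hb]) (by simp)]
    simp only [if_true, Finset.prod_const, Finset.card_univ, Fintype.card_fin]
    have h1 : 1 - a * p ≤ Real.exp (-(a * p)) := by linarith [Real.add_one_le_exp (-(a * p))]
    have h0 : 0 ≤ 1 - a * p := by
      have := quarterProb_le
      have : a ≤ 1 := by linarith [Real.exp_pos (-1)]
      nlinarith
    calc Real.exp (p / 2 * m) * (1 - a * p) ^ m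
        ≤ Real.exp (p / 2 * m) * Real.exp (-(a * p)) ^ m := by gcongr
      _ = Real.exp (-((a - 1 / 2) * (p * m))) := by
          rw [← Real.exp_nat_mul, ← Real.exp_add]; congr 1; ring
      _ ≤ Real.exp (-(p * m / 10)) := by
          apply Real.exp_le_exp.2
          have : 0 ≤ p * m := by positivity
          norm_num at ha0
          nlinarith

end

end NoisyCNN

namespace NoisyCNN

/-! ### Typical runs have high probability -/

section
variable {n m d : ℕ} {v : Patch d} {s σ₀ : ℝ} {ν : Measure (Weights m d)} [IsProbabilityMeasure ν]

lemma norm_projH_le {v : Patch d} (hv : v ≠ 0) (x : Patch d) : ‖projH v x‖ ≤ ‖x‖ := by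
  rw [← sq_le_sq₀ (norm_nonneg _) (norm_nonneg _), norm_projH_sq hv]
  linarith [sq_nonneg (⟪v, x⟫ / ‖v‖)]

instance : IsProbabilityMeasure (trainLaw n v s σ₀ ν) := by
  unfold trainLaw; infer_instance

lemma trainLaw_data (S : Set (Fin n → DataPoint d)) :
    trainLaw n v s σ₀ ν {ω | ω.1 ∈ S} = (Measure.pi fun _ : Fin n => dataLaw v s) S := by
  have : {ω : Outcome n m d | ω.1 ∈ S} = S ×ˢ Set.univ := by ext ω; simp
  rw [this, trainLaw, Measure.prod_prod, measure_univ, mul_one]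

lemma trainLaw_init_le {S : Set ((Fin n → DataPoint d) × Weights m d)} (hS : MeasurableSet S)
    {c : ENNReal}
    (h : ∀ D, (Measure.pi fun _ : Bool × Fin m => isoGaussian d σ₀) {W | (D, W) ∈ S} ≤ c) :
    trainLaw n v s σ₀ ν {ω | (ω.1, ω.2.1) ∈ S} ≤ c := by
  have hm : MeasurableSet {ω : Outcome n m d | (ω.1, ω.2.1) ∈ S} :=
    hS.preimage (by fun_prop)
  rw [trainLaw, Measure.prod_apply hm]
  refine (lintegral_mono (g := fun _ => c) fun D => ?_).trans (by simp)
  have : Prod.mk D ⁻¹' {ω : Outcome n m d | (ω.1, ω.2.1) ∈ S} =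
      {W | (D, W) ∈ S} ×ˢ Set.univ := by ext ω; simp
  rw [this, Measure.prod_prod, measure_univ, mul_one]
  exact h D

lemma trainLaw_noise_le {S : Set ((Fin n → DataPoint d) × (ℕ → Weights m d))}
    (hS : MeasurableSet S) {c : ENNReal}
    (h : ∀ D, (Measure.infinitePi fun _ : ℕ => ν) {z | (D, z) ∈ S} ≤ c) :
    trainLaw n v s σ₀ ν {ω | (ω.1, ω.2.2) ∈ S} ≤ c := by
  have hm : MeasurableSet {ω : Outcome n m d | (ω.1, ω.2.2) ∈ S} :=
    hS.preimage (by fun_prop)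
  rw [trainLaw, Measure.prod_apply hm]
  refine (lintegral_mono (g := fun _ => c) fun D => ?_).trans (by simp)
  have : Prod.mk D ⁻¹' {ω : Outcome n m d | (ω.1, ω.2.2) ∈ S} =
      Set.univ ×ˢ {z | (D, z) ∈ S} := by ext ω; simp
  rw [this, Measure.prod_prod, measure_univ, one_mul]
  exact h D

/-- The tail probability of a Gaussian variable at `L` standard deviations. -/
def tail (L : ℝ) : ENNReal := 2 * ENNReal.ofReal (Real.exp (-L ^ 2 / 2))

lemma trainLaw_noisePatch {S : Set (Patch d)} (hS : MeasurableSet S) (i : Fin n) :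
    trainLaw n v s σ₀ ν {ω | (ω.1 i).1.2 ∈ S} = stdGaussian (Patch d) {x | s • projH v x ∈ S} := by
  have hc : Continuous fun x => s • projH v x := (continuous_projH v).const_smul s
  have h := trainLaw_data (v := v) (s := s) (σ₀ := σ₀) (ν := ν)
    {D : Fin n → DataPoint d | (D i).1.2 ∈ S}
  have e := (measurePreserving_eval (fun _ : Fin n => dataLaw v s) i).measure_preimage
    (s := (fun p : DataPoint d => p.1.2) ⁻¹' S) (hS.preimage (by fun_prop)).nullMeasurableSet
  rw [← Measure.map_apply (by fun_prop) hS, dataLaw_map_noise, dataNoise,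
    Measure.map_apply hc.measurable hS] at e
  exact h.trans e

lemma trainLaw_norm_lt (hv : v ≠ 0) {L : ℝ} (hL : 0 ≤ L) (i : Fin n) :
    trainLaw n v s σ₀ ν {ω | ‖(ω.1 i).1.2‖ ^ 2 < s ^ 2 * (d / 4 - L ^ 2)} ≤
      ENNReal.ofReal (Real.exp (-(d : ℝ) / 4)) + tail L := by
  have hS : MeasurableSet {x : Patch d | ‖x‖ ^ 2 < s ^ 2 * (d / 4 - L ^ 2)} :=
    measurableSet_lt (by fun_prop) measurable_const
  refine (trainLaw_noisePatch hS i).trans_le ?_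
  have hv' : 0 < ‖v‖ := norm_pos_iff.2 hv
  refine le_trans (measure_mono (t := {x | ‖x‖ ^ 2 < d / 4} ∪ {x | L * ‖v‖ < |⟪x, v⟫|})
    fun x hx => ?_) ((measure_union_le _ _).trans (add_le_add stdGaussian_norm_sq_lt
      (measure_abs_gaussian_le (by fun_prop) (norm_nonneg v) (stdGaussian_map_inner v) hL)))
  have hx' : ‖s • projH v x‖ ^ 2 < s ^ 2 * (d / 4 - L ^ 2) := hx
  rw [norm_smul, mul_pow, Real.norm_eq_abs, sq_abs, norm_projH_sq hv] at hx'
  by_contra! hcon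
  have h1 : (d : ℝ) / 4 ≤ ‖x‖ ^ 2 := not_lt.1 fun h => hcon (Or.inl h)
  have h2 : |⟪x, v⟫| ≤ L * ‖v‖ := not_lt.1 fun h => hcon (Or.inr h)
  have h3 : (⟪v, x⟫ / ‖v‖) ^ 2 ≤ L ^ 2 := by
    rw [sq_le_sq, abs_of_nonneg hL, abs_div, abs_norm, div_le_iff₀ hv', real_inner_comm]
    exact h2
  have := mul_le_mul_of_nonneg_left (sub_le_sub h1 h3) (sq_nonneg s)
  linarith

lemma trainLaw_norm_gt (hv : v ≠ 0) (i : Fin n) :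
    trainLaw n v s σ₀ ν {ω | 4 * (s ^ 2 * d) < ‖(ω.1 i).1.2‖ ^ 2} ≤
      ENNReal.ofReal (Real.exp (-(d : ℝ) / 4)) := by
  have hS : MeasurableSet {x : Patch d | 4 * (s ^ 2 * d) < ‖x‖ ^ 2} :=
    measurableSet_lt measurable_const (by fun_prop)
  refine (trainLaw_noisePatch hS i).trans_le ?_
  refine (measure_mono fun x hx => ?_).trans stdGaussian_norm_sq_gt
  have hx' : 4 * (s ^ 2 * d) < ‖s • projH v x‖ ^ 2 := hx
  rw [norm_smul, mul_pow, Real.norm_eq_abs, sq_abs] at hx'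
  have h1 : ‖projH v x‖ ^ 2 ≤ ‖x‖ ^ 2 := by
    have := norm_projH_le hv x
    gcongr
  show 4 * (d : ℝ) < ‖x‖ ^ 2
  by_contra! h
  have := mul_le_mul_of_nonneg_left (h1.trans h) (sq_nonneg s)
  linarith

/-- Noise patches of different samples are almost orthogonal. -/
lemma trainLaw_gram (hv : v ≠ 0) (hs : 0 ≤ s) {L : ℝ} (hL : 0 ≤ L) {i k : Fin n} (hik : i ≠ k) :
    trainLaw n v s σ₀ ν
      {ω | L * (s * ‖(ω.1 k).1.2‖) < |⟪(ω.1 k).1.2, (ω.1 i).1.2⟫|} ≤ tail L := by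
  refine (trainLaw_data (v := v) (s := s) (σ₀ := σ₀) (ν := ν) {D : Fin n → DataPoint d |
    L * (s * ‖(D k).1.2‖) < |⟪(D k).1.2, (D i).1.2⟫|}).trans_le ?_
  have hS : MeasurableSet {p : DataPoint d × DataPoint d |
      L * (s * ‖p.1.1.2‖) < |⟪p.1.1.2, p.2.1.2⟫|} :=
    measurableSet_lt (by fun_prop) (by fun_prop)
  have e := Measure.infinitePi_map_eval_prod (P := fun _ : Fin n => dataLaw v s) hik.symm
  rw [Measure.infinitePi_eq_pi] at e
  have e' : (Measure.pi fun _ : Fin n => dataLaw v s) {D : Fin n → DataPoint d |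
      L * (s * ‖(D k).1.2‖) < |⟪(D k).1.2, (D i).1.2⟫|} = ((dataLaw v s).prod (dataLaw v s))
      {p | L * (s * ‖p.1.1.2‖) < |⟪p.1.1.2, p.2.1.2⟫|} := by
    rw [← e, Measure.map_apply (by fun_prop) hS]
    rfl
  rw [e', Measure.prod_apply hS]
  refine (lintegral_mono (g := fun _ => tail L) fun p => ?_).trans (by simp)
  set y := p.1.2 with hy
  have hS' : MeasurableSet {x : Patch d | L * (s * ‖y‖) < |⟪y, x⟫|} :=
    measurableSet_lt measurable_const (by fun_prop)
  have hc : Continuous fun x => s • projH v x := (continuous_projH v).const_smul s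
  have e2 : dataLaw v s (Prod.mk p ⁻¹' {p : DataPoint d × DataPoint d |
      L * (s * ‖p.1.1.2‖) < |⟪p.1.1.2, p.2.1.2⟫|}) =
      stdGaussian (Patch d) ((fun x => s • projH v x) ⁻¹' {x | L * (s * ‖y‖) < |⟪y, x⟫|}) := by
    rw [← Measure.map_apply hc.measurable hS', ← dataNoise, ← dataLaw_map_noise,
      Measure.map_apply (by fun_prop) hS']
    rfl
  rw [e2]
  refine (measure_mono fun x hx => ?_).trans (measure_abs_gaussian_le
    (ν := stdGaussian (Patch d)) (φ := fun x => ⟪x, s • projH v y⟫) (by fun_prop)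
    (norm_nonneg _) (stdGaussian_map_inner _) hL)
  have hx' : L * (s * ‖y‖) < |⟪y, s • projH v x⟫| := hx
  show L * ‖s • projH v y‖ < |⟪x, s • projH v y⟫|
  rw [inner_smul_right, real_inner_comm, inner_projH_symm] at hx'
  rw [inner_smul_right, norm_smul, Real.norm_of_nonneg hs]
  refine lt_of_le_of_lt ?_ hx'
  have := norm_projH_le hv y
  gcongr

lemma pi_isoGaussian_tail (hσ : 0 ≤ σ₀) {L : ℝ} (hL : 0 ≤ L) (p : Bool × Fin m) (x : Patch d) :
    (Measure.pi fun _ : Bool × Fin m => isoGaussian d σ₀)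
      {W | L * (σ₀ * ‖x‖) < |⟪W p, x⟫|} ≤ tail L := by
  have hS : MeasurableSet {w : Patch d | L * (σ₀ * ‖x‖) < |⟪w, x⟫|} :=
    measurableSet_lt measurable_const (by fun_prop)
  have e := (measurePreserving_eval (fun _ : Bool × Fin m => isoGaussian d σ₀) p).measure_preimage
    hS.nullMeasurableSet
  refine le_trans (le_of_eq e) ?_
  exact measure_abs_gaussian_le (by fun_prop) (by positivity) (isoGaussian_map_inner σ₀ x) hL

lemma trainLaw_init_tail (hσ : 0 ≤ σ₀) {L : ℝ} (hL : 0 ≤ L) (p : Bool × Fin m)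
    {x : (Fin n → DataPoint d) → Patch d} (hx : Measurable x) :
    trainLaw n v s σ₀ ν {ω | L * (σ₀ * ‖x ω.1‖) < |⟪ω.2.1 p, x ω.1⟫|} ≤ tail L :=
  trainLaw_init_le (S := {ω | L * (σ₀ * ‖x ω.1‖) < |⟪ω.2 p, x ω.1⟫|})
    (measurableSet_lt (by fun_prop) (by fun_prop)) fun D => pi_isoGaussian_tail hσ hL p (x D)

lemma trainLaw_few_good (hσ : 0 < σ₀) (i : Fin n) (j : Bool) :
    trainLaw n v s σ₀ ν {ω | (ω.1 i).1.2 ≠ 0 ∧ ((Finset.univ.filter fun r =>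
        σ₀ * ‖(ω.1 i).1.2‖ / 4 ≤ ⟪ω.2.1 (j, r), (ω.1 i).1.2⟫).card : ℝ) < quarterProb / 2 * m} ≤
      ENNReal.ofReal (Real.exp (-(quarterProb * m / 10))) := by
  have hS : MeasurableSet {ω : (Fin n → DataPoint d) × Weights m d | (ω.1 i).1.2 ≠ 0 ∧
      ((Finset.univ.filter fun r => σ₀ * ‖(ω.1 i).1.2‖ / 4 ≤
        ⟪ω.2 (j, r), (ω.1 i).1.2⟫).card : ℝ) < quarterProb / 2 * m} := by
    have h0 : MeasurableSet {ω : (Fin n → DataPoint d) × Weights m d | (ω.1 i).1.2 = 0} :=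
      measurableSet_eq_fun (by fun_prop) measurable_const
    have hr : ∀ r, MeasurableSet {ω : (Fin n → DataPoint d) × Weights m d |
        σ₀ * ‖(ω.1 i).1.2‖ / 4 ≤ ⟪ω.2 (j, r), (ω.1 i).1.2⟫} := fun r =>
      measurableSet_le (by fun_prop) (by fun_prop)
    have hc : Measurable fun ω : (Fin n → DataPoint d) × Weights m d =>
        ((Finset.univ.filter fun r => σ₀ * ‖(ω.1 i).1.2‖ / 4 ≤
          ⟪ω.2 (j, r), (ω.1 i).1.2⟫).card : ℝ) := by
      simp_rw [Finset.card_filter]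
      push_cast
      exact Finset.measurable_sum _ fun r _ =>
        Measurable.ite (hr r) measurable_const measurable_const
    exact h0.compl.inter (measurableSet_lt hc measurable_const)
  refine trainLaw_init_le hS fun D => ?_
  by_cases h0 : (D i).1.2 = 0
  · simp [h0]
  · refine (measure_mono fun W hW => ?_).trans (measure_few_good_le hσ h0 j)
    exact hW.2

lemma trainLaw_walk {σz : ℝ} (hσ : 0 ≤ σz) {p : Bool × Fin m}
    (hν : ν.map (fun z => z p) = isoGaussian d σz) (T : ℕ) {L : ℝ} (hL : 0 ≤ L)
    {x : (Fin n → DataPoint d) → Patch d} (hx : Measurable x) :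
    trainLaw n v s σ₀ ν {ω | ∃ t ≤ T, L * (σz * ‖x ω.1‖) * Real.sqrt T <
      |∑ k ∈ Finset.range t, ⟪ω.2.2 k p, x ω.1⟫|} ≤ tail L := by
  refine trainLaw_noise_le (S := {ω | ∃ t ≤ T, L * (σz * ‖x ω.1‖) * Real.sqrt T <
      |∑ k ∈ Finset.range t, ⟪ω.2 k p, x ω.1⟫|}) ?_ fun D => ?_
  · have : {ω : (Fin n → DataPoint d) × (ℕ → Weights m d) |
        ∃ t ≤ T, L * (σz * ‖x ω.1‖) * Real.sqrt T <
          |∑ k ∈ Finset.range t, ⟪ω.2 k p, x ω.1⟫|} = ⋃ t ∈ Finset.range (T + 1),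
        {ω | L * (σz * ‖x ω.1‖) * Real.sqrt T <
          |∑ k ∈ Finset.range t, ⟪ω.2 k p, x ω.1⟫|} := by
      ext ω; simp
    rw [this]
    refine Finset.measurableSet_biUnion _ fun t _ => measurableSet_lt (by fun_prop) ?_
    have : ∀ k, Measurable fun ω : (Fin n → DataPoint d) × (ℕ → Weights m d) => ω.2 k p := by
      intro k
      exact (measurable_pi_apply p).comp ((measurable_pi_apply k).comp measurable_snd)
    exact (Finset.measurable_sum _ fun k _ => (this k).inner (by fun_prop)).abs
  · refine measure_walk_le (ν := ν) (s := σz * ‖x D‖)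
      (φ := fun z : Weights m d => ⟪z p, x D⟫) (by fun_prop)
      (by positivity) ?_ T hL
    rw [← isoGaussian_map_inner, ← hν, Measure.map_map (by fun_prop) (by fun_prop)]
    rfl

/-- The union bound over all the exceptional events. -/
theorem trainLaw_not_typical_le {η σz L : ℝ} {N : Scales} (hv : v ≠ 0) (hs : 0 ≤ s)
    (hσ₀ : 0 < σ₀) (hη : 0 ≤ η) (hσz : 0 ≤ σz) (hL : 0 ≤ L)
    (hν : ∀ p, ν.map (fun z => z p) = isoGaussian d σz)
    (hslo : N.slo ≤ s ^ 2 * (d / 4 - L ^ 2)) (hslo0 : 0 < N.slo) (hshi : 4 * (s ^ 2 * d) ≤ N.shi)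
    (hR : L * (s * Real.sqrt N.shi) ≤ N.R)
    (hB : L * (σ₀ * Real.sqrt N.shi) ≤ N.B)
    (hB' : η * (L * (σz * Real.sqrt N.shi) * Real.sqrt N.T) ≤ N.B)
    (hx₀ : 3 * N.x₀ ≤ σ₀ * Real.sqrt N.slo / 4)
    (hx₀' : η * (L * (σz * Real.sqrt N.shi) * Real.sqrt (N.t₁ + N.t₂ : ℕ)) ≤ N.x₀)
    (hA : L * (σ₀ * ‖v‖) ≤ N.A₀ / 2)
    (hA' : η * (L * (σz * ‖v‖) * Real.sqrt N.T) ≤ N.A₀ / 2)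
    (hp : N.p₁ = quarterProb / 2) :
    trainLaw n v s σ₀ ν {ω | ¬ Typical η v N ω.1 ω.2.1 ω.2.2} ≤
      n * (2 * ENNReal.ofReal (Real.exp (-(d : ℝ) / 4)) + tail L) + n * n * tail L +
      3 * (2 * m * n * tail L) + 2 * (2 * m * tail L) +
      2 * n * ENNReal.ofReal (Real.exp (-(quarterProb * m / 10))) := by
  set P := trainLaw n v s σ₀ ν with hP
  -- the exceptional events
  let E0 : Set (Outcome n m d) :=
    {ω | ¬ ∀ i, (ω.1 i).1.1 = sgn (ω.1 i).2 • v ∧ ⟪v, (ω.1 i).1.2⟫ = 0}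
  let E1 : Fin n → Set (Outcome n m d) := fun i =>
    {ω | ‖(ω.1 i).1.2‖ ^ 2 < s ^ 2 * (d / 4 - L ^ 2)}
  let E2 : Fin n → Set (Outcome n m d) := fun i => {ω | 4 * (s ^ 2 * d) < ‖(ω.1 i).1.2‖ ^ 2}
  let E3 : Fin n × Fin n → Set (Outcome n m d) := fun a =>
    {ω | a.1 ≠ a.2 ∧ L * (s * ‖(ω.1 a.2).1.2‖) < |⟪(ω.1 a.2).1.2, (ω.1 a.1).1.2⟫|}
  let E4 : (Bool × Fin m) × Fin n → Set (Outcome n m d) := fun a =>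
    {ω | L * (σ₀ * ‖(ω.1 a.2).1.2‖) < |⟪ω.2.1 a.1, (ω.1 a.2).1.2⟫|}
  let E5 : Bool × Fin m → Set (Outcome n m d) := fun p => {ω | L * (σ₀ * ‖v‖) < |⟪ω.2.1 p, v⟫|}
  let E6 : Bool × Fin n → Set (Outcome n m d) := fun a =>
    {ω | (ω.1 a.2).1.2 ≠ 0 ∧ ((Finset.univ.filter fun r =>
      σ₀ * ‖(ω.1 a.2).1.2‖ / 4 ≤ ⟪ω.2.1 (a.1, r), (ω.1 a.2).1.2⟫).card : ℝ) <
        quarterProb / 2 * m}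
  let E7 : ℕ → (Bool × Fin m) × Fin n → Set (Outcome n m d) := fun T a =>
    {ω | ∃ t ≤ T, L * (σz * ‖(ω.1 a.2).1.2‖) * Real.sqrt T <
      |∑ k ∈ Finset.range t, ⟪ω.2.2 k a.1, (ω.1 a.2).1.2⟫|}
  let E8 : Bool × Fin m → Set (Outcome n m d) := fun p =>
    {ω | ∃ t ≤ N.T, L * (σz * ‖v‖) * Real.sqrt N.T < |∑ k ∈ Finset.range t, ⟪ω.2.2 k p, v⟫|}
  have hsub : {ω : Outcome n m d | ¬ Typical η v N ω.1 ω.2.1 ω.2.2} ⊆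
      E0 ∪ ((⋃ i, E1 i) ∪ ((⋃ i, E2 i) ∪ ((⋃ a, E3 a) ∪ ((⋃ a, E4 a) ∪ ((⋃ p, E5 p) ∪
        ((⋃ a, E6 a) ∪ ((⋃ a, E7 N.T a) ∪ ((⋃ a, E7 (N.t₁ + N.t₂) a) ∪ (⋃ p, E8 p))))))))) := by
    intro ω hω
    by_contra hcon
    simp only [Set.mem_union, Set.mem_iUnion, not_or, not_exists] at hcon
    obtain ⟨h0, h1, h2, h3, h4, h5, h6, h7, h7', h8⟩ := hcon
    simp only [E0, Set.mem_ofPred_eq, not_not] at h0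
    simp only [E1, E2, E3, E4, E5, E6, E7, E8, Set.mem_ofPred_eq, not_lt, not_and, not_exists]
      at h1 h2 h3 h4 h5 h6 h7 h7' h8
    have lo : ∀ i, N.slo ≤ ‖(ω.1 i).1.2‖ ^ 2 := fun i => hslo.trans (h1 i)
    have hi : ∀ i, ‖(ω.1 i).1.2‖ ^ 2 ≤ N.shi := fun i => (h2 i).trans hshi
    have hi' : ∀ i, ‖(ω.1 i).1.2‖ ≤ Real.sqrt N.shi := fun i => Real.le_sqrt_of_sq_le (hi i)
    have lo' : ∀ i, Real.sqrt N.slo ≤ ‖(ω.1 i).1.2‖ := fun i =>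
      Real.sqrt_le_iff.2 ⟨norm_nonneg _, lo i⟩
    refine hω ⟨fun i => (h0 i).1, fun i => (h0 i).2, lo, hi, fun i k hik => ?_, fun p i => ?_,
      fun i j => ?_, fun p => (h5 p).trans hA, fun t ht p i => ?_, fun t ht ht' p i => ?_,
      fun t ht p => ?_⟩
    · refine (h3 (i, k) hik).trans (le_trans ?_ hR)
      have := hi' k
      gcongr
    · refine (h4 (p, i)).trans (le_trans ?_ hB)
      have := hi' i
      gcongr
    · have hne : (ω.1 i).1.2 ≠ 0 := by
        intro h
        have := lo i
        rw [h] at this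
        simp at this
        linarith
      rw [hp]
      refine (h6 (j, i) hne).trans ?_
      norm_cast
      refine Finset.card_le_card fun r hr => ?_
      simp only [Finset.mem_filter, Finset.mem_univ, true_and] at hr ⊢
      refine hx₀.trans (le_trans ?_ hr)
      have := lo' i
      gcongr
    · refine le_trans ?_ hB'
      refine mul_le_mul_of_nonneg_left ((h7 (p, i) t ht).trans ?_) hη
      have := hi' i
      gcongr
    · refine le_trans ?_ hx₀'
      refine mul_le_mul_of_nonneg_left ((h7' (p, i) t ht').trans ?_) hη
      have := hi' i
      gcongr
    · exact (mul_le_mul_of_nonneg_left (h8 p t ht) hη).trans hA'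
  have union_le : ∀ {ι : Type} [Fintype ι] (E : ι → Set (Outcome n m d)) (c : ENNReal),
      (∀ a, P (E a) ≤ c) → P (⋃ a, E a) ≤ Fintype.card ι * c := by
    intro ι _ E c hE
    calc P (⋃ a, E a) ≤ ∑ a, P (E a) := measure_iUnion_fintype_le _ _
      _ ≤ ∑ _a : ι, c := Finset.sum_le_sum fun a _ => hE a
      _ = _ := by simp
  have b0 : P E0 = 0 := by
    have h : ∀ᵐ D ∂(Measure.pi fun _ : Fin n => dataLaw v s),
        ∀ i, (D i).1.1 = sgn (D i).2 • v ∧ ⟪v, (D i).1.2⟫ = 0 := by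
      rw [ae_all_iff]
      intro i
      exact (measurePreserving_eval (fun _ : Fin n => dataLaw v s) i).quasiMeasurePreserving.ae
        (dataLaw_ae hv s)
    exact (trainLaw_data _).trans (ae_iff.1 h)
  have b1 := union_le E1 _ fun i => trainLaw_norm_lt hv hL i
  have b2 := union_le E2 _ fun i => trainLaw_norm_gt hv i
  have b3 := union_le E3 (tail L) fun a => by
    by_cases h : a.1 = a.2
    · have : E3 a = ∅ := by ext ω; simp [E3, h]
      rw [this]; simp
    · exact (measure_mono fun ω hω => hω.2).trans (trainLaw_gram hv hs hL h)
  have b4 := union_le E4 (tail L) fun a =>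
    trainLaw_init_tail hσ₀.le hL a.1 (x := fun D => (D a.2).1.2) (by fun_prop)
  have b5 := union_le E5 (tail L) fun p =>
    trainLaw_init_tail hσ₀.le hL p (x := fun _ => v) (by fun_prop)
  have b6 := union_le E6 _ fun a => trainLaw_few_good hσ₀ a.2 a.1
  have b7 : ∀ T, P (⋃ a, E7 T a) ≤ _ := fun T => union_le (E7 T) (tail L) fun a =>
    trainLaw_walk hσz (hν a.1) T hL (x := fun D => (D a.2).1.2) (by fun_prop)
  have b8 := union_le E8 (tail L) fun p =>
    trainLaw_walk hσz (hν p) N.T hL (x := fun _ => v) (by fun_prop)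
  simp only [Fintype.card_prod, Fintype.card_bool, Fintype.card_fin, Nat.cast_mul,
    Nat.cast_ofNat] at b1 b2 b3 b4 b5 b6 b7 b8
  have hall := (measure_mono hsub).trans ((measure_union_le _ _).trans (add_le_add b0.le
    ((measure_union_le _ _).trans (add_le_add b1
    ((measure_union_le _ _).trans (add_le_add b2
    ((measure_union_le _ _).trans (add_le_add b3
    ((measure_union_le _ _).trans (add_le_add b4
    ((measure_union_le _ _).trans (add_le_add b5
    ((measure_union_le _ _).trans (add_le_add b6
    ((measure_union_le _ _).trans (add_le_add (b7 N.T)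
    ((measure_union_le _ _).trans (add_le_add (b7 (N.t₁ + N.t₂)) b8))))))))))))))))))
  refine hall.trans (le_of_eq ?_)
  ring

end

end NoisyCNN

namespace NoisyCNN

/-! ### Consequences of the regime -/

namespace Params

/-- The logarithmic factor `1 + log d`. -/
def logd (P : Params) : ℝ := 1 + Real.log P.d

/-- The inequalities of the noise-memorization regime in the form in which they are used, with `Λ`
the polylogarithmic factor. -/
structure Regime (P : Params) (a : ℝ) (b : ℕ) (C Λ : ℝ) : Prop where
  d_pos : 0 < P.d
  n_pos : 0 < P.n
  m_pos : 0 < P.m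
  X_pos : 0 < P.normXi
  V_pos : 0 < ‖P.v‖
  σξ_pos : 0 < P.σξ
  σ₀_pos : 0 < P.σ₀
  η_pos : 0 < P.η
  ε_pos : 0 < P.ε
  κ_pos : 0 < P.κ
  logd_ge : 1 ≤ P.logd
  dim : Λ * (P.m * P.n) ^ 2 ≤ P.d
  Λ_le_d : Λ ≤ P.d
  m_le_d : (P.m : ℝ) ≤ P.d
  n_le_d : (P.n : ℝ) ≤ P.d
  Λ_le_m : Λ ≤ P.m
  step : Λ * (P.η * P.normXi ^ 2) ≤ 1
  init_le : Λ * (P.σ₀ * P.normXi) ≤ 1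
  init_ge : Λ * P.n / Real.sqrt P.d ≤ P.σ₀ * ‖P.v‖
  V_le_X : ‖P.v‖ ≤ P.normXi
  snr_le : Λ * (P.n * (‖P.v‖ / P.normXi) ^ P.q) ≤ 1
  budget_ge : Λ ^ P.q ≤ P.ε * (P.σ₀ * P.normXi) ^ P.q
  ε_le : P.n * P.ε ≤ Real.sqrt P.d ^ P.q
  mu_ge : 1 ≤ P.mu
  T_pos : 0 < P.T
  T_ge : P.m * P.n * P.ε * P.σ₀ / (2 * (P.η * P.mu * P.normXi)) ≤ a * P.logd ^ b * P.T
  T_le : P.T * (P.η * P.normXi ^ 2) ≤ a * P.logd ^ b * (P.m * (P.n * P.ε))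
  time : P.firstStage C + Λ * (P.m ^ 4 * P.n) / (2 * P.normXi ^ 2 * P.η * P.κ) ≤ P.T

lemma eps_le_of_init {N D e V s Λ q : ℝ} (hq : 0 < q) (hN : 1 ≤ N) (hD : 0 < D) (he : 0 < e)
    (hV : 0 < V) (hΛ : 1 ≤ Λ) (h1 : Λ * N / D ≤ s * V) (h2 : Λ * s ≤ (N * e) ^ (-1 / q) * V⁻¹) :
    N * e ≤ D ^ q := by
  have hNe : 0 < N * e := by positivity
  have h3 : Λ * s * V ≤ (N * e) ^ (-1 / q) := by
    have h := mul_le_mul_of_nonneg_right h2 hV.le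
    rwa [mul_assoc (_ ^ _), inv_mul_cancel₀ hV.ne', mul_one] at h
  have h4 : 1 / D ≤ (N * e) ^ (-1 / q) := by
    refine le_trans ?_ h3
    have h5 : 1 / D ≤ Λ * N / D := by
      gcongr
      nlinarith
    have h6 : 0 ≤ s * V := le_trans (by positivity) h1
    nlinarith
  have h5 := Real.rpow_le_rpow (by positivity) h4 hq.le
  rw [← Real.rpow_mul hNe.le, div_mul_cancel₀ _ hq.ne', Real.rpow_neg_one, one_div,
    Real.inv_rpow hD.le] at h5
  exact (inv_le_inv₀ (by positivity) hNe).1 h5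

lemma budget_mul_le {P : Params} (hm : 0 ≤ P.m * (P.n * P.ε)) (hη : 0 < P.η) (hX : 0 < P.normXi)
    (hσ : P.σ₀ * P.normXi ≤ 1) : P.budget * (P.η * P.normXi ^ 2) ≤ P.m * (P.n * P.ε) := by
  have hmu : 1 ≤ P.mu := le_max_left _ _
  have hmu0 : 0 < P.mu := by linarith
  have hV : 0 ≤ ‖P.v‖ := norm_nonneg _
  rw [budget, div_mul_eq_mul_div, div_le_iff₀ (by positivity)]
  have h3 : P.σ₀ * P.normXi ^ 2 ≤ P.mu * (‖P.v‖ + P.normXi) :=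
    calc P.σ₀ * P.normXi ^ 2 = P.σ₀ * P.normXi * P.normXi := by ring
      _ ≤ P.mu * (‖P.v‖ + P.normXi) := by
        gcongr
        · exact hσ.trans hmu
        · linarith
  calc P.m * P.n * P.ε * P.σ₀ * (P.η * P.normXi ^ 2)
      = P.m * (P.n * P.ε) * P.η * (P.σ₀ * P.normXi ^ 2) := by ring
    _ ≤ P.m * (P.n * P.ε) * P.η * (P.mu * (‖P.v‖ + P.normXi)) := by gcongr
    _ = _ := by ring

theorem NoiseMemorization.regime {P : Params} {a : ℝ} {b : ℕ} {C : ℝ} {k : ℕ}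
    (H : P.NoiseMemorization a b C k) (hq : 2 < P.q) (ha : 1 ≤ a) (hC : 1 ≤ C) :
    P.Regime a b C (P.polylog C k) := by
  have hlog : 0 ≤ Real.log P.d := Real.log_natCast_nonneg _
  have hL : 1 ≤ P.logd := by unfold logd; linarith
  set Λ := P.polylog C k with hΛ
  have hΛ1 : 1 ≤ Λ := by
    have h : (1 : ℝ) ≤ (1 + Real.log P.d) ^ k := one_le_pow₀ (by linarith)
    rw [hΛ, polylog]
    nlinarith
  have hΛ0 : 0 < Λ := by linarith
  have hn1 : (1 : ℝ) ≤ P.n := hΛ1.trans H.sample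
  have hm1 : (1 : ℝ) ≤ P.m := hΛ1.trans H.width
  have hn : 0 < P.n := by exact_mod_cast (by linarith : (0 : ℝ) < P.n)
  have hm : 0 < P.m := by exact_mod_cast (by linarith : (0 : ℝ) < P.m)
  have hV : 0 < ‖P.v‖ := norm_pos_iff.2 H.v_ne
  have hdim : Λ * ((P.m : ℝ) * P.n) ^ 2 ≤ P.d := by
    refine le_trans ?_ H.dim
    have h1 : (P.m : ℝ) ^ 2 ≤ (P.m : ℝ) ^ max 2 (4 / (P.q - 2)) := by
      rw [← Real.rpow_two]
      exact Real.rpow_le_rpow_of_exponent_le hm1 (le_max_left _ _)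
    have h2 : (P.n : ℝ) ^ 2 ≤ (P.n : ℝ) ^ max 4 ((2 * P.q - 2) / (P.q - 2)) := by
      rw [← Real.rpow_two]
      exact Real.rpow_le_rpow_of_exponent_le hn1 (le_trans (by norm_num) (le_max_left _ _))
    calc Λ * ((P.m : ℝ) * P.n) ^ 2 = Λ * (P.m : ℝ) ^ 2 * (P.n : ℝ) ^ 2 := by ring
      _ ≤ _ := by gcongr
  have hmn : (1 : ℝ) ≤ P.m * P.n := one_le_mul_of_one_le_of_one_le hm1 hn1
  have hmn2 : (P.m : ℝ) * P.n ≤ ((P.m : ℝ) * P.n) ^ 2 := by nlinarith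
  have hmn3 : ((P.m : ℝ) * P.n) ^ 2 ≤ P.d :=
    (le_mul_of_one_le_left (by positivity) hΛ1).trans hdim
  have hΛd : Λ ≤ P.d := (le_mul_of_one_le_right hΛ0.le (by linarith)).trans hdim
  have hd1 : (1 : ℝ) ≤ P.d := by linarith
  have hd : 0 < P.d := by exact_mod_cast (by linarith : (0 : ℝ) < P.d)
  have hsd : 0 < Real.sqrt P.d := Real.sqrt_pos.2 (by linarith)
  have hX : 0 < P.normXi := mul_pos H.σξ_pos hsd
  have hη := H.η_pos
  have hε := H.ε_pos
  have hnε : 0 < P.n * P.ε := by positivity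
  have hlow1 : Λ * (P.ε ^ (-1 / P.q) * P.normXi⁻¹) ≤ P.σ₀ :=
    (mul_le_mul_of_nonneg_left (le_max_left _ _) hΛ0.le).trans H.init_lower
  have hlow2 : Λ * (P.n / Real.sqrt P.d * ‖P.v‖⁻¹) ≤ P.σ₀ :=
    (mul_le_mul_of_nonneg_left (le_max_right _ _) hΛ0.le).trans H.init_lower
  have hup1 : Λ * P.σ₀ ≤ (P.n * P.ε) ^ (-1 / P.q) * ‖P.v‖⁻¹ := H.init_upper.trans (min_le_left _ _)
  have hup2 : Λ * P.σ₀ ≤ P.normXi⁻¹ := H.init_upper.trans (min_le_right _ _)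
  have hσ₀ : 0 < P.σ₀ := lt_of_lt_of_le (by positivity) hlow1
  have hq0 : P.q ≠ 0 := by linarith
  have hge : Λ * P.n / Real.sqrt P.d ≤ P.σ₀ * ‖P.v‖ := by
    have h := mul_le_mul_of_nonneg_right hlow2 hV.le
    calc Λ * P.n / Real.sqrt P.d = Λ * (P.n / Real.sqrt P.d * ‖P.v‖⁻¹) * ‖P.v‖ := by field_simp
      _ ≤ _ := h
  have hsnr : Λ * (P.n * (‖P.v‖ / P.normXi) ^ P.q) ≤ 1 := by
    have h := H.snr_small.trans (min_le_right _ _)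
    have hp : 0 < (‖P.v‖ / P.normXi) ^ P.q := by positivity
    rw [snr, Real.rpow_neg (by positivity), ← mul_inv, ← one_div,
      le_div_iff₀ (by positivity)] at h
    calc Λ * (P.n * (‖P.v‖ / P.normXi) ^ P.q) = Λ * ((‖P.v‖ / P.normXi) ^ P.q * P.n) := by ring
      _ ≤ 1 := h
  have hVX : ‖P.v‖ ≤ P.normXi := by
    by_contra! hlt
    have h1 : 1 < (‖P.v‖ / P.normXi) ^ P.q :=
      Real.one_lt_rpow ((one_lt_div hX).2 hlt) (by linarith)
    have h2 : 1 ≤ Λ * P.n := one_le_mul_of_one_le_of_one_le hΛ1 hn1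
    have h3 : 1 < Λ * P.n * (‖P.v‖ / P.normXi) ^ P.q := one_lt_mul_of_le_of_lt h2 h1
    linarith
  have hmu : 1 ≤ P.mu := le_max_left _ _
  have hTpos : (0 : ℝ) < P.T := lt_of_lt_of_le (inv_pos.2 H.κ_pos) H.inv_le
  have hpl : P.polylog a b = a * P.logd ^ b := rfl
  refine
    { d_pos := hd, n_pos := hn, m_pos := hm, X_pos := hX, V_pos := hV, σξ_pos := H.σξ_pos,
      σ₀_pos := hσ₀, η_pos := hη, ε_pos := hε, κ_pos := H.κ_pos, logd_ge := hL, dim := hdim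
      Λ_le_d := hΛd
      m_le_d := (le_mul_of_one_le_right (by linarith) hn1).trans (hmn2.trans hmn3)
      n_le_d := (le_mul_of_one_le_left (by linarith) hm1).trans (hmn2.trans hmn3)
      Λ_le_m := H.width
      step := ?_, init_le := ?_, init_ge := hge, V_le_X := hVX, snr_le := hsnr
      budget_ge := ?_, ε_le := ?_, mu_ge := hmu, T_pos := by exact_mod_cast hTpos
      T_ge := ?_, T_le := ?_, time := ?_ }
  · have h := H.step.trans (min_le_right _ _)
    rw [← one_div, le_div_iff₀ (by positivity)] at h
    linarith
  · rw [← one_div, le_div_iff₀ hX] at hup2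
    linarith
  · have h1 : Λ * P.ε ^ (-1 / P.q) ≤ P.σ₀ * P.normXi := by
      have h := mul_le_mul_of_nonneg_right hlow1 hX.le
      calc Λ * P.ε ^ (-1 / P.q) = Λ * (P.ε ^ (-1 / P.q) * P.normXi⁻¹) * P.normXi := by field_simp
        _ ≤ _ := h
    have h2 := Real.rpow_le_rpow (by positivity) h1 (by linarith : 0 ≤ P.q)
    rw [Real.mul_rpow hΛ0.le (by positivity), ← Real.rpow_mul hε.le,
      div_mul_cancel₀ _ hq0, Real.rpow_neg_one] at h2
    calc Λ ^ P.q = P.ε * (Λ ^ P.q * P.ε⁻¹) := by field_simp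
      _ ≤ _ := by gcongr
  · exact eps_le_of_init (by linarith) hn1 hsd hε hV hΛ1 hge hup1
  · refine le_trans ?_ (H.budget_le.trans (le_of_eq (by rw [hpl])))
    rw [budget]
    have h : ‖P.v‖ + P.normXi ≤ 2 * P.normXi := by linarith
    have hmu0 : 0 < P.mu := by linarith
    have hden : P.η * P.mu * (‖P.v‖ + P.normXi) ≤ 2 * (P.η * P.mu * P.normXi) :=
      calc P.η * P.mu * (‖P.v‖ + P.normXi) ≤ P.η * P.mu * (2 * P.normXi) := by gcongr
        _ = _ := by ring
    exact div_le_div_of_nonneg_left (by positivity) (by positivity) hden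
  · have hσX : P.σ₀ * P.normXi ≤ 1 := by
      rw [← one_div, le_div_iff₀ hX] at hup2
      have := mul_le_mul_of_nonneg_right hΛ1 (mul_pos hσ₀ hX).le
      linarith
    have h1 := budget_mul_le (P := P) (by positivity) hη hX hσX
    have hal : 0 ≤ a * P.logd ^ b := by positivity
    calc P.T * (P.η * P.normXi ^ 2) ≤ (a * P.logd ^ b * P.budget) * (P.η * P.normXi ^ 2) := by
          have := H.le_budget
          rw [hpl] at this
          gcongr
      _ = a * P.logd ^ b * (P.budget * (P.η * P.normXi ^ 2)) := by ring
      _ ≤ _ := by gcongr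
  · refine le_trans (le_of_eq ?_) H.time
    congr 1
    have hκ := H.κ_pos
    have hs : Real.sqrt P.n ^ 2 = P.n := Real.sq_sqrt (by positivity)
    rw [div_pow, mul_pow, hs, ← hΛ]
    field_simp

end Params

end NoisyCNN

namespace NoisyCNN

/-! ### The choice of the polylogarithmic factor -/

/-- The number of steps that growth at rate `β` takes to reach `y` from `1`. -/
lemma le_one_add_pow_ceil {β y : ℝ} (hβ : 0 < β) (hβ1 : β ≤ 1) (hy : 0 < y) :
    y ≤ (1 + β) ^ ⌈2 * Real.log y / β⌉₊ := by
  have h1 : Real.exp (β / 2) ≤ 1 + β := by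
    have h := (abs_le.1 (Real.abs_exp_sub_one_sub_id_le (x := β / 2)
      (by rw [abs_of_pos (by positivity)]; linarith))).2
    nlinarith
  have h2 := Nat.le_ceil (2 * Real.log y / β)
  calc y = Real.exp (Real.log y) := (Real.exp_log hy).symm
    _ ≤ Real.exp (⌈2 * Real.log y / β⌉₊ * (β / 2)) := by
        apply Real.exp_le_exp.2
        rw [div_le_iff₀ hβ] at h2
        linarith
    _ = Real.exp (β / 2) ^ ⌈2 * Real.log y / β⌉₊ := Real.exp_nat_mul _ _
    _ ≤ _ := by gcongr

lemma exists_mul_pow_rpow_ge {K θ : ℝ} (hK : 1 ≤ K) (hθ : 0 < θ) (hθ1 : θ ≤ 1) (s : ℕ) :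
    ∃ C, K ≤ C ∧ ∃ k : ℕ, ∀ L : ℝ, 1 ≤ L → K * L ^ s ≤ (C * L ^ k) ^ θ := by
  have hK0 : 0 < K := by linarith
  refine ⟨K ^ (1 / θ), ?_, ⌈s / θ⌉₊, fun L hL => ?_⟩
  · conv_lhs => rw [← Real.rpow_one K]
    exact Real.rpow_le_rpow_of_exponent_le hK (by rw [le_div_iff₀ hθ]; linarith)
  · have hL0 : 0 < L := by linarith
    rw [Real.mul_rpow (by positivity) (by positivity), ← Real.rpow_mul hK0.le,
      one_div_mul_cancel hθ.ne', Real.rpow_one, ← Real.rpow_natCast L ⌈_⌉₊, ← Real.rpow_mul hL0.le,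
      ← Real.rpow_natCast L s]
    have h : (s : ℝ) ≤ ⌈s / θ⌉₊ * θ := (div_le_iff₀ hθ).1 (Nat.le_ceil _)
    gcongr

/-- A bound for the maximal margin in units of `1 + log d`, with one unit to spare. -/
def marginConst (q : ℝ) : ℝ := q + 9

/-- The lower bounds that the polylogarithmic factor `Λ` has to satisfy, where `L = 1 + log d`. -/
structure Ample (q a : ℝ) (b : ℕ) (L Λ : ℝ) : Prop where
  sqrt : 80 * (q * 2 ^ q) * marginConst q ^ 2 * L ^ 3 ≤ Real.sqrt Λ
  pow : L ≤ Λ ^ (q - 2)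
  close : 80 * (q * 2 ^ q) * marginConst q ^ 2 * L ^ 3 ≤ Λ
  horizon : 28 * (q ^ 2 * 4 ^ q) * marginConst q ^ 2 * a * L ^ (b + 2) ≤ Λ
  cross : 2304 * marginConst q * L ^ 2 ≤ quarterProb * Λ
  signal : 2 * (144 * L) ^ (q - 2) * ((864 + 8 * q * marginConst q / lateRate q) * L) ≤ Λ
  early : 2 * 72 ^ 2 * 864 * 36 ^ (q - 2) * a * L ^ (b + 3) ≤ Λ
  late : 256 * marginConst q * L ≤ lateRate q * Λ

/-- All lower bounds are polynomial in `L`, hence satisfied by `C * L ^ k` with `C` and `k` depending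
on `q`, `a` and `b` only. The two bounds on `C` itself control the length of the first stage and make
`d` exceed `exp 20`. -/
lemma exists_ample {q a : ℝ} (hq : 2 < q) (ha : 1 ≤ a) (b : ℕ) :
    ∃ C, 1 ≤ C ∧ 144 * 36 ^ (q - 2) ≤ C ∧ Real.exp 20 ≤ C ∧
      ∃ k : ℕ, ∀ L : ℝ, 1 ≤ L → Ample q a b L (C * L ^ k) := by
  have hq0 : 0 < q := by linarith
  have hE : 1 ≤ marginConst q := by unfold marginConst; linarith
  have hE0 : 0 < marginConst q := by linarith
  have hp := quarterProb_pos
  have hc := Traj.lateRate_pos hq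
  set E := marginConst q
  set p := quarterProb
  set c := lateRate q
  set N := ⌈q⌉₊
  set K₁ := 80 * (q * 2 ^ q) * E ^ 2 with hK₁
  set K₂ := 28 * (q ^ 2 * 4 ^ q) * E ^ 2 * a with hK₂
  set K₃ := 2304 * E / p with hK₃
  set K₄ := 2 * (144 : ℝ) ^ (q - 2) * (864 + 8 * q * E / c) with hK₄
  set K₅ := 2 * 72 ^ 2 * 864 * (36 : ℝ) ^ (q - 2) * a with hK₅
  set K₆ := 256 * E / c with hK₆
  have h₁ : 0 < K₁ := by positivity
  have h₂ : 0 < K₂ := by positivity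
  have h₃ : 0 < K₃ := by positivity
  have h₄ : 0 < K₄ := by positivity
  have h₅ : 0 < K₅ := by positivity
  have h₆ : 0 < K₆ := by positivity
  set K := K₁ + K₂ + K₃ + K₄ + K₅ + K₆ + Real.exp 20 with hK
  have hexp : 1 ≤ Real.exp 20 := Real.one_le_exp (by norm_num)
  have hK1 : 1 ≤ K := by linarith
  obtain ⟨C, hKC, k, hC⟩ := exists_mul_pow_rpow_ge hK1 (θ := min (1 / 2) (q - 2))
    (lt_min (by norm_num) (by linarith)) ((min_le_left _ _).trans (by norm_num)) (b + N + 3)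
  refine ⟨C, by linarith, ?_, by linarith, k, fun L hL => ?_⟩
  · have h36 : (0 : ℝ) < 36 ^ (q - 2) := by positivity
    nlinarith
  · have hL0 : 0 < L := by linarith
    set Λ := C * L ^ k
    have hΛ1 : 1 ≤ Λ := one_le_mul_of_one_le_of_one_le (by linarith) (one_le_pow₀ hL)
    have hθ : ∀ e, min (1 / 2) (q - 2) ≤ e → K * L ^ (b + N + 3) ≤ Λ ^ e := fun e he =>
      (hC L hL).trans (Real.rpow_le_rpow_of_exponent_le hΛ1 he)
    have key : ∀ {c j} e, 0 ≤ c → c ≤ K → j ≤ b + N + 3 → min (1 / 2) (q - 2) ≤ e →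
        c * L ^ j ≤ Λ ^ e := fun {c j} e hc0 hcK hj he =>
      (mul_le_mul hcK (pow_le_pow_right₀ hL hj) (by positivity) (by linarith)).trans (hθ e he)
    have key1 : ∀ {c j}, 0 ≤ c → c ≤ K → j ≤ b + N + 3 → c * L ^ j ≤ Λ := fun {c j} hc0 hcK hj => by
      have := key 1 hc0 hcK hj ((min_le_left _ _).trans (by norm_num))
      rwa [Real.rpow_one] at this
    have hN : 1 ≤ N := Nat.one_le_ceil_iff.2 hq0
    constructor
    · rw [Real.sqrt_eq_rpow]
      exact key _ h₁.le (by linarith) (by omega) (min_le_left _ _)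
    · have := key (c := 1) (j := 1) (q - 2) zero_le_one hK1 (by omega) (min_le_right _ _)
      rwa [one_mul, pow_one] at this
    · exact key1 h₁.le (by linarith) (by omega)
    · exact key1 h₂.le (by linarith) (by omega)
    · have := key1 (j := 2) h₃.le (by linarith) (by omega)
      calc 2304 * E * L ^ 2 = p * (K₃ * L ^ 2) := by rw [hK₃]; field_simp
        _ ≤ _ := by gcongr
    · have h := key1 (j := N + 1) h₄.le (by linarith) (by omega)
      refine le_trans ?_ h
      have hpow : L ^ (q - 2) ≤ L ^ N := by
        rw [← Real.rpow_natCast]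
        exact Real.rpow_le_rpow_of_exponent_le hL (by linarith [Nat.le_ceil q])
      rw [Real.mul_rpow (by norm_num) hL0.le, hK₄, pow_succ]
      calc _ = 2 * (144 : ℝ) ^ (q - 2) * (864 + 8 * q * E / c) * (L ^ (q - 2) * L) := by ring
        _ ≤ _ := by gcongr
    · exact key1 h₅.le (by linarith) (by omega)
    · have := key1 (j := 1) h₆.le (by linarith) (by omega)
      calc 256 * E * L = c * (K₆ * L ^ 1) := by rw [hK₆]; field_simp
        _ ≤ _ := by gcongr

end NoisyCNN

namespace NoisyCNN

/-! ### The scales of the noise-memorization regime -/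

namespace Params

lemma sqrt_le_of_one_le {x : ℝ} (hx : 1 ≤ x) : Real.sqrt x ≤ x :=
  Real.sqrt_le_iff.2 ⟨by linarith, by nlinarith⟩

/-- The growth rate of a noise correlation that starts at the scale `σ₀ ‖ξ‖₂ / 36`. -/
def growth (P : Params) : ℝ :=
  P.η / ((P.n : ℝ) * P.m) * (P.normXi ^ 2 / 8) * P.q * (P.σ₀ * P.normXi / 36) ^ (P.q - 2) / 9

/-- The growth rate of a noise correlation of order one. -/
def growthLate (P : Params) : ℝ :=
  P.η / ((P.n : ℝ) * P.m) * (P.normXi ^ 2 / 8) * P.q / 9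

/-- The scales of the deterministic analysis in the noise-memorization regime. The Gaussian quantities
`B`, `R`, `A₀` are `1 + log d` standard deviations, up to a factor; `M` is such that `exp M` exceeds
the number of steps, which is at most `d ^ (q + 2)` in the relevant units; `x₀` is a third of
`σ₀ ‖ξ_i‖ / 4`, the size of a useful initial correlation, as `‖ξ_i‖ ≥ ‖ξ‖₂ / 3`; `δ` collects the
deviations of the correlations from their memorized parts; `t₁` and `t₂` are the times that
exponential growth takes from `x₀` to `1` and from `1` to `2 m`. -/
def scales (P : Params) : Scales where
  q := P.q
  h := P.η / ((P.n : ℝ) * P.m)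
  M := (P.q + 8) * P.logd
  δ := 4 * P.logd * (P.σ₀ * P.normXi) +
    16 * P.logd * (P.n * (P.m * ((P.q + 8) * P.logd))) / Real.sqrt P.d
  B := 2 * P.logd * (P.σ₀ * P.normXi)
  x₀ := P.σ₀ * P.normXi / 36
  R := 2 * P.logd * P.normXi ^ 2 / Real.sqrt P.d
  A₀ := 2 * P.logd * (P.σ₀ * ‖P.v‖)
  A := 4 * P.logd * (P.σ₀ * ‖P.v‖)
  V := ‖P.v‖ ^ 2
  slo := P.normXi ^ 2 / 8
  shi := 4 * P.normXi ^ 2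
  p₁ := quarterProb / 2
  T := P.T
  t₁ := ⌈2 * Real.log (P.σ₀ * P.normXi / 36)⁻¹ / P.growth⌉₊
  t₂ := ⌈2 * Real.log (2 * P.m) / P.growthLate⌉₊

section
variable {P : Params} {a : ℝ} {b : ℕ} {C Λ : ℝ} (G : P.Regime a b C Λ) (hq : 2 < P.q)
  (ha : 1 ≤ a) (W : Ample P.q a b P.logd Λ)
include G

lemma Regime.d_pos' : (0 : ℝ) < P.d := by exact_mod_cast G.d_pos

lemma Regime.m_one : (1 : ℝ) ≤ P.m := by exact_mod_cast G.m_pos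

lemma Regime.n_one : (1 : ℝ) ≤ P.n := by exact_mod_cast G.n_pos

lemma Regime.sqrt_pos : 0 < Real.sqrt P.d := Real.sqrt_pos.2 G.d_pos'

lemma Regime.scale_pos : 0 < P.σ₀ * P.normXi := mul_pos G.σ₀_pos G.X_pos

lemma Regime.exp_logd : Real.exp (P.logd - 1) = P.d := by
  rw [logd, add_sub_cancel_left, Real.exp_log G.d_pos']

lemma Regime.one_add_M_le : 1 + P.scales.M ≤ marginConst P.q * P.logd := by
  have := G.logd_ge
  simp only [scales, marginConst]
  linarith

include ha in
lemma Regime.horizon_const_le : 1 ≤ a * P.logd ^ b := by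
  have := one_le_pow₀ G.logd_ge (n := b)
  exact one_le_mul_of_one_le_of_one_le ha this

include hq

lemma Regime.incr_eq : P.scales.incr P.m =
    4 * (P.q ^ 2 * 4 ^ P.q) * (1 + P.scales.M) ^ 2 * (P.η * P.normXi ^ 2 / P.n) := by
  have hm := G.m_one
  have hn := G.n_one
  simp only [Scales.incr, scales]
  field_simp

lemma Regime.incr_nonneg : 0 ≤ P.scales.incr P.m := by
  have := G.η_pos
  rw [G.incr_eq hq]
  positivity

include W

lemma Regime.Λ_ge : 80 * P.logd ^ 3 ≤ Λ ∧ 80 * P.logd ^ 3 ≤ Real.sqrt Λ := by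
  have hL := G.logd_ge
  have h1 : (1 : ℝ) ≤ 2 ^ P.q := Real.one_le_rpow (by norm_num) (by linarith)
  have h2 : 1 ≤ P.q * 2 ^ P.q := by nlinarith
  have h3 : 1 ≤ marginConst P.q ^ 2 := one_le_pow₀ (by unfold marginConst; linarith)
  have h4 : 1 ≤ P.q * 2 ^ P.q * marginConst P.q ^ 2 := one_le_mul_of_one_le_of_one_le h2 h3
  have h5 : 80 * P.logd ^ 3 ≤ 80 * (P.q * 2 ^ P.q) * marginConst P.q ^ 2 * P.logd ^ 3 := by
    have : 0 ≤ P.logd ^ 3 := by positivity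
    nlinarith
  exact ⟨h5.trans W.close, h5.trans W.sqrt⟩

lemma Regime.Λ_ge_linear : 80 * P.logd ≤ Λ := by
  have hL := G.logd_ge
  have : P.logd ^ 1 ≤ P.logd ^ 3 := pow_le_pow_right₀ hL (by norm_num)
  linarith [(G.Λ_ge hq W).1]

lemma Regime.Λ_one : 1 ≤ Λ := by linarith [G.Λ_ge_linear hq W, G.logd_ge]

lemma Regime.scale_le : P.σ₀ * P.normXi ≤ 1 / Λ := by
  have := G.Λ_one hq W
  rw [le_div_iff₀ (by linarith)]
  linarith [G.init_le]

lemma Regime.scale_le_one : P.σ₀ * P.normXi ≤ 1 := by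
  have := G.Λ_one hq W
  exact (G.scale_le hq W).trans ((div_le_one (by linarith)).2 this)

lemma Regime.mul_le_sqrt : Real.sqrt Λ * (P.n * P.m) ≤ Real.sqrt P.d := by
  have := G.Λ_one hq W
  apply Real.le_sqrt_of_sq_le
  rw [mul_pow, Real.sq_sqrt (by linarith)]
  calc _ = Λ * ((P.m : ℝ) * P.n) ^ 2 := by ring
    _ ≤ _ := G.dim

lemma Regime.δ_le : P.scales.δ ≤ 20 * marginConst P.q * P.logd ^ 2 / Real.sqrt Λ := by
  have hΛ := G.Λ_one hq W
  have hL := G.logd_ge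
  have hs : 0 < Real.sqrt Λ := Real.sqrt_pos.2 (by linarith)
  have hsd := G.sqrt_pos
  have h1 : P.σ₀ * P.normXi ≤ 1 / Real.sqrt Λ := by
    refine (G.scale_le hq W).trans ?_
    have : Real.sqrt Λ ≤ Λ := sqrt_le_of_one_le hΛ
    gcongr
  have h2 : (P.n * P.m : ℝ) / Real.sqrt P.d ≤ 1 / Real.sqrt Λ := by
    rw [div_le_div_iff₀ hsd hs]
    linarith [G.mul_le_sqrt hq W]
  have e : P.scales.δ = 4 * P.logd * (P.σ₀ * P.normXi) +
      16 * (P.q + 8) * P.logd ^ 2 * (P.n * P.m / Real.sqrt P.d) := by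
    simp only [scales]; ring
  rw [e]
  calc _ ≤ 4 * P.logd * (1 / Real.sqrt Λ) + 16 * (P.q + 8) * P.logd ^ 2 * (1 / Real.sqrt Λ) := by
        gcongr
    _ = (4 * P.logd + 16 * (P.q + 8) * P.logd ^ 2) / Real.sqrt Λ := by ring
    _ ≤ _ := by
        gcongr
        unfold marginConst
        nlinarith

lemma Regime.close : P.q * 2 ^ P.q * P.scales.δ * (1 + P.scales.M) + 3 * P.scales.δ ≤ 1 / 2 := by
  have hΛ := G.Λ_one hq W
  have hL := G.logd_ge
  have hM := G.one_add_M_le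
  have hM0 : 1 ≤ 1 + P.scales.M := by simp only [scales]; nlinarith
  have hs : 0 < Real.sqrt Λ := Real.sqrt_pos.2 (by linarith)
  have hδ := G.δ_le hq W
  have h1 : (1 : ℝ) ≤ 2 ^ P.q := Real.one_le_rpow (by norm_num) (by linarith)
  have h4 : (4 : ℝ) ≤ 2 ^ P.q := by
    calc (4 : ℝ) = 2 ^ (2 : ℝ) := by norm_num
      _ ≤ _ := Real.rpow_le_rpow_of_exponent_le (by norm_num) hq.le
  have h2 : 3 ≤ P.q * 2 ^ P.q * (marginConst P.q * P.logd) := by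
    have : 3 ≤ P.q * 2 ^ P.q := by nlinarith
    nlinarith
  have hδ0 : 0 ≤ P.scales.δ := by
    have := G.scale_pos
    simp only [scales]; positivity
  calc _ ≤ P.scales.δ * (2 * (P.q * 2 ^ P.q * (marginConst P.q * P.logd))) := by
        have h5 : P.q * 2 ^ P.q * P.scales.δ * (1 + P.scales.M) ≤
          P.q * 2 ^ P.q * P.scales.δ * (marginConst P.q * P.logd) := by gcongr
        nlinarith
    _ ≤ 20 * marginConst P.q * P.logd ^ 2 / Real.sqrt Λ *
        (2 * (P.q * 2 ^ P.q * (marginConst P.q * P.logd))) := by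
        have : 0 ≤ marginConst P.q := by unfold marginConst; linarith
        gcongr
    _ = 80 * (P.q * 2 ^ P.q) * marginConst P.q ^ 2 * P.logd ^ 3 / Real.sqrt Λ / 2 := by ring
    _ ≤ 1 / 2 := by
        gcongr
        exact (div_le_one hs).2 W.sqrt

lemma Regime.step_le : P.scales.h * P.scales.shi * P.m ≤ 4 / Λ := by
  have hΛ := G.Λ_one hq W
  have hn := G.n_one
  have hm := G.m_one
  have hη := G.η_pos
  have e : P.scales.h * P.scales.shi * P.m = 4 * (P.η * P.normXi ^ 2) / P.n := by
    simp only [scales]; field_simp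
  have h1 : P.η * P.normXi ^ 2 ≤ 1 / Λ := by
    rw [le_div_iff₀ (by linarith)]; linarith [G.step]
  rw [e]
  calc _ ≤ 4 * (P.η * P.normXi ^ 2) := div_le_self (by positivity) hn
    _ ≤ 4 * (1 / Λ) := by gcongr
    _ = _ := by ring

lemma Regime.step_fits :
    P.scales.h * P.scales.shi * (P.q * 2 ^ P.q * (P.m * (1 + P.scales.M))) ≤ 1 / 4 := by
  have hΛ := G.Λ_one hq W
  have hM := G.one_add_M_le
  have hL := G.logd_ge
  have hM0 : 0 ≤ 1 + P.scales.M := by simp only [scales]; nlinarith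
  have h1 := G.step_le hq W
  have hE : 1 ≤ marginConst P.q := by unfold marginConst; linarith
  have h2 : 16 * (P.q * 2 ^ P.q) * (marginConst P.q * P.logd) ≤ Λ := by
    refine le_trans ?_ W.close
    have h3 : marginConst P.q * P.logd ≤ marginConst P.q ^ 2 * P.logd ^ 3 := by
      have := pow_le_pow_right₀ hL (show 1 ≤ 3 by norm_num)
      have h4 := pow_le_pow_right₀ hE (show 1 ≤ 2 by norm_num)
      rw [pow_one] at this h4
      gcongr
    have : 0 ≤ P.q * 2 ^ P.q := by positivity
    have h0 : 0 ≤ marginConst P.q * P.logd := by positivity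
    nlinarith [mul_le_mul_of_nonneg_left h3 this, mul_nonneg this h0]
  calc _ = P.scales.h * P.scales.shi * P.m * (P.q * 2 ^ P.q * (1 + P.scales.M)) := by ring
    _ ≤ 4 / Λ * (P.q * 2 ^ P.q * (marginConst P.q * P.logd)) := by gcongr
    _ = 16 * (P.q * 2 ^ P.q) * (marginConst P.q * P.logd) / Λ / 4 := by ring
    _ ≤ 1 / 4 := by
        gcongr
        exact (div_le_one (by linarith)).2 h2

include ha

lemma Regime.incr_le : P.scales.incr P.m ≤ 1 := by
  have hΛ := G.Λ_one hq W
  have hL := G.logd_ge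
  have hM := G.one_add_M_le
  have hM0 : 0 ≤ 1 + P.scales.M := by simp only [scales]; nlinarith
  have hη := G.η_pos
  have h1 : P.η * P.normXi ^ 2 / P.n ≤ 1 / Λ := by
    refine (div_le_self (by positivity) G.n_one).trans ?_
    rw [le_div_iff₀ (by linarith)]; linarith [G.step]
  have hab := G.horizon_const_le ha
  rw [G.incr_eq hq]
  calc _ ≤ 4 * (P.q ^ 2 * 4 ^ P.q) * (marginConst P.q * P.logd) ^ 2 * (1 / Λ) := by gcongr
    _ = 4 * (P.q ^ 2 * 4 ^ P.q) * marginConst P.q ^ 2 * P.logd ^ 2 / Λ := by ring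
    _ ≤ 1 := by
        rw [div_le_one (by linarith)]
        refine le_trans ?_ W.horizon
        have h0 : 0 ≤ (P.q ^ 2 * 4 ^ P.q) * marginConst P.q ^ 2 * P.logd ^ 2 := by positivity
        calc _ = 4 * ((P.q ^ 2 * 4 ^ P.q) * marginConst P.q ^ 2 * P.logd ^ 2) := by ring
          _ ≤ 28 * ((P.q ^ 2 * 4 ^ P.q) * marginConst P.q ^ 2 * P.logd ^ 2) * (a * P.logd ^ b) := by
              nlinarith
          _ = _ := by ring

lemma Regime.horizon :
    1 + 2 * Real.exp 1 * P.scales.incr P.m * P.T ≤ Real.exp P.scales.M := by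
  have hΛ := G.Λ_one hq W
  have hL := G.logd_ge
  have hM := G.one_add_M_le
  have hM0 : 0 ≤ 1 + P.scales.M := by simp only [scales]; nlinarith
  have hη := G.η_pos
  have hn := G.n_one
  have hab := G.horizon_const_le ha
  have hd1 : (1 : ℝ) ≤ P.d := hΛ.trans G.Λ_le_d
  have hε := G.ε_pos
  have hdq : Real.sqrt P.d ^ P.q ≤ (P.d : ℝ) ^ P.q :=
    Real.rpow_le_rpow (Real.sqrt_nonneg _) (sqrt_le_of_one_le hd1) (by linarith)
  have hdq1 : 1 ≤ (P.d : ℝ) ^ P.q := Real.one_le_rpow hd1 (by linarith)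
  have h1 : P.T * (P.η * P.normXi ^ 2) / P.n ≤ a * P.logd ^ b * (P.d * (P.d : ℝ) ^ P.q) := by
    calc P.T * (P.η * P.normXi ^ 2) / P.n ≤ P.T * (P.η * P.normXi ^ 2) :=
          div_le_self (by positivity) hn
      _ ≤ a * P.logd ^ b * (P.m * (P.n * P.ε)) := G.T_le
      _ ≤ _ := by
        have h2 := G.m_le_d
        have h3 := G.ε_le.trans hdq
        gcongr
  set Q := 4 * (P.q ^ 2 * 4 ^ P.q) * marginConst P.q ^ 2 * a * P.logd ^ (b + 2) with hQ
  have hQ1 : 1 ≤ Q := by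
    have h2 : (1 : ℝ) ≤ 4 ^ P.q := Real.one_le_rpow (by norm_num) (by linarith)
    have h3 : 1 ≤ P.q ^ 2 := one_le_pow₀ (by linarith)
    have h4 : 1 ≤ marginConst P.q ^ 2 := one_le_pow₀ (by unfold marginConst; linarith)
    have h5 : 1 ≤ P.logd ^ (b + 2) := one_le_pow₀ hL
    have h6 := one_le_mul_of_one_le_of_one_le h3 h2
    have h7 := one_le_mul_of_one_le_of_one_le h6 h4
    have h8 := one_le_mul_of_one_le_of_one_le (one_le_mul_of_one_le_of_one_le h7 ha) h5
    rw [hQ]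
    linarith
  have h2 : P.scales.incr P.m * P.T ≤ Q * (P.d * (P.d : ℝ) ^ P.q) := by
    rw [G.incr_eq hq]
    calc _ = 4 * (P.q ^ 2 * 4 ^ P.q) * (1 + P.scales.M) ^ 2 *
          (P.T * (P.η * P.normXi ^ 2) / P.n) := by ring
      _ ≤ 4 * (P.q ^ 2 * 4 ^ P.q) * (marginConst P.q * P.logd) ^ 2 *
          (a * P.logd ^ b * (P.d * (P.d : ℝ) ^ P.q)) := by gcongr
      _ = _ := by rw [hQ]; ring
  have hD : 1 ≤ P.d * (P.d : ℝ) ^ P.q := one_le_mul_of_one_le_of_one_le hd1 hdq1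
  have he : Real.exp 1 ≤ 3 := by linarith [Real.exp_one_lt_d9]
  have hD0 : 0 ≤ Q * (P.d * (P.d : ℝ) ^ P.q) := by positivity
  have h0 := mul_nonneg (G.incr_nonneg hq) (Nat.cast_nonneg (α := ℝ) P.T)
  calc 1 + 2 * Real.exp 1 * P.scales.incr P.m * P.T
      = 1 + 2 * Real.exp 1 * (P.scales.incr P.m * P.T) := by ring
    _ ≤ 1 + 2 * 3 * (Q * (P.d * (P.d : ℝ) ^ P.q)) := by gcongr
    _ ≤ 7 * Q * (P.d * (P.d : ℝ) ^ P.q) := by nlinarith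
    _ ≤ P.d * (P.d * (P.d : ℝ) ^ P.q) := by
        have : 7 * Q ≤ P.d := by
          refine le_trans (le_of_eq ?_) (W.horizon.trans G.Λ_le_d)
          rw [hQ]; ring
        gcongr
    _ = Real.exp ((P.logd - 1) * (P.q + 2)) := by
        rw [Real.exp_mul, G.exp_logd, Real.rpow_add G.d_pos', Real.rpow_two]
        ring
    _ ≤ _ := by
        apply Real.exp_le_exp.2
        simp only [scales]
        nlinarith

omit ha

lemma Regime.scale_ge : 1 / (P.d : ℝ) ≤ P.σ₀ * P.normXi := by
  have hΛ := G.Λ_one hq W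
  have hn := G.n_one
  have hd1 : (1 : ℝ) ≤ P.d := hΛ.trans G.Λ_le_d
  have hσ := G.σ₀_pos
  calc 1 / (P.d : ℝ) ≤ Λ * P.n / Real.sqrt P.d := by
        have h1 := sqrt_le_of_one_le hd1
        have h2 : 1 ≤ Λ * P.n := one_le_mul_of_one_le_of_one_le hΛ hn
        have := G.sqrt_pos
        gcongr
    _ ≤ _ := G.init_ge
    _ ≤ _ := by
        have := G.V_le_X
        gcongr

lemma Regime.cross : P.scales.R * (2 / P.scales.p₁ * (P.n * (1 + P.scales.M) / P.scales.slo)) ≤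
    P.scales.x₀ := by
  have hM := G.one_add_M_le
  have hp := quarterProb_pos
  have hX := G.X_pos
  have hsd := G.sqrt_pos
  have hL := G.logd_ge
  have hn := G.n_one
  have hσ := G.σ₀_pos
  have hE : 0 < marginConst P.q := by unfold marginConst; linarith
  have h1 : Λ * (P.n / Real.sqrt P.d) ≤ P.σ₀ * P.normXi := by
    have h2 := G.V_le_X
    calc Λ * (P.n / Real.sqrt P.d) = Λ * P.n / Real.sqrt P.d := by ring
      _ ≤ _ := G.init_ge
      _ ≤ _ := by gcongr
  have e : P.scales.R * (2 / P.scales.p₁ * (P.n * (1 + P.scales.M) / P.scales.slo)) =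
      64 * P.logd * (1 + P.scales.M) * (P.n / Real.sqrt P.d) / quarterProb := by
    simp only [scales]; field_simp; ring
  rw [e, div_le_iff₀ hp]
  calc _ ≤ 64 * P.logd * (marginConst P.q * P.logd) * (P.n / Real.sqrt P.d) := by gcongr
    _ = 2304 * marginConst P.q * P.logd ^ 2 * (P.n / Real.sqrt P.d) / 36 := by ring
    _ ≤ quarterProb * Λ * (P.n / Real.sqrt P.d) / 36 := by
        have := W.cross
        gcongr
    _ = quarterProb * (Λ * (P.n / Real.sqrt P.d)) / 36 := by ring
    _ ≤ quarterProb * (P.σ₀ * P.normXi) / 36 := by gcongr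
    _ = _ := by simp only [scales]; ring

end

end Params

end NoisyCNN

namespace NoisyCNN

/-! ### Lengths of the stages -/

namespace Params

section
variable {P : Params} {a : ℝ} {b : ℕ} {C Λ : ℝ} (G : P.Regime a b C Λ) (hq : 2 < P.q)
  (W : Ample P.q a b P.logd Λ)
include G hq

lemma Regime.growthLate_pos : 0 < P.growthLate := by
  have := G.η_pos
  have := G.X_pos
  have := G.n_one
  have := G.m_one
  unfold growthLate; positivity

omit hq in
lemma Regime.log_width_le : Real.log (2 * P.m) ≤ P.logd := by
  have hm := G.m_one
  rw [Real.log_mul (by norm_num) (by linarith), logd]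
  have h1 := Real.log_le_log (by linarith) G.m_le_d
  linarith [Real.log_two_lt_d9]

omit hq in
lemma Regime.x₀_pos : 0 < P.σ₀ * P.normXi / 36 := by linarith [G.scale_pos]

omit G hq in
lemma growth_eq : P.growth = P.growthLate * (P.σ₀ * P.normXi / 36) ^ (P.q - 2) := by
  unfold growth growthLate; ring

lemma Regime.growth_pos : 0 < P.growth := by
  rw [growth_eq]
  exact mul_pos (G.growthLate_pos hq) (Real.rpow_pos_of_pos G.x₀_pos _)

/-- The common factor of the lengths of the stages. -/
lemma Regime.inv_growth : 1 / P.growth = 72 * 36 ^ (P.q - 2) * (P.n * P.m /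
    (P.η * P.normXi ^ 2 * P.q * (P.σ₀ * P.normXi) ^ (P.q - 2))) := by
  have := G.η_pos
  have := G.X_pos
  have := G.n_one
  have := G.m_one
  have hs := Real.rpow_pos_of_pos G.scale_pos (P.q - 2)
  have h36 := Real.rpow_pos_of_pos (show (0 : ℝ) < 36 by norm_num) (P.q - 2)
  rw [growth, Real.div_rpow G.scale_pos.le (by norm_num)]
  field_simp
  norm_num

include W

lemma Regime.growthLate_le : P.growthLate ≤ 1 := by
  have hη := G.η_pos
  have hX := G.X_pos
  have hn := G.n_one
  have hm := G.m_one
  have hL := G.logd_ge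
  have hqΛ : P.q ≤ Λ := by
    refine le_trans ?_ W.close
    have h1 : (1 : ℝ) ≤ 2 ^ P.q := Real.one_le_rpow (by norm_num) (by linarith)
    have h2 : P.q ≤ P.q * 2 ^ P.q := le_mul_of_one_le_right (by linarith) h1
    have h3 : 1 ≤ marginConst P.q ^ 2 * P.logd ^ 3 := one_le_mul_of_one_le_of_one_le
      (one_le_pow₀ (by unfold marginConst; linarith)) (one_le_pow₀ hL)
    have h4 : P.q * 2 ^ P.q ≤ P.q * 2 ^ P.q * (marginConst P.q ^ 2 * P.logd ^ 3) :=
      le_mul_of_one_le_right (by linarith) h3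
    linarith
  have h1 : P.growthLate = P.q * (P.η * P.normXi ^ 2) / (P.n * P.m) / 72 := by
    unfold growthLate; ring
  have h2 : P.q * (P.η * P.normXi ^ 2) ≤ 1 := by
    have : P.q * (P.η * P.normXi ^ 2) ≤ Λ * (P.η * P.normXi ^ 2) := by gcongr
    linarith [G.step]
  have h3 : P.q * (P.η * P.normXi ^ 2) / (P.n * P.m) ≤ P.q * (P.η * P.normXi ^ 2) :=
    div_le_self (by positivity) (one_le_mul_of_one_le_of_one_le hn hm)
  rw [h1]
  linarith

lemma Regime.x₀_le_one : P.σ₀ * P.normXi / 36 ≤ 1 := by linarith [G.scale_le_one hq W]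

lemma Regime.growth_le : P.growth ≤ 1 := by
  rw [growth_eq]
  exact mul_le_one₀ (G.growthLate_le hq W) (Real.rpow_nonneg G.x₀_pos.le _)
    (Real.rpow_le_one G.x₀_pos.le (G.x₀_le_one hq W) (by linarith))

/-- The second stage is shorter than the first one, because a noise correlation of order one grows
faster than a small one by a factor that beats `log m`. -/
lemma Regime.stages_le : ((P.scales.t₁ + P.scales.t₂ : ℕ) : ℝ) ≤
    2 / P.growth * (Real.log (P.σ₀ * P.normXi / 36)⁻¹ + 2) := by
  have hg := G.growth_pos hq
  have hgl := G.growthLate_pos hq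
  have hx := G.x₀_pos
  have hm := G.m_one
  have hlog : 0 ≤ Real.log (P.σ₀ * P.normXi / 36)⁻¹ :=
    Real.log_nonneg ((one_le_inv₀ hx).2 (G.x₀_le_one hq W))
  have hlogm : 0 ≤ Real.log (2 * P.m) := Real.log_nonneg (by linarith)
  have h1 := (Nat.ceil_lt_add_one (a := 2 * Real.log (P.σ₀ * P.normXi / 36)⁻¹ / P.growth)
    (by positivity)).le
  have h2 := (Nat.ceil_lt_add_one (a := 2 * Real.log (2 * P.m) / P.growthLate) (by positivity)).le
  have h3 : Real.log (2 * P.m) * (P.σ₀ * P.normXi / 36) ^ (P.q - 2) ≤ 1 := by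
    have hΛ := G.Λ_one hq W
    have h4 : (P.σ₀ * P.normXi / 36) ^ (P.q - 2) ≤ (1 / Λ) ^ (P.q - 2) :=
      Real.rpow_le_rpow hx.le (by linarith [G.scale_le hq W, G.scale_pos]) (by linarith)
    have hpow := Real.rpow_pos_of_pos (show 0 < Λ by linarith) (P.q - 2)
    rw [Real.div_rpow zero_le_one (by linarith), Real.one_rpow] at h4
    calc _ ≤ P.logd * (1 / Λ ^ (P.q - 2)) := by
          have := G.log_width_le
          have := G.logd_ge
          gcongr
      _ ≤ 1 := by
          rw [mul_one_div]
          exact (div_le_one hpow).2 W.pow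
  have h5 : 2 * Real.log (2 * P.m) / P.growthLate ≤ 2 / P.growth := by
    rw [div_le_div_iff₀ hgl hg, growth_eq]
    calc _ = 2 * P.growthLate * (Real.log (2 * P.m) * (P.σ₀ * P.normXi / 36) ^ (P.q - 2)) := by ring
      _ ≤ 2 * P.growthLate * 1 := by gcongr
      _ = _ := by ring
  have h6 : 1 ≤ 1 / P.growth := (one_le_div hg).2 (G.growth_le hq W)
  have e : (2 : ℝ) / P.growth * (Real.log (P.σ₀ * P.normXi / 36)⁻¹ + 2) =
      2 * Real.log (P.σ₀ * P.normXi / 36)⁻¹ / P.growth + 2 / P.growth + 2 * (1 / P.growth) := by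
    ring
  rw [e]
  push_cast
  simp only [scales]
  linarith

lemma Regime.log_inv_le : Real.log (P.σ₀ * P.normXi / 36)⁻¹ ≤ P.logd + 3 := by
  have hs := G.scale_pos
  have h1 := G.scale_ge hq W
  have hd := G.d_pos'
  rw [div_le_iff₀ hd] at h1
  have h2 : (P.σ₀ * P.normXi / 36)⁻¹ ≤ 36 * P.d := by
    rw [inv_div, div_le_iff₀ hs]
    linarith
  have h3 : Real.log 36 ≤ 4 := by
    rw [Real.log_le_iff_le_exp (by norm_num)]
    have h4 : (2.7 : ℝ) ≤ Real.exp 1 := by linarith [Real.exp_one_gt_d9]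
    calc (36 : ℝ) ≤ 2.7 ^ 4 := by norm_num
      _ ≤ Real.exp 1 ^ 4 := by gcongr
      _ = Real.exp 4 := by rw [← Real.exp_nat_mul]; norm_num
  have h4 := Real.log_le_log (inv_pos.2 G.x₀_pos) h2
  rw [Real.log_mul (by norm_num) hd.ne'] at h4
  unfold logd
  linarith

lemma Regime.stages_le_log : ((P.scales.t₁ + P.scales.t₂ : ℕ) : ℝ) ≤ 12 * P.logd * (1 / P.growth) := by
  have hg := G.growth_pos hq
  have hL := G.logd_ge
  refine (G.stages_le hq W).trans ?_
  calc _ ≤ 2 / P.growth * (6 * P.logd) := by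
        have := G.log_inv_le hq W
        gcongr
        linarith
    _ = _ := by ring

lemma Regime.phase_one : 1 ≤ P.scales.x₀ *
    (1 + P.scales.h * P.scales.slo * P.scales.q * P.scales.x₀ ^ (P.scales.q - 2) / 9) ^
      P.scales.t₁ := by
  have h := le_one_add_pow_ceil (G.growth_pos hq) (G.growth_le hq W) (inv_pos.2 G.x₀_pos)
  have hx := G.x₀_pos
  calc 1 = P.σ₀ * P.normXi / 36 * (P.σ₀ * P.normXi / 36)⁻¹ := (mul_inv_cancel₀ hx.ne').symm
    _ ≤ P.σ₀ * P.normXi / 36 *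
        (1 + P.growth) ^ ⌈2 * Real.log (P.σ₀ * P.normXi / 36)⁻¹ / P.growth⌉₊ := by gcongr
    _ = _ := rfl

lemma Regime.phase_two : 2 * (P.m : ℝ) ≤
    (1 + P.scales.h * P.scales.slo * P.scales.q / 9) ^ P.scales.t₂ :=
  le_one_add_pow_ceil (G.growthLate_pos hq) (G.growthLate_le hq W) (by linarith [G.m_one])

/-- The signal is not learned: as `n SNR^q` is small, its growth up to the end of training is
negligible against its initial size. -/
lemma Regime.signal : P.scales.A₀ + P.scales.h * P.scales.V *
    (P.scales.q * P.scales.A ^ (P.scales.q - 1)) * (P.n * (P.scales.t₁ + P.scales.t₂ +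
      P.scales.M / (lateRate P.scales.q * (P.scales.h * P.scales.slo)))) ≤ P.scales.A := by
  have hη := G.η_pos
  have hX := G.X_pos
  have hV := G.V_pos
  have hn := G.n_one
  have hm := G.m_one
  have hL := G.logd_ge
  have hσ := G.σ₀_pos
  have hΛ := G.Λ_one hq W
  have hx := G.x₀_pos
  have hc := Traj.lateRate_pos hq
  have hE : 0 < marginConst P.q := by unfold marginConst; linarith
  set x := P.σ₀ * P.normXi / 36 with hxdef
  set ρ := ‖P.v‖ / P.normXi with hρdef
  have hρ : 0 < ρ := by positivity
  have hxp := Real.rpow_pos_of_pos hx (P.q - 2)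
  set c := lateRate P.q
  set g := P.η / ((P.n : ℝ) * P.m) * P.normXi ^ 2 with hg
  have hg0 : 0 < g := by positivity
  set t : ℝ := ((P.scales.t₁ + P.scales.t₂ : ℕ) : ℝ) with ht
  have hA : P.scales.A = 144 * P.logd * x * ρ := by
    simp only [scales, hxdef, hρdef]; field_simp; norm_num
  have hA0 : 0 < P.scales.A := by rw [hA]; positivity
  have hpow : P.scales.A ^ (P.q - 1) =
      P.scales.A * ((144 * P.logd) ^ (P.q - 2) * x ^ (P.q - 2) * ρ ^ (P.q - 2)) := by
    conv_lhs => rw [show P.q - 1 = 1 + (P.q - 2) by ring, Real.rpow_add hA0, Real.rpow_one, hA,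
      Real.mul_rpow (by positivity) hρ.le, Real.mul_rpow (by positivity) hx.le, ← hA]
  have hρq : ρ ^ P.q = ρ ^ 2 * ρ ^ (P.q - 2) := by
    rw [← Real.rpow_two, ← Real.rpow_add hρ]; congr 1; ring
  have hgV : P.scales.h * P.scales.V = g * ρ ^ 2 := by
    simp only [scales, hg, hρdef]; field_simp
  have hgs : P.scales.h * P.scales.slo = g / 8 := by simp only [scales, hg]; ring
  have hgrow : 1 / P.growth = 72 / (g * P.q * x ^ (P.q - 2)) := by
    rw [growth, ← hxdef, hg]; field_simp; norm_num
  have ht1 : g * x ^ (P.q - 2) * t ≤ 864 * P.logd / P.q := by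
    calc _ ≤ g * x ^ (P.q - 2) * (12 * P.logd * (1 / P.growth)) := by
          have := G.stages_le_log hq W
          gcongr
      _ = _ := by rw [hgrow]; field_simp; norm_num
  have hM : P.scales.M ≤ marginConst P.q * P.logd := by linarith [G.one_add_M_le]
  have hM0 : 0 ≤ P.scales.M := by simp only [scales]; nlinarith
  have hx1 : x ^ (P.q - 2) ≤ 1 := Real.rpow_le_one hx.le (G.x₀_le_one hq W) (by linarith)
  have ht2 : x ^ (P.q - 2) * (8 * P.scales.M / c) ≤ 8 * (marginConst P.q * P.logd) / c :=
    calc _ ≤ 1 * (8 * P.scales.M / c) := by gcongr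
      _ = 8 * P.scales.M / c := one_mul _
      _ ≤ _ := by gcongr
  have hnρ : P.n * ρ ^ P.q ≤ 1 / Λ := by
    rw [le_div_iff₀ (by linarith)]
    linarith [G.snr_le]
  have hbr : P.q * (g * x ^ (P.q - 2) * t + x ^ (P.q - 2) * (8 * P.scales.M / c)) ≤
      (864 + 8 * P.q * marginConst P.q / c) * P.logd :=
    calc _ ≤ P.q * (864 * P.logd / P.q + 8 * (marginConst P.q * P.logd) / c) := by gcongr
      _ = _ := by field_simp
  have e : P.scales.h * P.scales.V * (P.scales.q * P.scales.A ^ (P.scales.q - 1)) *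
      (P.n * (P.scales.t₁ + P.scales.t₂ +
        P.scales.M / (lateRate P.scales.q * (P.scales.h * P.scales.slo)))) =
      P.scales.A * ((144 * P.logd) ^ (P.q - 2) * (P.n * ρ ^ P.q) *
        (P.q * (g * x ^ (P.q - 2) * t + x ^ (P.q - 2) * (8 * P.scales.M / c)))) := by
    have hc' : lateRate P.q = c := rfl
    rw [show P.scales.q = P.q from rfl, hc', hpow, hgV, hgs, hρq, ht]
    push_cast
    field_simp
  have key : (144 * P.logd) ^ (P.q - 2) * (P.n * ρ ^ P.q) *
      (P.q * (g * x ^ (P.q - 2) * t + x ^ (P.q - 2) * (8 * P.scales.M / c))) ≤ 1 / 2 :=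
    calc _ ≤ (144 * P.logd) ^ (P.q - 2) * (1 / Λ) *
          ((864 + 8 * P.q * marginConst P.q / c) * P.logd) := by gcongr
      _ = 2 * (144 * P.logd) ^ (P.q - 2) *
          ((864 + 8 * P.q * marginConst P.q / c) * P.logd) / Λ / 2 := by ring
      _ ≤ 1 / 2 := by
          gcongr
          exact (div_le_one (by linarith)).2 W.signal
  rw [e]
  have h0 : P.scales.A₀ = P.scales.A / 2 := by simp only [scales]; ring
  rw [h0]
  have h1 := mul_le_mul_of_nonneg_left key hA0.le
  linarith

/-- The private noise is negligible during the first two stages: these are short compared to `T`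
because the privacy budget is large. -/
lemma Regime.early : 72 ^ 2 * P.logd ^ 2 * (P.scales.t₁ + P.scales.t₂ : ℕ) ≤ P.mu * P.T := by
  have hη := G.η_pos
  have hX := G.X_pos
  have hn := G.n_one
  have hm := G.m_one
  have hL := G.logd_ge
  have hσ := G.σ₀_pos
  have hε := G.ε_pos
  have hmu : 0 < P.mu := by linarith [G.mu_ge]
  have hΛ := G.Λ_one hq W
  have hs := G.scale_pos
  have hsp := Real.rpow_pos_of_pos hs (P.q - 2)
  by_cases ha : 0 < a
  swap
  · -- for `a ≤ 0` the lower bound on `T` is contradictory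
    have h1 := G.T_ge
    have h2 : 0 < P.m * P.n * P.ε * P.σ₀ / (2 * (P.η * P.mu * P.normXi)) := by positivity
    have h3 : a * P.logd ^ b * P.T ≤ 0 :=
      mul_nonpos_of_nonpos_of_nonneg (mul_nonpos_of_nonpos_of_nonneg (not_lt.1 ha) (by positivity))
        (Nat.cast_nonneg _)
    linarith
  set s := P.σ₀ * P.normXi with hsdef
  set u := (P.n * P.m : ℝ) / (P.η * P.normXi ^ 2 * P.q * s ^ (P.q - 2)) with hu
  have hu0 : 0 < u := by positivity
  have hab : 0 < 2 * a * P.logd ^ b := by positivity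
  have h1 : Λ ≤ P.q * (P.ε * s * s ^ (P.q - 2)) := by
    have h2 : Λ ≤ Λ ^ P.q := by
      conv_lhs => rw [← Real.rpow_one Λ]
      exact Real.rpow_le_rpow_of_exponent_le hΛ (by linarith)
    have h3 : s ^ P.q ≤ s * s ^ (P.q - 2) := by
      have : s * s ^ (P.q - 2) = s ^ (P.q - 1) := by
        rw [← Real.rpow_one_add' hs.le (by linarith)]; congr 1; ring
      rw [this]
      exact Real.rpow_le_rpow_of_exponent_ge hs (G.scale_le_one hq W) (by linarith)
    calc Λ ≤ Λ ^ P.q := h2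
      _ ≤ P.ε * s ^ P.q := G.budget_ge
      _ ≤ P.ε * (s * s ^ (P.q - 2)) := by gcongr
      _ ≤ P.q * (P.ε * (s * s ^ (P.q - 2))) := le_mul_of_one_le_left (by positivity) (by linarith)
      _ = _ := by ring
  refine le_of_mul_le_mul_left ?_ hab
  calc 2 * a * P.logd ^ b * (72 ^ 2 * P.logd ^ 2 * (P.scales.t₁ + P.scales.t₂ : ℕ))
      ≤ 2 * a * P.logd ^ b * (72 ^ 2 * P.logd ^ 2 * (12 * P.logd * (1 / P.growth))) := by
        have := G.stages_le_log hq W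
        gcongr
    _ = 2 * 72 ^ 2 * 864 * 36 ^ (P.q - 2) * a * P.logd ^ (b + 3) * u := by
        rw [G.inv_growth hq, hu]; ring
    _ ≤ Λ * u := by
        have := W.early
        gcongr
    _ ≤ P.q * (P.ε * s * s ^ (P.q - 2)) * u := by gcongr
    _ = P.mu * (2 * (P.m * P.n * P.ε * P.σ₀ / (2 * (P.η * P.mu * P.normXi)))) := by
        rw [hu, hsdef]; field_simp
    _ ≤ P.mu * (2 * (a * P.logd ^ b * P.T)) := by
        have := G.T_ge
        gcongr
    _ = _ := by ring

lemma Regime.stages_le_firstStage (hC : 144 * 36 ^ (P.q - 2) ≤ C) :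
    ((P.scales.t₁ + P.scales.t₂ : ℕ) : ℝ) ≤ P.firstStage C := by
  have hη := G.η_pos
  have hX := G.X_pos
  have hn := G.n_one
  have hm := G.m_one
  have hσ := G.σ₀_pos
  have hs := G.scale_pos
  have hs1 := G.scale_le_one hq W
  have hXp := Real.rpow_pos_of_pos hX (P.q - 2)
  have hσp := Real.rpow_pos_of_pos hσ (P.q - 2)
  set s := P.σ₀ * P.normXi with hsdef
  have hsp := Real.rpow_pos_of_pos hs (P.q - 2)
  set u := (P.n * P.m : ℝ) / (P.η * P.normXi ^ 2 * P.q * s ^ (P.q - 2)) with hu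
  have hu0 : 0 < u := by positivity
  have h36 : (0 : ℝ) < 36 ^ (P.q - 2) := by positivity
  have hlog : Real.log (s / 36)⁻¹ + 2 ≤ 4 * Real.log (10 / s) := by
    have h1 : Real.log (s / 36)⁻¹ = Real.log (3.6 : ℝ) + Real.log (10 / s) := by
      rw [← Real.log_mul (by norm_num) (by positivity)]
      congr 1; field_simp; norm_num
    have h2 : Real.log (3.6 : ℝ) ≤ 2 := by
      rw [Real.log_le_iff_le_exp (by norm_num)]
      have h4 : (2.7 : ℝ) ≤ Real.exp 1 := by linarith [Real.exp_one_gt_d9]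
      calc (3.6 : ℝ) ≤ 2.7 ^ 2 := by norm_num
        _ ≤ Real.exp 1 ^ 2 := by gcongr
        _ = Real.exp 2 := by rw [← Real.exp_nat_mul]; norm_num
    have h3 : 2 ≤ Real.log (10 / s) := by
      rw [Real.le_log_iff_exp_le (by positivity)]
      have h4 : Real.exp 1 ≤ 2.8 := by linarith [Real.exp_one_lt_d9]
      calc Real.exp 2 = Real.exp 1 ^ 2 := by rw [← Real.exp_nat_mul]; norm_num
        _ ≤ 2.8 ^ 2 := by gcongr
        _ ≤ 10 := by norm_num
        _ ≤ 10 / s := by rw [le_div_iff₀ hs]; linarith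
    linarith
  have hlog1 : 0 ≤ Real.log (s / 36)⁻¹ :=
    Real.log_nonneg ((one_le_inv₀ (by linarith)).2 (by linarith))
  have hlog0 : 0 ≤ Real.log (10 / s) := Real.log_nonneg (by rw [le_div_iff₀ hs]; linarith)
  have h15 : (0.15 : ℝ) ^ (P.q - 2) ≤ 1 := Real.rpow_le_one (by norm_num) (by norm_num) (by linarith)
  have h15' : (0 : ℝ) < 0.15 ^ (P.q - 2) := by positivity
  have hC0 : 0 ≤ C := le_trans (by positivity) hC
  have e : P.firstStage C = C * (4 * Real.log (10 / s)) * u / 0.15 ^ (P.q - 2) := by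
    have h1 : P.normXi ^ P.q = P.normXi ^ 2 * P.normXi ^ (P.q - 2) := by
      rw [← Real.rpow_two, ← Real.rpow_add hX]; congr 1; ring
    rw [firstStage, hu, hsdef, h1, Real.mul_rpow hσ.le hX.le]
    field_simp
  refine (G.stages_le hq W).trans ?_
  calc 2 / P.growth * (Real.log (s / 36)⁻¹ + 2)
      = 144 * 36 ^ (P.q - 2) * (Real.log (s / 36)⁻¹ + 2) * u := by
        rw [div_eq_mul_one_div, G.inv_growth hq, hu]; ring
    _ ≤ C * (4 * Real.log (10 / s)) * u := by gcongr
    _ ≤ _ := by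
        rw [e]
        exact le_div_self (by positivity) h15' h15

lemma Regime.stages_le_T (hC : 144 * 36 ^ (P.q - 2) ≤ C) :
    P.scales.t₁ + P.scales.t₂ ≤ P.scales.T := by
  have h1 := G.stages_le_firstStage hq W hC
  have h2 := G.time
  have hη := G.η_pos
  have hκ := G.κ_pos
  have hΛ := G.Λ_one hq W
  have h3 : 0 ≤ Λ * (P.m ^ 4 * P.n) / (2 * P.normXi ^ 2 * P.η * P.κ) := by positivity
  have h4 : ((P.scales.t₁ + P.scales.t₂ : ℕ) : ℝ) ≤ (P.T : ℝ) := by linarith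
  exact_mod_cast h4

/-- The last stage is long enough to make the training loss smaller than `κ`. -/
lemma Regime.late (hC : 144 * 36 ^ (P.q - 2) ≤ C) :
    P.scales.M < ((P.scales.T : ℝ) - (P.scales.t₁ + P.scales.t₂ : ℕ)) *
      (lateRate P.scales.q * (P.scales.h * P.scales.slo) * (P.κ / (2 * Real.exp 2))) := by
  have hη := G.η_pos
  have hX := G.X_pos
  have hn := G.n_one
  have hm := G.m_one
  have hκ := G.κ_pos
  have hL := G.logd_ge
  have hΛ := G.Λ_one hq W
  have hc := Traj.lateRate_pos hq
  have hE : 0 < marginConst P.q := by unfold marginConst; linarith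
  have hM := G.one_add_M_le
  have h1 : Λ * (P.m ^ 4 * P.n) / (2 * P.normXi ^ 2 * P.η * P.κ) ≤
      (P.scales.T : ℝ) - (P.scales.t₁ + P.scales.t₂ : ℕ) := by
    have h2 := G.time
    have h3 := G.stages_le_firstStage hq W hC
    have h4 : P.scales.T = P.T := rfl
    rw [h4]
    linarith
  have he : Real.exp 2 ≤ 8 := by
    have h4 : Real.exp 1 ≤ 2.8 := by linarith [Real.exp_one_lt_d9]
    calc Real.exp 2 = Real.exp 1 ^ 2 := by rw [← Real.exp_nat_mul]; norm_num
      _ ≤ 2.8 ^ 2 := by gcongr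
      _ ≤ 8 := by norm_num
  have h0 : 0 ≤ lateRate P.scales.q * (P.scales.h * P.scales.slo) * (P.κ / (2 * Real.exp 2)) := by
    change 0 ≤ lateRate P.q * (P.η / ((P.n : ℝ) * P.m) * (P.normXi ^ 2 / 8)) *
      (P.κ / (2 * Real.exp 2))
    positivity
  calc P.scales.M < marginConst P.q * P.logd := by linarith
    _ = 256 * marginConst P.q * P.logd / 256 := by ring
    _ ≤ lateRate P.q * Λ / (32 * Real.exp 2) := by
        have := W.late
        gcongr
        linarith
    _ ≤ lateRate P.q * Λ / (32 * Real.exp 2) * P.m ^ 3 :=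
        le_mul_of_one_le_right (by positivity) (one_le_pow₀ hm)
    _ = Λ * (P.m ^ 4 * P.n) / (2 * P.normXi ^ 2 * P.η * P.κ) *
        (lateRate P.scales.q * (P.scales.h * P.scales.slo) * (P.κ / (2 * Real.exp 2))) := by
        simp only [scales]; field_simp; norm_num
    _ ≤ _ := by gcongr

/-- The scales of the noise-memorization regime fit together. -/
theorem Regime.fits (ha : 1 ≤ a) : P.scales.Fits P.n P.m := by
  have hη := G.η_pos
  have hX := G.X_pos
  have hn := G.n_one
  have hm := G.m_one
  have hL := G.logd_ge
  have hσ := G.σ₀_pos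
  have hV := G.V_pos
  have hs := G.scale_pos
  have hsd := G.sqrt_pos
  have hp := quarterProb_pos
  have hδ0 : 0 ≤ P.scales.δ := by simp only [scales]; positivity
  have hM0 : 1 ≤ P.scales.M := by simp only [scales]; nlinarith
  have hclose := G.close hq W
  have h2q : (1 : ℝ) ≤ 2 ^ P.q := Real.one_le_rpow (by norm_num) (by linarith)
  refine
    { hq := hq
      h_pos := by simp only [scales]; positivity
      n_pos := G.n_pos
      m_pos := G.m_pos
      M_ge := hM0
      δ_nonneg := hδ0
      δ_le := ?_
      x₀_pos := G.x₀_pos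
      x₀_le := G.x₀_le_one hq W
      R_nonneg := by simp only [scales]; positivity
      A_nonneg := by simp only [scales]; positivity
      A_le := ?_
      V_nonneg := by simp only [scales]; positivity
      slo_pos := by simp only [scales]; positivity
      p₁_pos := by simp only [scales]; positivity
      err := ?_
      close := hclose
      step := G.step_fits hq W
      incr_le := G.incr_le hq ha W
      horizon := G.horizon hq ha W
      cross := G.cross hq W
      phase_one := G.phase_one hq W
      phase_two := G.phase_two hq W
      signal := G.signal hq W }
  · have h1 : P.scales.δ ≤ P.q * 2 ^ P.q * P.scales.δ * (1 + P.scales.M) := by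
      have : 1 ≤ P.q * 2 ^ P.q * (1 + P.scales.M) :=
        one_le_mul_of_one_le_of_one_le (one_le_mul_of_one_le_of_one_le (by linarith) h2q)
          (by linarith)
      calc P.scales.δ ≤ P.scales.δ * (P.q * 2 ^ P.q * (1 + P.scales.M)) :=
            le_mul_of_one_le_right hδ0 this
        _ = _ := by ring
    linarith
  · have h1 : P.σ₀ * ‖P.v‖ ≤ P.σ₀ * P.normXi := by
      have := G.V_le_X
      gcongr
    have h2 : 0 ≤ 16 * P.logd * (P.n * (P.m * ((P.q + 8) * P.logd))) / Real.sqrt P.d := by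
      positivity
    have h3 : 4 * P.logd * (P.σ₀ * ‖P.v‖) ≤ 4 * P.logd * (P.σ₀ * P.normXi) := by gcongr
    simp only [scales]
    linarith
  · refine le_of_eq ?_
    simp only [scales]
    field_simp
    ring

end

end Params

end NoisyCNN

namespace NoisyCNN

/-! ### Probability of a typical run -/

namespace Params

section
variable {P : Params} {a : ℝ} {b : ℕ} {C Λ : ℝ} (G : P.Regime a b C Λ) (hq : 2 < P.q)
  (W : Ample P.q a b P.logd Λ)
include G

lemma Regime.noise_scale : P.η * P.sigmaZ * Real.sqrt P.T ≤ P.σ₀ := by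
  have hη := G.η_pos
  have hT : 0 < Real.sqrt P.T := Real.sqrt_pos.2 (by exact_mod_cast G.T_pos)
  have hmu : 0 < P.mu := by linarith [G.mu_ge]
  have e : P.η * P.sigmaZ * Real.sqrt P.T = P.σ₀ / P.mu := by
    unfold sigmaZ; field_simp
  rw [e]
  exact div_le_self G.σ₀_pos.le G.mu_ge

lemma Regime.sqrt_shi : Real.sqrt P.scales.shi = 2 * P.normXi := by
  have e : P.scales.shi = (2 * P.normXi) ^ 2 := by simp only [scales]; ring
  rw [e, Real.sqrt_sq (by linarith [G.X_pos])]

include hq W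

lemma Regime.early_noise : P.η * (P.logd * (P.sigmaZ * Real.sqrt P.scales.shi) *
    Real.sqrt (P.scales.t₁ + P.scales.t₂ : ℕ)) ≤ P.scales.x₀ := by
  have hη := G.η_pos
  have hX := G.X_pos
  have hσ := G.σ₀_pos
  have hL := G.logd_ge
  have hT : 0 < Real.sqrt P.T := Real.sqrt_pos.2 (by exact_mod_cast G.T_pos)
  have hmu : 0 < P.mu := by linarith [G.mu_ge]
  have h1 : 72 * P.logd * Real.sqrt (P.scales.t₁ + P.scales.t₂ : ℕ) ≤ P.mu * Real.sqrt P.T := by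
    refine (sq_le_sq₀ (by positivity) (by positivity)).1 ?_
    rw [mul_pow, mul_pow, mul_pow, Real.sq_sqrt (Nat.cast_nonneg _),
      Real.sq_sqrt (Nat.cast_nonneg _)]
    refine (G.early hq W).trans ?_
    have : P.mu ≤ P.mu ^ 2 := le_self_pow₀ G.mu_ge (by norm_num)
    gcongr
  rw [G.sqrt_shi]
  have e : P.η * (P.logd * (P.sigmaZ * (2 * P.normXi)) *
      Real.sqrt (P.scales.t₁ + P.scales.t₂ : ℕ)) =
      72 * P.logd * Real.sqrt (P.scales.t₁ + P.scales.t₂ : ℕ) / (P.mu * Real.sqrt P.T) *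
        (P.σ₀ * P.normXi / 36) := by
    unfold sigmaZ; field_simp; ring
  rw [e]
  exact mul_le_of_le_one_left G.x₀_pos.le ((div_le_one (by positivity)).2 h1)

/-- Every exceptional event has a probability which is a large negative power of `d`, as
`exp (-(1 + log d) ^ 2 / 2)` is. -/
theorem Regime.not_typical_le (hC : Real.exp 20 ≤ Λ) (hv : P.v ≠ 0)
    (ν : Measure (Weights P.m P.d)) [IsProbabilityMeasure ν]
    (hν : ∀ p, ν.map (fun z => z p) = isoGaussian P.d P.sigmaZ) :
    trainLaw P.n P.v P.σξ P.σ₀ ν {ω | ¬ Typical P.η P.v P.scales ω.1 ω.2.1 ω.2.2} ≤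
      ENNReal.ofReal (1 / (P.d : ℝ)) := by
  have hη := G.η_pos
  have hX := G.X_pos
  have hσ := G.σ₀_pos
  have hL := G.logd_ge
  have hV := G.V_pos
  have hsd := G.sqrt_pos
  have hp := quarterProb_pos
  have hd := G.d_pos'
  have hΛ3 := (G.Λ_ge hq W).1
  have hL2 : P.logd ^ 2 ≤ P.logd ^ 3 := pow_le_pow_right₀ hL (by norm_num)
  have hL1 := pow_le_pow_right₀ hL (show 1 ≤ 3 by norm_num)
  rw [pow_one] at hL1
  have hΛd := G.Λ_le_d
  have hmu : 0 < P.mu := by linarith [G.mu_ge]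
  have hσz : 0 ≤ P.sigmaZ := by unfold sigmaZ; positivity
  have hnoise := G.noise_scale
  have hXsq : P.normXi ^ 2 = P.σξ ^ 2 * P.d := by
    rw [normXi, mul_pow, Real.sq_sqrt hd.le]
  have hsqrt := G.sqrt_shi
  refine (trainLaw_not_typical_le (L := P.logd) hv G.σξ_pos.le hσ hη.le hσz (by linarith) hν
    ?_ ?_ ?_ ?_ ?_ ?_ ?_ ?_ ?_ ?_ rfl).trans ?_
  · change P.normXi ^ 2 / 8 ≤ _
    rw [hXsq]
    nlinarith [sq_nonneg P.σξ]
  · change 0 < P.normXi ^ 2 / 8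
    positivity
  · change _ ≤ 4 * P.normXi ^ 2
    rw [hXsq]
  · rw [hsqrt]
    refine le_of_eq ?_
    change _ = 2 * P.logd * P.normXi ^ 2 / Real.sqrt P.d
    rw [eq_div_iff hsd.ne', normXi]
    ring
  · rw [hsqrt]
    refine le_of_eq ?_
    simp only [scales]; ring
  · rw [hsqrt]
    calc P.η * (P.logd * (P.sigmaZ * (2 * P.normXi)) * Real.sqrt P.scales.T)
        = 2 * P.logd * (P.η * P.sigmaZ * Real.sqrt P.T * P.normXi) := by
          simp only [scales]; ring
      _ ≤ 2 * P.logd * (P.σ₀ * P.normXi) := by gcongr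
  · have h1 : P.normXi / 3 ≤ Real.sqrt P.scales.slo := by
      apply Real.le_sqrt_of_sq_le
      simp only [scales]
      nlinarith [sq_nonneg P.normXi]
    calc 3 * P.scales.x₀ = P.σ₀ * (P.normXi / 3) / 4 := by simp only [scales]; ring
      _ ≤ _ := by gcongr
  · exact G.early_noise hq W
  · refine le_of_eq ?_
    simp only [scales]; ring
  · calc P.η * (P.logd * (P.sigmaZ * ‖P.v‖) * Real.sqrt P.scales.T)
        = P.logd * (P.η * P.sigmaZ * Real.sqrt P.T * ‖P.v‖) := by
          simp only [scales]; ring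
      _ ≤ P.logd * (P.σ₀ * ‖P.v‖) := by gcongr
      _ = _ := by simp only [scales]; ring
  -- all summands are at most `d ^ 2 * d ^ (-10)` up to constants
  set x := ENNReal.ofReal (Real.exp (-(10 * (P.logd - 1)))) with hx
  have hL21 : 21 ≤ P.logd := by
    have h1 : 20 ≤ Real.log P.d := by
      rw [Real.le_log_iff_exp_le hd]
      linarith
    unfold logd; linarith
  have hm100 : 100 * P.logd ≤ quarterProb * P.m := by
    have h1 : 1 ≤ marginConst P.q := by unfold marginConst; linarith
    have h2 : P.logd ≤ P.logd ^ 2 := le_self_pow₀ hL (by norm_num)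
    have h3 : 100 * P.logd ≤ 2304 * marginConst P.q * P.logd ^ 2 := by nlinarith
    have h4 : quarterProb * Λ ≤ quarterProb * P.m := by
      have := G.Λ_le_m
      gcongr
    linarith [W.cross]
  have hx1 : ENNReal.ofReal (Real.exp (-P.logd ^ 2 / 2)) ≤ x := by
    apply ENNReal.ofReal_le_ofReal
    apply Real.exp_le_exp.2
    nlinarith
  have hx2 : ENNReal.ofReal (Real.exp (-(P.d : ℝ) / 4)) ≤ x := by
    apply ENNReal.ofReal_le_ofReal
    apply Real.exp_le_exp.2
    linarith
  have hx3 : ENNReal.ofReal (Real.exp (-(quarterProb * P.m / 10))) ≤ x := by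
    apply ENNReal.ofReal_le_ofReal
    apply Real.exp_le_exp.2
    linarith
  have hn : (P.n : ENNReal) ≤ P.d := by
    have := G.n_le_d
    exact_mod_cast this
  have hm : (P.m : ENNReal) ≤ P.d := by
    have := G.m_le_d
    exact_mod_cast this
  have hd1 : (1 : ENNReal) ≤ P.d := by exact_mod_cast G.d_pos
  have hexp : Real.exp (-(10 * (P.logd - 1))) = ((P.d : ℝ) ^ 10)⁻¹ := by
    rw [Real.exp_neg, show (10 : ℝ) * (P.logd - 1) = ((10 : ℕ) : ℝ) * (P.logd - 1) by norm_num,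
      Real.exp_nat_mul, G.exp_logd]
  calc _ ≤ (P.d : ENNReal) * (2 * x + 2 * x) + P.d * P.d * (2 * x) + 3 * (2 * P.d * P.d * (2 * x)) +
        2 * (2 * P.d * (2 * x)) + 2 * P.d * x := by
        unfold tail
        gcongr
    _ = 14 * (P.d * P.d * x) + 14 * (P.d * 1 * x) := by ring
    _ ≤ 14 * (P.d * P.d * x) + 14 * (P.d * P.d * x) := by gcongr
    _ = ENNReal.ofReal (28 * (P.d * P.d * Real.exp (-(10 * (P.logd - 1))))) := by
        rw [ENNReal.ofReal_mul (by norm_num), ENNReal.ofReal_mul (by positivity),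
          ENNReal.ofReal_mul (by positivity), ENNReal.ofReal_natCast, ← hx,
          show ENNReal.ofReal 28 = 28 by simp]
        ring
    _ ≤ _ := by
        apply ENNReal.ofReal_le_ofReal
        have hd28 : (28 : ℝ) ≤ P.d := by linarith
        rw [hexp, le_div_iff₀ hd, ← div_eq_mul_inv, ← mul_div_assoc, div_mul_eq_mul_div,
          div_le_one (by positivity)]
        calc 28 * ((P.d : ℝ) * P.d) * P.d ≤ P.d * (P.d * P.d) * P.d := by gcongr
          _ = (P.d : ℝ) ^ 4 := by ring
          _ ≤ (P.d : ℝ) ^ 10 := pow_le_pow_right₀ (by linarith) (by norm_num)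

end

/-! ### Losses along a typical run -/

lemma trainLoss_le {m d n : ℕ} (hn : 0 < n) {q κ : ℝ} {D : Fin n → DataPoint d} {W : Weights m d}
    (h : ∀ i, logistic (sgn (D i).2 * net q W (D i).1) ≤ κ) : trainLoss q D W ≤ κ := by
  have hn' : (0 : ℝ) < n := by exact_mod_cast hn
  calc trainLoss q D W ≤ 1 / (n : ℝ) * ∑ _i : Fin n, κ := by
        unfold trainLoss
        gcongr with i _
        exact h i
    _ = κ := by simp; field_simp

lemma logistic_neg_half_le : logistic (-(1 / 2)) ≤ 1 := by
  have h1 := Real.exp_one_gt_d9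
  have h2 := Real.exp_one_lt_d9
  rw [logistic, Real.log_le_iff_le_exp (by positivity)]
  have h3 : Real.exp (-(-(1 / 2))) ≤ 1.7 := by
    refine (sq_le_sq₀ (by positivity) (by norm_num)).1 ?_
    rw [← Real.exp_nat_mul]
    norm_num
    linarith
  linarith

/-- The conclusion holds along every typical run: the signal is never learned, hence the test loss
stays large, while the last iterate (for `κ ≥ 1`, the first one) has small training loss. -/
theorem Regime.losses {P : Params} {a : ℝ} {b : ℕ} {C Λ : ℝ} (G : P.Regime a b C Λ) (hq : 2 < P.q)
    (ha : 1 ≤ a) (W : Ample P.q a b P.logd Λ) (hC : 144 * 36 ^ (P.q - 2) ≤ C)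
    {ω : Outcome P.n P.m P.d} (E : Typical P.η P.v P.scales ω.1 ω.2.1 ω.2.2) :
    ∃ T' ≤ P.T, trainLoss P.q ω.1 (iterate P.q P.η ω T') ≤ P.κ ∧
      ∀ t ≤ T', 0.1 ≤ testLoss P.q P.v P.σξ (iterate P.q P.η ω t) := by
  have H := G.fits hq W ha
  have F : (runTraj P.q P.η P.v ω.1 ω.2.1 ω.2.2).Follows P.scales :=
    E.follows G.η_pos hq rfl rfl H.R_nonneg
  have test : ∀ t ≤ P.T, 0.1 ≤ testLoss P.q P.v P.σξ (iterate P.q P.η ω t) := fun t ht =>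
    testLoss_ge hq G.m_pos _ _ _ fun p =>
      (((F.inv H (t := t) ht).sig_le p).trans H.A_le).trans (by linarith [H.δ_le])
  rcases lt_or_ge P.κ 1 with hκ | hκ
  · refine ⟨P.T, le_rfl, trainLoss_le G.n_pos fun i => ?_, test⟩
    have h := F.margin_ge H G.κ_pos hκ.le (G.stages_le_T hq W hC) (G.late hq W hC) i
    have e := runTraj_margin (q := P.q) (η := P.η) (v := P.v) (W₀ := ω.2.1) (z := ω.2.2)
      E.signal_patch P.T i
    have h' : Real.log P.κ⁻¹ ≤ sgn (ω.1 i).2 * net P.q (iterate P.q P.η ω P.T) (ω.1 i).1 :=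
      h.trans e.le
    calc _ ≤ Real.exp (-(sgn (ω.1 i).2 * net P.q (iterate P.q P.η ω P.T) (ω.1 i).1)) :=
          logistic_le_exp _
      _ ≤ Real.exp (-Real.log P.κ⁻¹) := Real.exp_le_exp.2 (by linarith)
      _ = P.κ := by rw [Real.log_inv, neg_neg, Real.exp_log G.κ_pos]
  · refine ⟨0, Nat.zero_le _, trainLoss_le G.n_pos fun i => ?_, fun t ht => test t (by omega)⟩
    have h1 := (abs_le.1 (F.abs_margin_sub_level H (Nat.zero_le _)
      (F.inv H (Nat.zero_le _)) i)).1
    have h2 := F.level_nonneg H 0 i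
    have e := runTraj_margin (q := P.q) (η := P.η) (v := P.v) (W₀ := ω.2.1) (z := ω.2.2)
      E.signal_patch 0 i
    have h3 : -(1 / 2) ≤ sgn (ω.1 i).2 * net P.q (iterate P.q P.η ω 0) (ω.1 i).1 := by
      refine le_trans ?_ e.le
      have h4 : -(1 / 2) ≤ (runTraj P.q P.η P.v ω.1 ω.2.1 ω.2.2).margin P.scales.q 0 i := by linarith
      exact h4
    exact ((logistic_anti h3).trans logistic_neg_half_le).trans hκ

end Params

end NoisyCNN

end

theorem corollary4p12 (q : ℝ) (hq : 2 < q) (a : ℝ) (ha : 1 ≤ a) (b : ℕ) :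
    ∃ C : ℝ, 0 < C ∧ ∃ k : ℕ, ∀ P : NoisyCNN.Params, P.q = q → P.NoiseMemorization a b C k →
      ∀ (ν : MeasureTheory.Measure (NoisyCNN.Weights P.m P.d))
        [MeasureTheory.IsProbabilityMeasure ν],
        (∀ p, ν.map (fun z => z p) = NoisyCNN.isoGaussian P.d P.sigmaZ) →
        ENNReal.ofReal (1 - 1 / (P.d : ℝ)) ≤
          NoisyCNN.trainLaw P.n P.v P.σξ P.σ₀ ν
            {ω | ∃ T' ≤ P.T,
              NoisyCNN.trainLoss P.q ω.1 (NoisyCNN.iterate P.q P.η ω T') ≤ P.κ ∧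
              ∀ t ≤ T', 0.1 ≤ NoisyCNN.testLoss P.q P.v P.σξ (NoisyCNN.iterate P.q P.η ω t)} := by
  obtain ⟨C, hC1, hC, hCe, k, hk⟩ := NoisyCNN.exists_ample hq ha b
  refine ⟨C, by linarith, k, ?_⟩
  rintro P rfl H ν _ hν
  have G := H.regime hq ha hC1
  have W : NoisyCNN.Ample P.q a b P.logd (P.polylog C k) := hk P.logd G.logd_ge
  have hCΛ : C ≤ P.polylog C k :=
    le_mul_of_one_le_right (by linarith) (one_le_pow₀ G.logd_ge)
  have hbad := G.not_typical_le hq W (hCe.trans hCΛ) H.v_ne ν hν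
  set μ := NoisyCNN.trainLaw P.n P.v P.σξ P.σ₀ ν
  set S := {ω : NoisyCNN.Outcome P.n P.m P.d |
    ¬ NoisyCNN.Typical P.η P.v P.scales ω.1 ω.2.1 ω.2.2}
  have h1 : 1 ≤ μ Sᶜ + μ S := by
    rw [← measure_univ (μ := μ), ← Set.compl_union_self S]
    exact measure_union_le _ _
  have h2 : ENNReal.ofReal (1 - 1 / (P.d : ℝ)) ≤ μ Sᶜ := by
    rw [ENNReal.ofReal_sub _ (by positivity), ENNReal.ofReal_one]
    exact tsub_le_iff_right.2 (h1.trans (by gcongr))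
  refine h2.trans (measure_mono fun ω hω => ?_)
  exact G.losses hq ha W hC (not_not.1 hω)
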